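/- **Setting.** An sc-Banach space $E$ is a Banach space $E=E_0$ with Banach spaces $E_0\supseteq E_1\supseteq E_2\supseteq\cdots$ such that the inclusions $E_{m+1}\hookrightarrow E_m$ are compact and $E_\infty=\bigcap_m E_m$ is dense in every $E_m$; $E^1$ denotes $E_1$ with the levels $(E^1)_m=E_{m+1}$, and $TU=U^1\oplus E$ for $U\subseteq E$. A map $f:U\to F$ on a relatively open subset $U$ of a partial quadrant in $E$ (a set corresponding to $[0,\infty)^n\oplus Q\subseteq\mathbb R^n\oplus Q$ under a linear sc-isomorphism) is $\mathrm{sc}^0$ if it maps $U_m=U\cap E_m$ continuously into $F_m$ for all $m$; it is $\mathrm{sc}^1$ if moreover at every $x\in U_1$ there is $Df(x)\in\mathcal L(E_0,F_0)$ with $\|f(x+h)-f(x)-Df(x)h\|_0/\|h\|_1\to0$ as $\|h\|_1\to 0$ and $Tf(x,h)=(f(x),Df(x)h)$ is an $\mathrm{sc}^0$-map $TU\to TF$; it is sc-smooth if all iterated tangent maps exist in this sense. An sc-operator $T:E\to F$ (linear, bounded $E_m\to F_m$ for all $m$) is sc-Fredholm if there are sc-splittings $E=\ker T\oplus X$, $F=T(X)\oplus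 C$ with $\ker T$ and $C$ finite-dimensional and $T:X\to T(X)$ an sc-isomorphism; its index is $\dim\ker T-\dim C$. A splicing $\mathcal S=(\pi,E,V)$ consists of an open subset $V$ of a partial quadrant in an sc-Banach space $W$ and projections $\pi_v\in\mathcal L(E)$, $v\in V$, with $(v,e)\mapsto\pi_v(e)$ sc-smooth; its core is $K^{\mathcal S}=\{(v,e)\in V\oplus E:\pi_v(e)=e\}$. For $O\subseteq K^{\mathcal S}$ open put $\widehat O=\{(v,e)\in V\oplus E:(v,\pi_v(e))\in O\}$; a map on $O$ is sc-smooth if its composition with $(v,e)\mapsto(v,\pi_v(e))$ is sc-smooth on $\widehat O$. A strong bundle splicing $\mathcal R=(\rho,F,(O,\mathcal S))$ is a family of projections $\rho_{(v,e)}\in\mathcal L(F)$, $(v,e)\in O$, that is sc-smooth both as a map $O\oplus F\to F$ and as a map $O\oplus F^1\to F^1$; its core is $K^{\mathcal R}=\{(w,u)\in O\oplus F:\rho_w(u)=u\}$. A filler for $\mathcal R$ is an sc-diffeomorphism, linear in the fibres and covering the identity of $O$, $$\{((v,e),a): (v,e)\in O,\ a\in\ker\pi_v\}\longrightarrow\{((v,e),y):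 (v,e)\in O,\ y\in\ker\rho_{(v,e)}\},\qquad ((v,e),a)\mapsto((v,e),\phi_{(v,e)}(a)),$$ and its principal part is $\mathbf f^c:\widehat O\to F$, $\mathbf f^c(v,e)=\phi_{(v,\pi_v(e))}(e-\pi_v(e))$. An M-polyfold $X$ is modelled, by sc-smoothly compatible charts, on open subsets of splicing cores, and a strong M-polyfold bundle $p:Y\to X$ is modelled, by fibrewise linear strong bundle charts with transition maps sc-smooth for both filtrations $O\oplus F$ and $O\oplus F^1$, on the bundles $K^{\mathcal R}\to O$. It is fillable if around every point there is a compatible strong bundle chart whose $\mathcal R$ has a filler. An $\mathrm{sc}^+$-section is a section whose local principal parts are sc-smooth as maps into $F^1$. For an sc-smooth section $f$, a smooth point $q\in X_\infty$ and an $\mathrm{sc}^+$-section $s$ defined near $q$ with $s(q)=f(q)$, the linearization is $f'_{[s]}(q)=P_q\circ T(f-s)(q):T_qX\to Y_q$, where $P_q:T_{0_q}Y\cong T_qX\oplus Y_q\to Y_q$ is the projection. **Proposition.** Let $p:Y\to X$ be a fillable strong M-polyfold bundle, $f$ an sc-smooth section, and $q\in X_\infty$ a smooth point. Let $\Phi:Y|U\to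 K^{\mathcal R}$ be a compatible strong bundle chart over an open neighbourhood $U$ of $q$, covering $\varphi:U\to O$, such that $\mathcal R$ has a filler, let $\mathbf f^c$ be the principal part of a filler, let $\mathbf f:\widehat O\to F$, $(v,e)\mapsto\mathbf f(v,e)$, be the principal part of $\Phi_*f$ at $(v,\pi_v(e))$, and let $\bar f$ be the filled version of $f$, i.e. the section of $\widehat O\triangleleft F\to\widehat O$ with principal part $\bar{\mathbf f}=\mathbf f+\mathbf f^c$. Put $(v,e)=\varphi(q)$. Let $s$ be any $\mathrm{sc}^+$-section of $Y$ defined near $q$ with $s(q)=f(q)$, and let $t$ be any $\mathrm{sc}^+$-section of $\widehat O\triangleleft F\to\widehat O$ defined near $(v,e)$, with principal part $\mathbf t$ satisfying $\mathbf t(v,e)=\bar{\mathbf f}(v,e)$. Then $$f'_{[s]}(q):T_qX\to Y_q\ \text{ is sc-Fredholm}\iff \bar f'_{[t]}(v,e)=D(\bar{\mathbf f}-\mathbf t)(v,e):W\oplus E\to F\ \text{ is sc-Fredholm},$$ and in this case the two Fredholm indices are equal. -/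

import Mathlib

open Set Topology

universe u v w

noncomputable section

/-! ### sc-Banach spaces -/

/-- An sc-Banach space: Banach spaces `E₀ ⊇ E₁ ⊇ E₂ ⊇ …`, presented as a sequence of types with
injective compact linear inclusions `step m : E_{m+1} → E_m`, such that `E_∞ = ⋂ E_m` is dense in
every `E_m`.  In `dense`, a point of `E_m` is smooth if it lies in every smaller level, i.e. if
there is a sequence `y` with `y 0` that point and `y k ∈ E_{m+k}` included into `y (k-1)`. -/
structure ScBanach : Type (u + 1) where
  lvl : ℕ → Type u
  [normed : ∀ m, NormedAddCommGroup (lvl m)]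
  [space : ∀ m, NormedSpace ℝ (lvl m)]
  [complete : ∀ m, CompleteSpace (lvl m)]
  step : ∀ m, lvl (m + 1) →L[ℝ] lvl m
  step_injective : ∀ m, Function.Injective (step m)
  step_compact : ∀ m, IsCompactOperator (step m)
  dense : ∀ m, Dense {x : lvl m | ∃ y : ∀ k, lvl (m + k), y 0 = x ∧
    ∀ k, step (m + k) (y (k + 1)) = y k}

attribute [instance] ScBanach.normed ScBanach.space ScBanach.complete

namespace ScBanach

/-- The inclusion `E_m → E₀`. -/
def incl (E : ScBanach.{u}) : ∀ m, E.lvl m →L[ℝ] E.lvl 0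
  | 0 => ContinuousLinearMap.id ℝ _
  | m + 1 => (E.incl m).comp (E.step m)

theorem incl_injective (E : ScBanach.{u}) : ∀ m, Function.Injective (E.incl m)
  | 0 => fun _ _ h => h
  | m + 1 => (E.incl_injective m).comp (E.step_injective m)

/-- `x ∈ E_∞`. -/
def IsSmooth (E : ScBanach.{u}) (x : E.lvl 0) : Prop := ∀ m, ∃ y : E.lvl m, E.incl m y = x

/-- `E ⊕ F`, with `(E ⊕ F)_m = E_m ⊕ F_m`. -/
def prod (E F : ScBanach.{u}) : ScBanach.{u} where
  lvl m := E.lvl m × F.lvl m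
  step m := (E.step m).prodMap (F.step m)
  step_injective m := (E.step_injective m).prodMap (F.step_injective m)
  step_compact m := by
    have h1 : IsCompactOperator (ContinuousLinearMap.inl ℝ (E.lvl m) (F.lvl m) ∘ E.step m ∘
        ContinuousLinearMap.fst ℝ (E.lvl (m + 1)) (F.lvl (m + 1))) :=
      ((E.step_compact m).comp_clm _).clm_comp _
    have h2 : IsCompactOperator (ContinuousLinearMap.inr ℝ (E.lvl m) (F.lvl m) ∘ F.step m ∘
        ContinuousLinearMap.snd ℝ (E.lvl (m + 1)) (F.lvl (m + 1))) :=
      ((F.step_compact m).comp_clm _).clm_comp _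
    have h : ⇑((E.step m).prodMap (F.step m)) =
        (ContinuousLinearMap.inl ℝ (E.lvl m) (F.lvl m) ∘ E.step m ∘
          ContinuousLinearMap.fst ℝ (E.lvl (m + 1)) (F.lvl (m + 1))) +
        (ContinuousLinearMap.inr ℝ (E.lvl m) (F.lvl m) ∘ F.step m ∘
          ContinuousLinearMap.snd ℝ (E.lvl (m + 1)) (F.lvl (m + 1))) := by
      funext x
      simp [Prod.map]
    rw [h]
    exact h1.add h2
  dense m := by
    refine ((E.dense m).prod (F.dense m)).mono ?_
    rintro ⟨x, x'⟩ ⟨⟨y, hy0, hy⟩, ⟨y', hy0', hy'⟩⟩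
    exact ⟨fun k => (y k, y' k), Prod.ext hy0 hy0', fun k => Prod.ext (hy k) (hy' k)⟩

/-- The space `E¹`, with `(E¹)_m = E_{m+1}`. -/
def shift (E : ScBanach.{u}) : ScBanach.{u} where
  lvl m := E.lvl (m + 1)
  step m := E.step (m + 1)
  step_injective m := E.step_injective (m + 1)
  step_compact m := E.step_compact (m + 1)
  dense m := by
    refine (E.dense (m + 1)).mono ?_
    rintro x ⟨y, hy0, hy⟩
    have key : ∀ k, m + 1 + k = m + k + 1 := fun k => by omega
    have hcast : ∀ {a b : ℕ} (h : a = b) (z : E.lvl (a + 1)),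
        E.step b (cast (congrArg (fun n => E.lvl (n + 1)) h) z) =
          cast (congrArg E.lvl h) (E.step a z) := by
      intro a b h z
      subst h
      rfl
    refine ⟨fun k => cast (congrArg E.lvl (key k)) (y k), hy0, fun k => ?_⟩
    have := hcast (key k) (y (k + 1))
    rw [hy k] at this
    exact this

/-- The tangent `TE = E¹ ⊕ E`. -/
def tangent (E : ScBanach.{u}) : ScBanach.{u} := E.shift.prod E

end ScBanach

/-! ### sc-smooth maps

Maps are total functions `E₀ → F₀`; only their values on the stated domain `U ⊆ E₀` matter.  The
domains below are relatively open subsets of partial quadrants. -/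

/-- `f : U → F` is `sc⁰`: it maps `U_m = U ∩ E_m` continuously into `F_m`, for every `m`. -/
def IsScZero (E F : ScBanach.{u}) (U : Set (E.lvl 0)) (f : E.lvl 0 → F.lvl 0) : Prop :=
  ∀ m, ∃ fm : E.lvl m → F.lvl m, ContinuousOn fm (E.incl m ⁻¹' U) ∧
    ∀ x, E.incl m x ∈ U → F.incl m (fm x) = f (E.incl m x)

/-- `D ∈ L(E₀, F₀)` is an sc-derivative of `f : U → F` at `x ∈ U₁`:
`‖f (x + h) - f x - D h‖₀ / ‖h‖₁ → 0` as `‖h‖₁ → 0`, `h ∈ E₁`, `x + h ∈ U₁`. -/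
def HasScDerivAt (E F : ScBanach.{u}) (U : Set (E.lvl 0)) (f : E.lvl 0 → F.lvl 0)
    (x : E.lvl 1) (D : E.lvl 0 →L[ℝ] F.lvl 0) : Prop :=
  HasFDerivWithinAt (fun y : E.lvl 1 => f (E.incl 1 y)) (D.comp (E.incl 1)) (E.incl 1 ⁻¹' U) x

/-- `f : U → F` is of class `sc^k`: it is `sc⁰` and, if `k > 0`, it has an sc-derivative at every
point of `U₁` and its tangent map `Tf (x, h) = (f x, Df(x) h)`, `TU = U¹ ⊕ E → TF = F¹ ⊕ F`, is of
class `sc^{k-1}`. -/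
def IsScDiff : ℕ → ∀ (E F : ScBanach.{u}), Set (E.lvl 0) → (E.lvl 0 → F.lvl 0) → Prop
  | 0, E, F, U, f => IsScZero E F U f
  | k + 1, E, F, U, f => IsScZero E F U f ∧
      ∃ Tf : E.lvl 1 × E.lvl 0 → F.lvl 1 × F.lvl 0,
        (∀ x, E.incl 1 x ∈ U → ∃ D : E.lvl 0 →L[ℝ] F.lvl 0, HasScDerivAt E F U f x D ∧
          ∀ h, F.incl 1 (Tf (x, h)).1 = f (E.incl 1 x) ∧ (Tf (x, h)).2 = D h) ∧
        IsScDiff k E.tangent F.tangent {z : E.lvl 1 × E.lvl 0 | E.incl 1 z.1 ∈ U} Tf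

/-- `f : U → F` is sc-smooth. -/
def ScSmooth (E F : ScBanach.{u}) (U : Set (E.lvl 0)) (f : E.lvl 0 → F.lvl 0) : Prop :=
  ∀ k, IsScDiff k E F U f

/-- `f : U → F` takes values in `F₁` and is sc-smooth as a map `U → F¹`. -/
def ScPlusSmooth (E F : ScBanach.{u}) (U : Set (E.lvl 0)) (f : E.lvl 0 → F.lvl 0) : Prop :=
  ∃ f₁ : E.lvl 0 → F.lvl 1, (∀ x ∈ U, F.incl 1 (f₁ x) = f x) ∧ ScSmooth E F.shift U f₁

/-- `g`, defined on `U ⊕ F`, is sc-smooth as a map `U ⊕ F → F'` and induces an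
sc-smooth map `U ⊕ F¹ → F'¹`. -/
def ScTriSmooth (G F F' : ScBanach.{u}) (U : Set (G.lvl 0))
    (g : G.lvl 0 × F.lvl 0 → F'.lvl 0) : Prop :=
  ScSmooth (G.prod F) F' {z : G.lvl 0 × F.lvl 0 | z.1 ∈ U} g ∧
  ∃ g₁ : G.lvl 0 × F.lvl 1 → F'.lvl 1,
    (∀ x ∈ U, ∀ y, F'.incl 1 (g₁ (x, y)) = g (x, F.incl 1 y)) ∧
    ScSmooth (G.prod F.shift) F'.shift {z : G.lvl 0 × F.lvl 1 | z.1 ∈ U} g₁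

open Classical in
/-- The sc-derivative `Df(x)` of `f : U → F` at `x ∈ U₁` (zero if there is none).  It is unique
when `U` is relatively open in a partial quadrant. -/
def scDeriv (E F : ScBanach.{u}) (U : Set (E.lvl 0)) (f : E.lvl 0 → F.lvl 0) (x : E.lvl 0) :
    E.lvl 0 →L[ℝ] F.lvl 0 :=
  if h : ∃ D : E.lvl 0 →L[ℝ] F.lvl 0, ∃ x₁ : E.lvl 1, E.incl 1 x₁ = x ∧ HasScDerivAt E F U f x₁ D
  then h.choose else 0

/-! ### Linear sc-theory

`ScFiltration E` records levels `E_m ⊆ E` with their topologies.  It is used for sc-Banach spaces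
and also for tangent spaces and fibres of bundles, whose Banach norms are only defined up to
equivalence. -/

structure ScFiltration (E : Type*) [AddCommGroup E] [Module ℝ E] where
  level : ℕ → Submodule ℝ E
  top : ∀ m, TopologicalSpace (level m)

/-- The filtration of `E₀` by the levels `E_m` of an sc-Banach space, each with its own Banach
space topology. -/
def ScBanach.filtration (E : ScBanach.{u}) : ScFiltration (E.lvl 0) where
  level m := LinearMap.range (E.incl m : E.lvl m →ₗ[ℝ] E.lvl 0)
  top m := TopologicalSpace.induced
    (LinearEquiv.ofInjective (E.incl m : E.lvl m →ₗ[ℝ] E.lvl 0) (E.incl_injective m)).symm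
    inferInstance

section Linear

variable {E : Type v} {F : Type w} [AddCommGroup E] [Module ℝ E] [AddCommGroup F] [Module ℝ F]

/-- The initial filtration for a family of linear maps `ev i : E → G_i` into sc-Banach spaces: `x`
is on level `m` if every `ev i x` is, and level `m` has the coarsest topology for which all the
maps `ev i : E_m → (G_i)_m` are continuous. -/
def ScFiltration.initial {ι : Type*} (G : ι → ScBanach.{u}) (ev : ∀ i, E →ₗ[ℝ] (G i).lvl 0) :
    ScFiltration E where
  level m := ⨅ i, ((G i).filtration.level m).comap (ev i)
  top m := ⨅ i, TopologicalSpace.induced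
    (fun x => (⟨ev i x.1, (Submodule.mem_iInf _).1 x.2 i⟩ : (G i).filtration.level m))
    ((G i).filtration.top m)

/-- `T` is an sc-operator: it induces continuous (linear) maps `E_m → F_m` for all `m`. -/
def IsScOperator (A : ScFiltration E) (B : ScFiltration F) (T : E →ₗ[ℝ] F) : Prop :=
  ∀ m, ∃ Tm : A.level m → B.level m, Continuous[A.top m, B.top m] Tm ∧ ∀ x, (Tm x : F) = T x

/-- `K` is an sc-subspace: a closed subspace of `E = E₀` such that the spaces `K_m = K ∩ E_m` form
an sc-structure, that is, `K_∞ = K ∩ E_∞` is dense in every `K_m` (completeness of `K_m` and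
compactness of `K_{m+1} → K_m` are inherited from `E`). -/
def IsScSubspace (A : ScFiltration E) (K : Submodule ℝ E) : Prop :=
  IsClosed[A.top 0] {x : A.level 0 | (x : E) ∈ K} ∧
  ∀ m, {x : A.level m | (x : E) ∈ K} ⊆
    @closure _ (A.top m) {x : A.level m | (x : E) ∈ K ∧ ∀ k, (x : E) ∈ A.level k}

/-- `E = K ⊕_sc X`: both are sc-subspaces, and `E_m = K_m ⊕ X_m` is a topological direct sum on
every level (`P` is the continuous projection onto `K_m` along `X_m`). -/
def IsScSplitting (A : ScFiltration E) (K X : Submodule ℝ E) : Prop :=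
  IsScSubspace A K ∧ IsScSubspace A X ∧ Disjoint K X ∧
  ∀ m, ∃ P : A.level m → A.level m, Continuous[A.top m, A.top m] P ∧
    ∀ x, (P x : E) ∈ K ∧ (x : E) - P x ∈ X

/-- `T` is sc-Fredholm: there are sc-splittings `E = K ⊕ X`, `F = Y ⊕ C` with `K = ker T` and `C`
finite-dimensional, `Y = T(X)`, and `T : X → Y` an sc-isomorphism (`G` is the inverse, on level
`m`). -/
def IsScFredholm (A : ScFiltration E) (B : ScFiltration F) (T : E →ₗ[ℝ] F) : Prop :=
  IsScOperator A B T ∧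
  ∃ (X : Submodule ℝ E) (Y C : Submodule ℝ F),
    IsScSplitting A (LinearMap.ker T) X ∧ IsScSplitting B Y C ∧
    FiniteDimensional ℝ (LinearMap.ker T) ∧ FiniteDimensional ℝ C ∧
    Y = X.map T ∧
    ∀ m, ∃ G : B.level m → A.level m,
      @ContinuousOn _ _ (B.top m) (A.top m) G {y | (y : F) ∈ Y} ∧
      ∀ y : B.level m, (y : F) ∈ Y → (G y : E) ∈ X ∧ T (G y : E) = (y : F)

/-- The Fredholm index `dim ker T - dim coker T`. -/
def fredholmIndex (T : E →ₗ[ℝ] F) : ℤ :=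
  (Module.finrank ℝ (LinearMap.ker T) : ℤ) - Module.finrank ℝ (F ⧸ LinearMap.range T)

end Linear

/-! ### Splicings and local M-polyfold models -/

/-- `C ⊆ W` is a partial quadrant: some linear sc-isomorphism `W → ℝⁿ ⊕ Q`, given by its
restrictions `T m` to the levels, maps `C` onto `[0,∞)ⁿ ⊕ Q`. -/
def IsPartialQuadrant (W : ScBanach.{u}) (C : Set (W.lvl 0)) : Prop :=
  ∃ (n : ℕ) (Q : ScBanach.{u}) (T : ∀ m, W.lvl m ≃L[ℝ] (Fin n → ℝ) × Q.lvl m),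
    (∀ m x, T m (W.step m x) = ((T (m + 1) x).1, Q.step m (T (m + 1) x).2)) ∧
    C = {x | ∀ i, 0 ≤ (T 0 x).1 i}

/-- An sc-smooth splicing `(π, E, V)`, with `V` an open subset of the partial quadrant `C ⊆ W`. -/
structure Splicing : Type (u + 1) where
  W : ScBanach.{u}
  E : ScBanach.{u}
  C : Set (W.lvl 0)
  isPartialQuadrant : IsPartialQuadrant W C
  V : Set (W.lvl 0)
  isOpen_V : ∃ G, IsOpen G ∧ V = C ∩ G
  π : W.lvl 0 → E.lvl 0 →L[ℝ] E.lvl 0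
  π_proj : ∀ v ∈ V, ∀ e, π v (π v e) = π v e
  π_smooth : ScSmooth (W.prod E) E {z : W.lvl 0 × E.lvl 0 | z.1 ∈ V}
    (fun z : W.lvl 0 × E.lvl 0 => π z.1 z.2)

namespace Splicing

/-- The ambient sc-Banach space `W ⊕ E`. -/
abbrev amb (S : Splicing.{u}) : ScBanach.{u} := S.W.prod S.E

/-- The splicing core `K^S = {(v, e) | v ∈ V, π_v e = e}`. -/
def core (S : Splicing.{u}) : Set (S.amb.lvl 0) :=
  {z : S.W.lvl 0 × S.E.lvl 0 | z.1 ∈ S.V ∧ S.π z.1 z.2 = z.2}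

/-- The map `(v, e) ↦ (v, π_v e)`. -/
def retr (S : Splicing.{u}) (z : S.amb.lvl 0) : S.amb.lvl 0 :=
  ((z.1, S.π z.1 z.2) : S.W.lvl 0 × S.E.lvl 0)

/-- `Ô = {(v, e) ∈ V ⊕ E | (v, π_v e) ∈ O}`. -/
def hat (S : Splicing.{u}) (O : Set (S.amb.lvl 0)) : Set (S.amb.lvl 0) :=
  {z | z.1 ∈ S.V ∧ S.retr z ∈ O}

/-- For `O` open in the splicing core: `f : O → G` is sc-smooth, i.e. `(v, e) ↦ f (v, π_v e)` is
sc-smooth on `Ô`. -/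
def SmoothOn (S : Splicing.{u}) (O : Set (S.amb.lvl 0)) (G : ScBanach.{u})
    (f : S.amb.lvl 0 → G.lvl 0) : Prop :=
  ScSmooth S.amb G (S.hat O) (fun z => f (S.retr z))

/-- The tangent map `Tf(z)` of `f : O → G` at `z ∈ O₁`; it is meant to be applied to vectors in
the tangent space at `z`. -/
def tangentMap (S : Splicing.{u}) (O : Set (S.amb.lvl 0)) (G : ScBanach.{u})
    (f : S.amb.lvl 0 → G.lvl 0) (z : S.amb.lvl 0) : S.amb.lvl 0 →L[ℝ] G.lvl 0 :=
  scDeriv S.amb G (S.hat O) (fun x => f (S.retr x)) z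

/-- The tangent space at `z = (v, e)` of an open subset of the splicing core: all `(δv, δe)` with
`δe = Dπ(v, e)(δv, δe)`. -/
def tangentSpace (S : Splicing.{u}) (z : S.amb.lvl 0) : Submodule ℝ (S.amb.lvl 0) :=
  LinearMap.eqLocus
    (scDeriv S.amb S.E {x : S.W.lvl 0 × S.E.lvl 0 | x.1 ∈ S.V}
      (fun x : S.W.lvl 0 × S.E.lvl 0 => S.π x.1 x.2) z : S.amb.lvl 0 →ₗ[ℝ] S.E.lvl 0)
    (LinearMap.snd ℝ (S.W.lvl 0) (S.E.lvl 0))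

end Splicing

/-! ### M-polyfolds -/

/-- An M-polyfold chart `(U, φ, S)`: a homeomorphism `φ` from the open set `U = source` onto an
open subset `O = target` of the splicing core of `S`. -/
structure MPolyfoldChart (X : Type v) [TopologicalSpace X] : Type (max v (u + 1)) where
  S : Splicing.{u}
  φ : PartialEquiv X (S.amb.lvl 0)
  open_source : IsOpen φ.source
  open_target : ∃ G, IsOpen G ∧ φ.target = S.core ∩ G
  continuousOn_φ : ContinuousOn φ φ.source
  continuousOn_symm : ContinuousOn φ.symm φ.target

namespace MPolyfoldChart

variable {X : Type v} [TopologicalSpace X]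

/-- The domain `φ(U ∩ U')` of the transition map from `c` to `c'`. -/
def overlap (c c' : MPolyfoldChart.{u} X) : Set (c.S.amb.lvl 0) :=
  c.φ '' (c.φ.source ∩ c'.φ.source)

/-- The transition map `φ' ∘ φ⁻¹`. -/
def transition (c c' : MPolyfoldChart.{u} X) (z : c.S.amb.lvl 0) : c'.S.amb.lvl 0 :=
  c'.φ (c.φ.symm z)

/-- The transition maps between `c` and `c'` are sc-smooth. -/
def Compatible (c c' : MPolyfoldChart.{u} X) : Prop :=
  c.S.SmoothOn (c.overlap c') c'.S.amb (c.transition c') ∧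
  c'.S.SmoothOn (c'.overlap c) c.S.amb (c'.transition c)

end MPolyfoldChart

/-- An M-polyfold structure on `X`, given by an atlas of compatible charts. -/
structure MPolyfold (X : Type v) [TopologicalSpace X] where
  atlas : Set (MPolyfoldChart.{u} X)
  cover : ∀ x, ∃ c ∈ atlas, x ∈ c.φ.source
  compatible : ∀ c ∈ atlas, ∀ c' ∈ atlas, c.Compatible c'

namespace MPolyfold

variable {X : Type v} [TopologicalSpace X]

/-- The maximal atlas: all charts compatible with the charts of the given atlas. -/
def maximalAtlas (M : MPolyfold.{u} X) : Set (MPolyfoldChart.{u} X) :=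
  {c | ∀ c' ∈ M.atlas, c.Compatible c'}

/-- The charts (of the maximal atlas) around `q`. -/
def ChartAt (M : MPolyfold.{u} X) (q : X) : Type (max v (u + 1)) :=
  {c : MPolyfoldChart.{u} X // c ∈ M.maximalAtlas ∧ q ∈ c.φ.source}

/-- `q ∈ X_∞`. -/
def IsSmoothPoint (M : MPolyfold.{u} X) (q : X) : Prop :=
  ∀ c : M.ChartAt q, c.1.S.amb.IsSmooth (c.1.φ q)

/-- The tangent space `T_qX`.  A tangent vector (an equivalence class of pairs consisting of a
chart around `q` and a vector `h ∈ T_{φ(q)}O`) is given by its representatives `h c` in all charts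
`c` around `q`, which correspond to each other under the tangent maps of the transition maps. -/
def TangentSpace (M : MPolyfold.{u} X) (q : X) :
    Submodule ℝ (∀ c : M.ChartAt q, c.1.S.amb.lvl 0) where
  carrier := {h | (∀ c : M.ChartAt q, h c ∈ c.1.S.tangentSpace (c.1.φ q)) ∧
    ∀ c c' : M.ChartAt q, c.1.S.tangentMap (c.1.overlap c'.1) c'.1.S.amb (c.1.transition c'.1) (c.1.φ q) (h c)
      = h c'}
  add_mem' := fun {a b} ha hb => ⟨fun c => add_mem (ha.1 c) (hb.1 c), fun c c' => by
    rw [Pi.add_apply, map_add, ha.2 c c', hb.2 c c', Pi.add_apply]⟩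
  zero_mem' := ⟨fun _ => zero_mem _, fun c c' => by
    rw [Pi.zero_apply, map_zero, Pi.zero_apply]⟩
  smul_mem' := fun r a ha => ⟨fun c => Submodule.smul_mem _ r (ha.1 c), fun c c' => by
    rw [Pi.smul_apply, map_smul, ha.2 c c', Pi.smul_apply]⟩

/-- The representative of a tangent vector in a chart. -/
def tangentCoord (M : MPolyfold.{u} X) (q : X) (c : M.ChartAt q) :
    M.TangentSpace q →ₗ[ℝ] c.1.S.amb.lvl 0 :=
  (LinearMap.proj c).comp (M.TangentSpace q).subtype

/-- The levels of `T_qX` (for `q` a smooth point), inherited from `W ⊕ E` through the charts. -/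
def tangentFiltration (M : MPolyfold.{u} X) (q : X) : ScFiltration (M.TangentSpace q) :=
  ScFiltration.initial (fun c : M.ChartAt q => c.1.S.amb) (M.tangentCoord q)

end MPolyfold

/-! ### Strong bundle splicings and fillers -/

/-- A strong bundle splicing `(ρ, F, (O, S))`: projections `ρ_z` of `F`, `z ∈ O`, such that `ρ` is
sc-smooth as a map `O ⊕ F → F` and as a map `O ⊕ F¹ → F¹`. -/
structure StrongBundleSplicing (S : Splicing.{u}) (O : Set (S.amb.lvl 0)) : Type (u + 1) where
  F : ScBanach.{u}
  ρ : S.amb.lvl 0 → F.lvl 0 →L[ℝ] F.lvl 0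
  ρ_proj : ∀ z ∈ O, ∀ y, ρ z (ρ z y) = ρ z y
  ρ_smooth : ScTriSmooth S.amb F F (S.hat O) (fun x => ρ (S.retr x.1) x.2)

/-- A filler for the strong bundle splicing `R` over `O`: an sc-diffeomorphism
`K^{s^*S^c} → K^{R^c}(0)` of the form `(z, a) ↦ (z, toFun z a)`, where
`K^{s^*S^c} = {(z, a) | z = (v, e) ∈ O, a ∈ ker π_v}` and `K^{R^c} = {(z, y) | z ∈ O, y ∈ ker ρ_z}`,
linear in the fibres.  Only the values of `toFun z` on `ker π_v` and of `invFun z` on `ker ρ_z`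
matter; sc-smoothness of the two maps is, as always, that of their compositions with the
projections onto the splicing cores. -/
structure Filler {S : Splicing.{u}} {O : Set (S.amb.lvl 0)} (R : StrongBundleSplicing S O) where
  toFun : S.amb.lvl 0 → S.E.lvl 0 →ₗ[ℝ] R.F.lvl 0
  invFun : S.amb.lvl 0 → R.F.lvl 0 →ₗ[ℝ] S.E.lvl 0
  map_toFun : ∀ z ∈ O, ∀ a, S.π z.1 a = 0 → R.ρ z (toFun z a) = 0
  map_invFun : ∀ z ∈ O, ∀ y, R.ρ z y = 0 → S.π z.1 (invFun z y) = 0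
  left_inv : ∀ z ∈ O, ∀ a, S.π z.1 a = 0 → invFun z (toFun z a) = a
  right_inv : ∀ z ∈ O, ∀ y, R.ρ z y = 0 → toFun z (invFun z y) = y
  smooth_toFun : ScSmooth (S.amb.prod S.E) R.F {x : S.amb.lvl 0 × S.E.lvl 0 | x.1 ∈ S.hat O}
    (fun x : S.amb.lvl 0 × S.E.lvl 0 => toFun (S.retr x.1) (x.2 - S.π x.1.1 x.2))
  smooth_invFun : ScSmooth (S.amb.prod R.F) S.E {x : S.amb.lvl 0 × R.F.lvl 0 | x.1 ∈ S.hat O}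
    (fun x : S.amb.lvl 0 × R.F.lvl 0 => invFun (S.retr x.1) (x.2 - R.ρ (S.retr x.1) x.2))

/-- The principal part `Ô → F`, `(v, e) ↦ f^c((v, π_v e), (1 - π_v) e)`, of a filler. -/
def Filler.principal {S : Splicing.{u}} {O : Set (S.amb.lvl 0)} {R : StrongBundleSplicing S O}
    (fc : Filler R) (z : S.amb.lvl 0) : R.F.lvl 0 :=
  fc.toFun (S.retr z) (z.2 - S.π z.1 z.2)

/-! ### Strong M-polyfold bundles -/

/-- A strong bundle chart for the bundle with fibres `Y x`, `x ∈ X`, and total space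
`Bundle.TotalSpace Unit Y = {(x, y) | y ∈ Y x}` (the argument `Unit` is irrelevant): a homeomorphism
`Φ : (x, y) ↦ (φ x, fib x y)` from `p⁻¹(U)` onto `K^R = {(z, y) | z ∈ O, ρ_z y = y}`, linear in the
fibres and covering the chart `φ : U → O`.  The map `fibInv x` is `Φ_x⁻¹ ∘ ρ_{φ(x)} : F → Y x`; the
axioms say that `fib x` is a bijection from `Y x` onto `im ρ_{φ(x)}` and determine `fibInv x`. -/
structure StrongBundleChart (X : Type v) [TopologicalSpace X] (Y : X → Type w)
    [∀ x, AddCommGroup (Y x)] [∀ x, Module ℝ (Y x)]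
    [TopologicalSpace (Bundle.TotalSpace Unit Y)] : Type (max v w (u + 1)) where
  base : MPolyfoldChart.{u} X
  R : StrongBundleSplicing base.S base.φ.target
  fib : ∀ x, Y x →ₗ[ℝ] R.F.lvl 0
  fibInv : ∀ x, R.F.lvl 0 →ₗ[ℝ] Y x
  fibInv_fib : ∀ x ∈ base.φ.source, ∀ y, fibInv x (fib x y) = y
  fib_fibInv : ∀ x ∈ base.φ.source, ∀ y, fib x (fibInv x y) = R.ρ (base.φ x) y
  isEmbedding : Topology.IsEmbedding
    (fun a : {a : Bundle.TotalSpace Unit Y // a.1 ∈ base.φ.source} =>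
      ((base.φ a.1.1, fib a.1.1 a.1.2) : base.S.amb.lvl 0 × R.F.lvl 0))

namespace StrongBundleChart

variable {X : Type v} [TopologicalSpace X] {Y : X → Type w}
  [∀ x, AddCommGroup (Y x)] [∀ x, Module ℝ (Y x)] [TopologicalSpace (Bundle.TotalSpace Unit Y)]

/-- The transition map from `c` to `c'`, of the form
`(z, y) ↦ (φ'(φ⁻¹ z), Φ'_x (Φ_x⁻¹ y))` with `x = φ⁻¹ z`, is an `sc_◁`-smooth strong bundle map: it is
sc-smooth as a map `K(0) → K'(0)` and as a map `K(1) → K'(1)`. -/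
def SmoothTransition (c c' : StrongBundleChart.{u} X Y) : Prop :=
  c.base.S.SmoothOn (c.base.overlap c'.base) c'.base.S.amb (c.base.transition c'.base) ∧
  ScTriSmooth c.base.S.amb c.R.F c'.R.F (c.base.S.hat (c.base.overlap c'.base))
    (fun a => c'.fib (c.base.φ.symm (c.base.S.retr a.1))
      (c.fibInv (c.base.φ.symm (c.base.S.retr a.1)) a.2))

/-- The principal part `O → F` of the local representation of a section. -/
def localRep (c : StrongBundleChart.{u} X Y) (f : ∀ x, Y x) (z : c.base.S.amb.lvl 0) :
    c.R.F.lvl 0 :=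
  c.fib (c.base.φ.symm z) (f (c.base.φ.symm z))

/-- The principal part `Ô → F` of the filled version of the section `f`:
`(v, e) ↦ f(v, π_v e) + f^c(v, e)`. -/
def filled (c : StrongBundleChart.{u} X Y) (fc : Filler c.R) (f : ∀ x, Y x)
    (z : c.base.S.amb.lvl 0) : c.R.F.lvl 0 :=
  c.localRep f (c.base.S.retr z) + fc.principal z

/-- The linearization `W ⊕ E → F` at `z` of the filled version of `f` with respect to an
`sc⁺`-section of `Ô ◁ F → Ô` with principal part `t`. -/
def filledLinearization (c : StrongBundleChart.{u} X Y) (fc : Filler c.R) (f : ∀ x, Y x)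
    (t : c.base.S.amb.lvl 0 → c.R.F.lvl 0) (z : c.base.S.amb.lvl 0) :
    c.base.S.amb.lvl 0 →L[ℝ] c.R.F.lvl 0 :=
  scDeriv c.base.S.amb c.R.F (c.base.S.hat c.base.φ.target) (fun x => c.filled fc f x - t x) z

end StrongBundleChart

/-- A strong M-polyfold bundle `p : Y → X` over the M-polyfold `X`, given by an atlas of strong
bundle charts. -/
structure StrongBundle {X : Type v} [TopologicalSpace X] (M : MPolyfold.{u} X) (Y : X → Type w)
    [∀ x, AddCommGroup (Y x)] [∀ x, Module ℝ (Y x)]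
    [TopologicalSpace (Bundle.TotalSpace Unit Y)] where
  continuous_proj : Continuous (Bundle.TotalSpace.proj : Bundle.TotalSpace Unit Y → X)
  atlas : Set (StrongBundleChart.{u} X Y)
  base_mem : ∀ c ∈ atlas, c.base ∈ M.maximalAtlas
  cover : ∀ x, ∃ c ∈ atlas, x ∈ c.base.φ.source
  compatible : ∀ c ∈ atlas, ∀ c' ∈ atlas, c.SmoothTransition c'

namespace StrongBundle

variable {X : Type v} [TopologicalSpace X] {M : MPolyfold.{u} X} {Y : X → Type w}
  [∀ x, AddCommGroup (Y x)] [∀ x, Module ℝ (Y x)] [TopologicalSpace (Bundle.TotalSpace Unit Y)]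

/-- All strong bundle charts compatible with the structure. -/
def maximalAtlas (B : StrongBundle M Y) : Set (StrongBundleChart.{u} X Y) :=
  {c | c.base ∈ M.maximalAtlas ∧
    ∀ c' ∈ B.atlas, c.SmoothTransition c' ∧ c'.SmoothTransition c}

/-- The strong bundle charts around `q`. -/
def ChartAt (B : StrongBundle M Y) (q : X) : Type (max v w (u + 1)) :=
  {c : StrongBundleChart.{u} X Y // c ∈ B.maximalAtlas ∧ q ∈ c.base.φ.source}

/-- The underlying chart of the M-polyfold `X`. -/
def ChartAt.toBase {B : StrongBundle M Y} {q : X} (c : B.ChartAt q) : M.ChartAt q :=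
  ⟨c.1.base, c.2.1.1, c.2.2⟩

/-- Some strong bundle chart around `q`. -/
def someChart (B : StrongBundle M Y) (q : X) : B.ChartAt q :=
  ⟨(B.cover q).choose,
    ⟨B.base_mem _ (B.cover q).choose_spec.1, fun c' hc' =>
      ⟨B.compatible _ (B.cover q).choose_spec.1 c' hc',
        B.compatible c' hc' _ (B.cover q).choose_spec.1⟩⟩,
    (B.cover q).choose_spec.2⟩

/-- The levels of the fibre `Y_q` (for `q` a smooth point), inherited from `F` through the strong
bundle charts. -/
def fiberFiltration (B : StrongBundle M Y) (q : X) : ScFiltration (Y q) :=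
  ScFiltration.initial (fun c : B.ChartAt q => c.1.R.F) (fun c => c.1.fib q)

/-- The bundle is fillable: around every point there is a compatible strong bundle chart whose
strong bundle splicing has a filler. -/
def IsFillable (B : StrongBundle M Y) : Prop := ∀ q, ∃ c : B.ChartAt q, Nonempty (Filler c.1.R)

/-- `f` is an sc-smooth section of the bundle. -/
def IsScSmoothSection (B : StrongBundle M Y) (f : ∀ x, Y x) : Prop :=
  ∀ c ∈ B.maximalAtlas, c.base.S.SmoothOn c.base.φ.target c.R.F (c.localRep f)

/-- `s` is an `sc⁺`-section over the open set `N`. -/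
def IsScPlusSectionOn (B : StrongBundle M Y) (N : Set X) (s : ∀ x, Y x) : Prop :=
  ∀ c ∈ B.maximalAtlas, ScPlusSmooth c.base.S.amb c.R.F
    (c.base.S.hat (c.base.φ '' (c.base.φ.source ∩ N))) (fun z => c.localRep s (c.base.S.retr z))

/-- The linearization `f'_{[s]}(q) = P_q ∘ T(f - s)(q) : T_qX → Y_q` of the section `f` at `q` with
respect to a section `s` near `q` with `s(q) = f(q)`, computed in some strong bundle chart around
`q` (the result does not depend on the chart). -/
def linearization (B : StrongBundle M Y) (f s : ∀ x, Y x) (q : X) :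
    M.TangentSpace q →ₗ[ℝ] Y q :=
  let c := B.someChart q
  ((c.1.fibInv q).comp
    (c.1.base.S.tangentMap c.1.base.φ.target c.1.R.F (c.1.localRep (fun x => f x - s x))
      (c.1.base.φ q) : c.1.base.S.amb.lvl 0 →ₗ[ℝ] c.1.R.F.lvl 0)).comp
    (M.tangentCoord q c.toBase)

end StrongBundle

end

/-! Work in the chart, with `z = φ(q) = (v, e)`, `r(v, e) = (v, π_v e)` and `P = Dr(z)`.
Differentiating `r ∘ r = r` shows that `P` is idempotent; its range is the tangent space and its
kernel is `0 ⊕ ker π_v`. Let `A` be the derivative at `z` of the local representative of `f - s`,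
precomposed with `r`. Then `A ∘ P = A`. As `f - s` vanishes at `q`, differentiating the fact that
`ρ` fixes its representative gives `ρ_z ∘ A = A`: the term containing the derivative of `ρ` is
evaluated at the zero vector. For the same reason, with `e - π_v e = 0`, the filler has derivative
`Φ δ = φ_z(δ₂ - (P δ)₂)`. So `A + Φ` is block diagonal for `W ⊕ E = im P ⊕ ker P` and `F = im ρ_z ⊕
ker ρ_z`. One block is `f'_{[s]}(q)`; the other is the sc-isomorphism `φ_z : ker π_v → ker ρ_z`
(`StrongBundle.exists_isScBlock`). The filled linearization differs from `A + Φ` by the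
`sc⁺`-operator `Ds - Dt`. What remains is that neither an invertible complementary block nor an
`sc⁺`-perturbation affects the sc-Fredholm property or the index.

For this, sc-Fredholm is replaced by the existence of a parametrix, an inverse modulo finite rank
operators with smooth values (`isScFredholm_iff_exists_parametrix`). Parametrices pass between an
operator and its block by explicit formulas (`IsScBlock.exists_parametrix_iff`). For an
`sc⁺`-operator `K` and a parametrix `S` of `T`, `S ∘ K` is compact on `E_0`, so Riesz theory and the
density of `E_∞` give a finite rank `R` with smooth values for which `1 + S ∘ K + R` is invertible.
The inverse preserves all levels by bootstrapping, and composed with `S` it is a parametrix of `T +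
K` (`ScBanach.exists_parametrix_add`). The index is controlled because `S ∘ T` is the identity minus
a finite rank operator, so it has index zero.

The derivatives above need the sc-chain rule, although sc-smooth maps need not be differentiable on
a fixed level. Compactness of `E_1 → E_0` replaces norm continuity of the derivative
(`hasFDerivWithinAt_comp_of_compact`). At a smooth point the derivative is moreover an sc-operator
(`ScSmooth.exists_germ`), and `ScSmooth.germ_fibre_comp` is the product rule at a zero. -/

/-! ### Operators between filtered spaces -/

section FilteredOperators

variable {E E' : Type*} [AddCommGroup E] [Module ℝ E] [AddCommGroup E'] [Module ℝ E']
variable {F F' : Type*} [AddCommGroup F] [Module ℝ F] [AddCommGroup F'] [Module ℝ F']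

attribute [local instance] ScFiltration.top

/-- The smooth vectors `E_∞ = ⋂ E_m`. -/
def ScFiltration.smooth (A : ScFiltration E) : Submodule ℝ E := ⨅ k, A.level k

theorem ScFiltration.mem_smooth {A : ScFiltration E} {x : E} :
    x ∈ A.smooth ↔ ∀ k, x ∈ A.level k := Submodule.mem_iInf _

/-- The levels are Hausdorff topological vector spaces, level `0` is everything, and the smooth
vectors are dense in every level. -/
structure ScFiltration.IsRegular (A : ScFiltration E) : Prop where
  level_zero : A.level 0 = ⊤
  addGroup : ∀ m, IsTopologicalAddGroup (A.level m)
  smul : ∀ m, ContinuousSMul ℝ (A.level m)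
  t2 : ∀ m, T2Space (A.level m)
  dense : ∀ m, Dense {x : A.level m | (x : E) ∈ A.smooth}

theorem isScOperator_iff {A : ScFiltration E} {B : ScFiltration F} {T : E →ₗ[ℝ] F} :
    IsScOperator A B T ↔
      ∀ m, ∃ h : ∀ x ∈ A.level m, T x ∈ B.level m, Continuous (T.restrict h) := by
  constructor
  · intro h m
    obtain ⟨Tm, hc, hT⟩ := h m
    refine ⟨fun x hx => hT ⟨x, hx⟩ ▸ (Tm ⟨x, hx⟩).2, ?_⟩
    convert hc using 1
    ext x
    simp [hT]
  · intro h m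
    obtain ⟨h1, h2⟩ := h m
    exact ⟨_, h2, fun x => rfl⟩

namespace IsScOperator

variable {A : ScFiltration E} {B : ScFiltration F} {A' : ScFiltration E'}

theorem mem_level {T : E →ₗ[ℝ] F} (h : IsScOperator A B T) {m : ℕ} {x : E}
    (hx : x ∈ A.level m) : T x ∈ B.level m := (isScOperator_iff.1 h m).1 x hx

theorem mem_smooth {T : E →ₗ[ℝ] F} (h : IsScOperator A B T) {x : E}
    (hx : x ∈ A.smooth) : T x ∈ B.smooth :=
  ScFiltration.mem_smooth.2 fun k => h.mem_level (ScFiltration.mem_smooth.1 hx k)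

theorem id : IsScOperator A A LinearMap.id := fun _ => ⟨_root_.id, continuous_id, fun _ => rfl⟩

theorem comp {T : E →ₗ[ℝ] F} {S : E' →ₗ[ℝ] E} (hT : IsScOperator A B T)
    (hS : IsScOperator A' A S) : IsScOperator A' B (T ∘ₗ S) := by
  intro m
  obtain ⟨Tm, hTc, hTm⟩ := hT m
  obtain ⟨Sm, hSc, hSm⟩ := hS m
  exact ⟨Tm ∘ Sm, hTc.comp hSc, fun x => by simp [hTm, hSm]⟩

theorem add (hB : B.IsRegular) {T S : E →ₗ[ℝ] F} (hT : IsScOperator A B T)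
    (hS : IsScOperator A B S) : IsScOperator A B (T + S) := by
  intro m
  obtain ⟨Tm, hTc, hTm⟩ := hT m
  obtain ⟨Sm, hSc, hSm⟩ := hS m
  have := hB.addGroup m
  exact ⟨fun x => Tm x + Sm x, hTc.add hSc, fun x => by simp [hTm, hSm]⟩

theorem sub (hB : B.IsRegular) {T S : E →ₗ[ℝ] F} (hT : IsScOperator A B T)
    (hS : IsScOperator A B S) : IsScOperator A B (T - S) := by
  intro m
  obtain ⟨Tm, hTc, hTm⟩ := hT m
  obtain ⟨Sm, hSc, hSm⟩ := hS m
  have := hB.addGroup m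
  exact ⟨fun x => Tm x - Sm x, hTc.sub hSc, fun x => by simp [hTm, hSm]⟩

end IsScOperator

/-- `R` has finite rank and takes values in `E_∞`. -/
def IsSmoothFinite (A : ScFiltration E) (R : F →ₗ[ℝ] E) : Prop :=
  FiniteDimensional ℝ (LinearMap.range R) ∧ ∀ x, R x ∈ A.smooth

namespace IsSmoothFinite

variable {A : ScFiltration E} {B : ScFiltration F} {A' : ScFiltration E'}

theorem comp_left {R : F →ₗ[ℝ] E} (hR : IsSmoothFinite A R) {T : E →ₗ[ℝ] E'}
    (hT : ∀ x, T (R x) ∈ A'.smooth) : IsSmoothFinite A' (T ∘ₗ R) := by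
  have := hR.1
  refine ⟨?_, hT⟩
  rw [LinearMap.range_comp]
  infer_instance

theorem comp_right {R : F →ₗ[ℝ] E} (hR : IsSmoothFinite A R) (T : F' →ₗ[ℝ] F) :
    IsSmoothFinite A (R ∘ₗ T) := by
  have := hR.1
  exact ⟨Submodule.finiteDimensional_of_le (LinearMap.range_comp_le_range T R), fun x => hR.2 _⟩

theorem add {R S : F →ₗ[ℝ] E} (hR : IsSmoothFinite A R) (hS : IsSmoothFinite A S) :
    IsSmoothFinite A (R + S) := by
  have := hR.1
  have := hS.1
  exact ⟨Submodule.finiteDimensional_of_le (LinearMap.range_add_le R S),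
    fun x => A.smooth.add_mem (hR.2 x) (hS.2 x)⟩

theorem smul {R : F →ₗ[ℝ] E} (hR : IsSmoothFinite A R) (r : ℝ) : IsSmoothFinite A (r • R) :=
  have := hR.1
  ⟨Submodule.finiteDimensional_of_le (S₂ := LinearMap.range R)
    (by rintro _ ⟨x, rfl⟩; exact ⟨r • x, map_smul R r x⟩), fun x => A.smooth.smul_mem r (hR.2 x)⟩

/-- Post-composing a finite rank sc-operator with any linear map which keeps the values smooth
gives an sc-operator. -/
theorem isScOperator_comp {R : E →ₗ[ℝ] E'} (hA' : A'.IsRegular) (hB : B.IsRegular)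
    (hR : IsSmoothFinite A' R) (hRsc : IsScOperator A A' R) {T : E' →ₗ[ℝ] F}
    (hT : ∀ x, T (R x) ∈ B.smooth) : IsScOperator A B (T ∘ₗ R) := by
  rw [isScOperator_iff] at hRsc ⊢
  intro m
  obtain ⟨h, hc⟩ := hRsc m
  have := hA'.addGroup m
  have := hA'.smul m
  have := hA'.t2 m
  have := hB.addGroup m
  have := hB.smul m
  have := hR.1
  let V : Submodule ℝ (A'.level m) := (LinearMap.range R).comap (A'.level m).subtype
  have hfin : FiniteDimensional ℝ V :=
    FiniteDimensional.of_injective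
      ((A'.level m).subtype.restrict (p := V) (q := LinearMap.range R) fun x hx => hx)
      fun x y hxy => by
        apply Subtype.ext; apply Subtype.ext
        exact congrArg (fun z : LinearMap.range R => (z : E')) hxy
  have hTm : ∀ x : V, T (x : A'.level m) ∈ B.level m := by
    rintro ⟨x, y, hy⟩
    have := hT y
    rw [hy] at this
    exact ScFiltration.mem_smooth.1 this m
  let t : V →ₗ[ℝ] B.level m :=
    (T ∘ₗ (A'.level m).subtype ∘ₗ V.subtype).codRestrict (B.level m) hTm
  -- `V` is finite-dimensional and Hausdorff in the topology of level `m`, so continuity is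
  -- automatic here even though `T` itself carries none.
  have ht : Continuous t := t.continuous_of_finiteDimensional
  have hm : ∀ x ∈ A.level m, (T ∘ₗ R) x ∈ B.level m :=
    fun x _ => ScFiltration.mem_smooth.1 (hT x) m
  refine ⟨hm, ?_⟩
  exact ht.comp (hc.subtype_mk fun x => ⟨x, rfl⟩ :
    Continuous fun x : A.level m => (⟨R.restrict h x, ⟨x, rfl⟩⟩ : V))

end IsSmoothFinite

/-! ### Parametrices and sc-Fredholm splittings -/

/-- `S` inverts the sc-operator `T` up to finite rank operators with smooth values. -/
structure IsScParametrix (A : ScFiltration E) (B : ScFiltration F) (T : E →ₗ[ℝ] F)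
    (S : F →ₗ[ℝ] E) : Prop where
  left : IsScOperator A B T
  right : IsScOperator B A S
  comp_left : IsSmoothFinite A (LinearMap.id - S ∘ₗ T)
  comp_right : IsSmoothFinite B (LinearMap.id - T ∘ₗ S)

/-- For an idempotent sc-operator `Q`, the map `1 - Q` fixes `ker Q` and sends the dense set of
smooth vectors to smooth vectors of `ker Q`; this gives the density required of an sc-subspace. The
range of `P` is treated as the kernel of `1 - P`. -/
theorem isScSplitting_of_idempotent {A : ScFiltration E} (hA : A.IsRegular) {P : E →ₗ[ℝ] E}
    (hP : IsScOperator A A P) (hPP : ∀ x, P (P x) = P x) :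
    IsScSplitting A (LinearMap.range P) (LinearMap.ker P) := by
  have aux : ∀ Q : E →ₗ[ℝ] E, IsScOperator A A Q → (∀ x, Q (Q x) = Q x) →
      IsScSubspace A (LinearMap.ker Q) := by
    intro Q hQ hQQ
    rw [isScOperator_iff] at hQ
    constructor
    · obtain ⟨h, hc⟩ := hQ 0
      have := hA.t2 0
      convert isClosed_eq hc (continuous_const (y := (0 : A.level 0))) using 1
      ext x
      simp [Subtype.ext_iff]
    · intro m x hx
      obtain ⟨h, hc⟩ := hQ m
      have := hA.addGroup m
      have hc' : Continuous fun y : A.level m => y - Q.restrict h y := continuous_id.sub hc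
      have hx' : x - Q.restrict h x = x := by
        apply Subtype.ext
        have : Q (x : E) = 0 := hx
        simp [this]
      rw [← hx']
      refine closure_mono ?_ (image_closure_subset_closure_image hc'
        ⟨x, hA.dense m x, rfl⟩)
      rintro _ ⟨y, hy, rfl⟩
      refine ⟨?_, ?_⟩
      · simp [hQQ]
      · intro k
        have hk := ScFiltration.mem_smooth.1 hy k
        exact (A.level k).sub_mem hk ((hQ k).1 _ hk)
  have hr : LinearMap.range P = LinearMap.ker (LinearMap.id - P) := by
    ext x
    constructor
    · rintro ⟨y, rfl⟩
      simp [hPP]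
    · intro hx
      exact ⟨x, (sub_eq_zero.1 hx).symm⟩
  refine ⟨?_, aux P hP hPP, ?_, ?_⟩
  · rw [hr]
    refine aux _ (IsScOperator.id.sub hA hP) fun x => ?_
    simp [hPP]
  · rw [Submodule.disjoint_def]
    rintro _ ⟨y, rfl⟩ hy
    rw [LinearMap.mem_ker, hPP] at hy
    exact hy
  · intro m
    obtain ⟨Pm, hc, hPm⟩ := hP m
    refine ⟨Pm, hc, fun x => ⟨?_, ?_⟩⟩
    · rw [hPm]
      exact ⟨_, rfl⟩
    · rw [hPm, LinearMap.mem_ker, map_sub, hPP, sub_self]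

/-- The defect `R₁` is the identity on `ker T`, and `T ∘ S + R₂ = 1` shows that `range T` has a
complement inside the range of `R₂`. Kernel and complement are therefore finite-dimensional with
smooth vectors, and sc-projections onto them come from algebraic projections composed with the
defects. -/
theorem IsScParametrix.isScFredholm {A : ScFiltration E} {B : ScFiltration F} {T : E →ₗ[ℝ] F}
    {S : F →ₗ[ℝ] E} (hA : A.IsRegular) (hB : B.IsRegular) (h : IsScParametrix A B T S) :
    IsScFredholm A B T := by
  set R₁ : E →ₗ[ℝ] E := LinearMap.id - S ∘ₗ T with hR₁
  set R₂ : F →ₗ[ℝ] F := LinearMap.id - T ∘ₗ S with hR₂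
  have e₁ : ∀ x, x = S (T x) + R₁ x := fun x => by simp [hR₁]
  have e₂ : ∀ y, y = T (S y) + R₂ y := fun y => by simp [hR₂]
  have scR₁ : IsScOperator A A R₁ := IsScOperator.id.sub hA (h.right.comp h.left)
  have scR₂ : IsScOperator B B R₂ := IsScOperator.id.sub hB (h.left.comp h.right)
  have kR₁ : ∀ x ∈ LinearMap.ker T, R₁ x = x := fun x hx => by
    rw [LinearMap.mem_ker] at hx
    simp [hR₁, hx]
  have := h.comp_left.1
  have := h.comp_right.1
  have hkfin : FiniteDimensional ℝ (LinearMap.ker T) :=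
    Submodule.finiteDimensional_of_le
      (show LinearMap.ker T ≤ LinearMap.range R₁ from fun x hx => ⟨x, kR₁ x hx⟩)
  obtain ⟨X₀, hX₀⟩ := (LinearMap.ker T).exists_isCompl
  set p := (LinearMap.ker T).projection X₀ hX₀ with hp
  have hpk : ∀ x, T (p x) = 0 := fun x => Submodule.projection_apply_mem hX₀ x
  set P : E →ₗ[ℝ] E := p ∘ₗ R₁ with hPdef
  -- The algebraic projection `p` may be discontinuous. Composing with `R₁`, which is the identity
  -- on `ker T`, keeps it a projection onto `ker T` and makes it a finite rank sc-operator.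
  have kP : ∀ x, T x = 0 → P x = x := fun x hx => by
    rw [hPdef, LinearMap.comp_apply, kR₁ x hx]
    exact Submodule.projection_apply_of_mem_left hX₀ hx
  have hTP : ∀ x, T (P x) = 0 := fun x => hpk _
  have scP : IsScOperator A A P :=
    h.comp_left.isScOperator_comp hA hA scR₁ fun x => by
      rw [← kR₁ _ (hpk (R₁ x))]
      exact h.comp_left.2 _
  have hPP : ∀ x, P (P x) = P x := fun x => kP _ (hTP x)
  have rP : LinearMap.range P = LinearMap.ker T := by
    ext x
    exact ⟨by rintro ⟨y, rfl⟩; exact hTP y, fun hx => ⟨x, kP x hx⟩⟩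
  have hcod : Codisjoint (LinearMap.range T) (LinearMap.range R₂) := by
    rw [codisjoint_iff, eq_top_iff]
    intro y _
    rw [e₂ y]
    exact Submodule.add_mem_sup ⟨_, rfl⟩ ⟨_, rfl⟩
  obtain ⟨C, hCR, hC⟩ : ∃ C ≤ LinearMap.range R₂, IsCompl (LinearMap.range T) C := by
    obtain ⟨C, hC1, hC2⟩ := hcod.symm.exists_isCompl
    exact ⟨C, hC1, hC2.symm⟩
  set q' := C.projection (LinearMap.range T) hC.symm with hq'
  set Q : F →ₗ[ℝ] F := q' ∘ₗ R₂ with hQdef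
  have hq'T : ∀ x, q' (T x) = 0 := fun x =>
    (Submodule.projection_apply_eq_zero_iff hC.symm).2 ⟨x, rfl⟩
  -- `q'` kills `range T`, so by `y = T (S y) + R₂ y` nothing is lost by inserting `R₂`, which is
  -- what makes `q'` an sc-operator.
  have hQq : ∀ y, Q y = q' y := fun y => by
    conv_rhs => rw [e₂ y]
    rw [map_add, hq'T, zero_add]
    rfl
  have hQC : ∀ y, Q y ∈ C := fun y => Submodule.projection_apply_mem hC.symm _
  have hQT : ∀ x, Q (T x) = 0 := fun x => by rw [hQq, hq'T]
  have hQQ : ∀ y, Q (Q y) = Q y := fun y => by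
    rw [hQq (Q y)]
    exact Submodule.projection_apply_of_mem_left hC.symm (hQC y)
  have rQ : LinearMap.range Q = C := by
    ext y
    refine ⟨by rintro ⟨y, rfl⟩; exact hQC y, fun hy => ⟨y, ?_⟩⟩
    rw [hQq]
    exact Submodule.projection_apply_of_mem_left hC.symm hy
  have kQ : LinearMap.ker Q = LinearMap.range T := by
    ext y
    rw [LinearMap.mem_ker, hQq]
    exact Submodule.projection_apply_eq_zero_iff hC.symm
  have scQ : IsScOperator B B Q :=
    h.comp_right.isScOperator_comp hB hB scR₂ fun x => by
      obtain ⟨y, hy⟩ := hCR (hQC x)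
      change Q x ∈ _
      rw [← hy]
      exact h.comp_right.2 _
  set Q' : F →ₗ[ℝ] F := LinearMap.id - Q with hQ'
  have scQ' : IsScOperator B B Q' := IsScOperator.id.sub hB scQ
  obtain ⟨g, hg⟩ := (T ∘ₗ (LinearMap.ker P).subtype).exists_leftInverse_of_injective (by
    rw [LinearMap.ker_eq_bot']
    rintro ⟨x, hx⟩ hx'
    apply Subtype.ext
    change x = 0
    rw [← kP x hx']
    exact hx)
  have hg' : ∀ x (hx : P x = 0), g (T x) = ⟨x, hx⟩ := fun x hx =>
    LinearMap.congr_fun hg ⟨x, hx⟩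
  have hgY : ∀ y, Q y = 0 → ∃ x, P x = 0 ∧ T x = y := by
    intro y hy
    obtain ⟨x, rfl⟩ : y ∈ LinearMap.range T := kQ ▸ hy
    exact ⟨x - P x, by rw [map_sub, hPP, sub_self], by rw [map_sub, hTP, sub_zero]⟩
  -- Regularity: if `T x` is smooth, so is `x = S (T x) + R₁ x`.
  have hsm : ∀ y, ((LinearMap.ker P).subtype ∘ₗ g ∘ₗ Q') (R₂ y) ∈ A.smooth := by
    intro y
    have h1 : Q' (R₂ y) ∈ B.smooth := scQ'.mem_smooth (h.comp_right.2 y)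
    obtain ⟨x, hx, hxy⟩ := hgY (Q' (R₂ y)) (by simp [hQ', hQQ])
    rw [← hxy] at h1
    have h2 : ((LinearMap.ker P).subtype ∘ₗ g ∘ₗ Q') (R₂ y) = x := by
      change ((g (Q' (R₂ y)) : LinearMap.ker P) : E) = x
      rw [← hxy, hg' x hx]
    rw [h2, e₁ x]
    exact A.smooth.add_mem (h.right.mem_smooth h1) (h.comp_left.2 x)
  -- The algebraic inverse `g` need not be continuous, so it is used only on the finite rank part
  -- `R₂`; `S` handles the rest, corrected by `1 - P` to land in `ker P`.
  set G : F →ₗ[ℝ] E := (LinearMap.id - P) ∘ₗ S +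
    ((LinearMap.ker P).subtype ∘ₗ g ∘ₗ Q') ∘ₗ R₂ with hG
  have scG : IsScOperator B A G :=
    ((IsScOperator.id.sub hA scP).comp h.right).add hA
      (h.comp_right.isScOperator_comp hB hA scR₂ hsm)
  have hGT : ∀ x, P x = 0 → G (T x) = x := by
    intro x hx
    have h1 : R₂ (T x) = T (R₁ x - P (R₁ x)) := by
      rw [map_sub, hTP, sub_zero]
      simp [hR₁, hR₂]
    have h2 : Q' (R₂ (T x)) = T (R₁ x - P (R₁ x)) := by
      simp [h1, hQ', hQT]
    have h3 : G (T x) = (S (T x) - P (S (T x))) +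
        ((g (Q' (R₂ (T x))) : LinearMap.ker P) : E) := rfl
    rw [h3, h2, hg' _ (by rw [map_sub, hPP, sub_self])]
    have h4 : x - P x = (S (T x) + R₁ x) - P (S (T x) + R₁ x) := by rw [← e₁ x]
    rw [hx, sub_zero, map_add] at h4
    exact (add_sub_add_comm _ _ _ _).symm.trans h4.symm
  have hY : LinearMap.range T = (LinearMap.ker P).map T := by
    ext y
    constructor
    · rintro hy
      rw [← kQ] at hy
      exact hgY y hy
    · rintro ⟨x, -, rfl⟩
      exact ⟨x, rfl⟩
  refine ⟨h.left, LinearMap.ker P, LinearMap.range T, C, ?_, ?_, hkfin, ?_, hY, ?_⟩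
  · rw [← rP]
    exact isScSplitting_of_idempotent hA scP hPP
  · have h1 := isScSplitting_of_idempotent hB scQ' (fun x => by simp [hQ', hQQ])
    have h2 : LinearMap.range Q' = LinearMap.range T := by
      rw [← kQ]
      ext y
      refine ⟨by rintro ⟨z, rfl⟩; simp [hQ', hQQ], fun hy => ⟨y, ?_⟩⟩
      rw [LinearMap.mem_ker] at hy
      simp [hQ', hy]
    have h3 : LinearMap.ker Q' = C := by
      rw [← rQ]
      ext y
      refine ⟨fun hy => ⟨y, (sub_eq_zero.1 hy).symm⟩, ?_⟩
      rintro ⟨z, rfl⟩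
      simp [hQ', hQQ]
    rwa [h2, h3] at h1
  · exact Submodule.finiteDimensional_of_le hCR
  · intro m
    obtain ⟨Gm, hc, hGm⟩ := scG m
    refine ⟨Gm, hc.continuousOn, fun y hy => ?_⟩
    rw [← kQ] at hy
    obtain ⟨x, hx, hxy⟩ := hgY y hy
    rw [hGm, ← hxy, hGT x hx]
    exact ⟨hx, rfl⟩

/-- The smooth vectors of `K` form a finite-dimensional, hence closed, subspace of level `0`, and
they are dense in `K`. -/
theorem IsScSubspace.le_smooth {A : ScFiltration E} (hA : A.IsRegular) {K : Submodule ℝ E}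
    (hK : IsScSubspace A K) [FiniteDimensional ℝ K] : K ≤ A.smooth := by
  have := hA.addGroup 0
  have := hA.smul 0
  have := hA.t2 0
  let V : Submodule ℝ (A.level 0) := (K ⊓ A.smooth).comap (A.level 0).subtype
  have hfin : FiniteDimensional ℝ V :=
    FiniteDimensional.of_injective
      ((A.level 0).subtype.restrict (p := V) (q := K) fun x hx => hx.1)
      fun x y hxy => by
        apply Subtype.ext; apply Subtype.ext
        exact congrArg (fun z : K => (z : E)) hxy
  have hcl : IsClosed (V : Set (A.level 0)) := V.closed_of_finiteDimensional
  intro x hx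
  have hx0 : x ∈ A.level 0 := by rw [hA.level_zero]; trivial
  have h1 := hK.2 0 (show (⟨x, hx0⟩ : A.level 0) ∈ {x : A.level 0 | (x : E) ∈ K} from hx)
  have h2 : {x : A.level 0 | (x : E) ∈ K ∧ ∀ k, (x : E) ∈ A.level k} = V := by
    ext y
    exact and_congr Iff.rfl ScFiltration.mem_smooth.symm
  rw [h2, hcl.closure_eq] at h1
  exact h1.2

/-- The splitting is unique, so the projections given level by level are all restrictions of the
single algebraic projection onto `K` along `X`. -/
theorem IsScSplitting.exists_projection {A : ScFiltration E} (hA : A.IsRegular)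
    {K X : Submodule ℝ E} (h : IsScSplitting A K X) :
    ∃ P : E →ₗ[ℝ] E, IsScOperator A A P ∧ (∀ x, P x ∈ K) ∧ ∀ x, x - P x ∈ X := by
  have hc : IsCompl K X := by
    refine ⟨h.2.2.1, ?_⟩
    rw [codisjoint_iff, eq_top_iff]
    intro x _
    obtain ⟨P, -, hP⟩ := h.2.2.2 0
    have hx0 : x ∈ A.level 0 := by rw [hA.level_zero]; trivial
    have := Submodule.add_mem_sup (hP ⟨x, hx0⟩).1 (hP ⟨x, hx0⟩).2
    simpa using this
  refine ⟨K.projection X hc, fun m => ?_, Submodule.projection_apply_mem hc,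
    Submodule.sub_projection_mem hc⟩
  obtain ⟨P, hPc, hP⟩ := h.2.2.2 m
  refine ⟨P, hPc, fun x => ?_⟩
  have h1 : K.projection X hc x = K.projection X hc (P x + (x - P x)) := by simp
  rw [h1, map_add, Submodule.projection_apply_of_mem_left hc (hP x).1,
    (Submodule.projection_apply_eq_zero_iff hc).2 (hP x).2, add_zero]

/-- Invert `T : X → Y` after projecting onto `Y`. The two defects are then the projections onto `ker
T` and `C`, whose values are smooth because finite-dimensional sc-subspaces consist of smooth
vectors. -/
theorem IsScFredholm.exists_parametrix {A : ScFiltration E} {B : ScFiltration F} {T : E →ₗ[ℝ] F}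
    (hA : A.IsRegular) (hB : B.IsRegular) (h : IsScFredholm A B T) :
    ∃ S, IsScParametrix A B T S := by
  obtain ⟨hT, X, Y, C, hKX, hYC, hKf, hCf, rfl, hG⟩ := h
  obtain ⟨P, scP, hPK, hPX⟩ := hKX.exists_projection hA
  obtain ⟨Q, scQ, hQY, hQC⟩ := hYC.exists_projection hB
  have hTP : ∀ x, T (P x) = 0 := hPK
  obtain ⟨g, hg⟩ := (T ∘ₗ X.subtype).exists_leftInverse_of_injective (by
    rw [LinearMap.ker_eq_bot']
    rintro ⟨x, hx⟩ hx'
    apply Subtype.ext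
    exact Submodule.disjoint_def.1 hKX.2.2.1 x hx' hx)
  have hgX : ∀ x ∈ X, (g (T x) : E) = x := fun x hx =>
    congrArg Subtype.val (LinearMap.congr_fun hg ⟨x, hx⟩)
  have hQT : ∀ x, Q (T x) = T x := by
    intro x
    have h1 : T x - Q (T x) ∈ X.map T := by
      refine Submodule.sub_mem _ ⟨x - P x, hPX x, ?_⟩ (hQY _)
      rw [map_sub, hTP, sub_zero]
    have := Submodule.disjoint_def.1 hYC.2.2.1 _ h1 (hQC _)
    exact (sub_eq_zero.1 this).symm
  have hR₁ : LinearMap.id - (X.subtype ∘ₗ g ∘ₗ Q) ∘ₗ T = P := by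
    ext x
    change x - (g (Q (T x)) : E) = P x
    have : T x = T (x - P x) := by rw [map_sub, hTP, sub_zero]
    rw [hQT, this, hgX _ (hPX x)]
    exact sub_sub_cancel x (P x)
  have hR₂ : LinearMap.id - T ∘ₗ (X.subtype ∘ₗ g ∘ₗ Q) = LinearMap.id - Q := by
    ext y
    change y - T (g (Q y) : E) = y - Q y
    obtain ⟨x, hx, hxy⟩ := hQY y
    rw [← hxy, hgX x hx]
  refine ⟨X.subtype ∘ₗ g ∘ₗ Q, hT, ?_, ?_, ?_⟩
  · intro m
    obtain ⟨Gm, hGc, hGm⟩ := hG m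
    obtain ⟨Qm, hQc, hQm⟩ := scQ m
    have hmem : ∀ y, (Qm y : F) ∈ X.map T := fun y => by
      rw [hQm]
      exact hQY _
    refine ⟨fun y => Gm (Qm y), ?_, fun y => ?_⟩
    · rw [← continuousOn_univ]
      exact hGc.comp hQc.continuousOn fun y _ => hmem y
    · obtain ⟨h1, h2⟩ := hGm (Qm y) (hmem y)
      change (Gm (Qm y) : E) = (g (Q y) : E)
      rw [← hQm, ← h2, hgX _ h1]
  · rw [hR₁]
    have hle : LinearMap.range P ≤ LinearMap.ker T := by
      rintro _ ⟨x, rfl⟩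
      exact hPK x
    exact ⟨Submodule.finiteDimensional_of_le hle, fun x => hKX.1.le_smooth hA (hPK x)⟩
  · rw [hR₂]
    have hle : LinearMap.range (LinearMap.id - Q) ≤ C := by
      rintro _ ⟨x, rfl⟩
      exact hQC x
    exact ⟨Submodule.finiteDimensional_of_le hle, fun x => hYC.2.1.le_smooth hB (hQC x)⟩

theorem isScFredholm_iff_exists_parametrix {A : ScFiltration E} {B : ScFiltration F}
    {T : E →ₗ[ℝ] F} (hA : A.IsRegular) (hB : B.IsRegular) :
    IsScFredholm A B T ↔ ∃ S, IsScParametrix A B T S :=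
  ⟨fun h => h.exists_parametrix hA hB, fun ⟨_, h⟩ => h.isScFredholm hA hB⟩

end FilteredOperators

/-! ### The index -/

section Index

variable {E F : Type*} [AddCommGroup E] [Module ℝ E] [AddCommGroup F] [Module ℝ F]

/-- Linear maps `a : E → F`, `b : F → E` which intertwine `T` and `T'` and are inverse to each
other modulo the ranges induce an isomorphism of cokernels. -/
theorem finrank_coker_eq {E₁ E₂ F₁ F₂ : Type*} [AddCommGroup E₁] [Module ℝ E₁]
    [AddCommGroup E₂] [Module ℝ E₂] [AddCommGroup F₁] [Module ℝ F₁] [AddCommGroup F₂] [Module ℝ F₂]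
    {T₁ : E₁ →ₗ[ℝ] F₁} {T₂ : E₂ →ₗ[ℝ] F₂} (a : F₁ →ₗ[ℝ] F₂) (b : F₂ →ₗ[ℝ] F₁)
    (ha : ∀ x, a (T₁ x) ∈ LinearMap.range T₂) (hb : ∀ x, b (T₂ x) ∈ LinearMap.range T₁)
    (hba : ∀ y, b (a y) - y ∈ LinearMap.range T₁) (hab : ∀ y, a (b y) - y ∈ LinearMap.range T₂) :
    Module.finrank ℝ (F₁ ⧸ LinearMap.range T₁) = Module.finrank ℝ (F₂ ⧸ LinearMap.range T₂) := by
  let a' := (LinearMap.range T₁).mapQ (LinearMap.range T₂) a (by rintro _ ⟨x, rfl⟩; exact ha x)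
  let b' := (LinearMap.range T₂).mapQ (LinearMap.range T₁) b (by rintro _ ⟨x, rfl⟩; exact hb x)
  refine (LinearEquiv.ofLinearMap a' b' ?_ ?_).finrank_eq
  · ext y
    exact (Submodule.Quotient.eq _).2 (hab y)
  · ext y
    exact (Submodule.Quotient.eq _).2 (hba y)

theorem finrank_ker_eq {E₁ E₂ F₁ F₂ : Type*} [AddCommGroup E₁] [Module ℝ E₁]
    [AddCommGroup E₂] [Module ℝ E₂] [AddCommGroup F₁] [Module ℝ F₁] [AddCommGroup F₂] [Module ℝ F₂]
    {T₁ : E₁ →ₗ[ℝ] F₁} {T₂ : E₂ →ₗ[ℝ] F₂} (a : E₁ →ₗ[ℝ] E₂) (b : E₂ →ₗ[ℝ] E₁)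
    (ha : ∀ x, T₁ x = 0 → T₂ (a x) = 0) (hb : ∀ x, T₂ x = 0 → T₁ (b x) = 0)
    (hba : ∀ x, T₁ x = 0 → b (a x) = x) (hab : ∀ x, T₂ x = 0 → a (b x) = x) :
    Module.finrank ℝ (LinearMap.ker T₁) = Module.finrank ℝ (LinearMap.ker T₂) := by
  refine (LinearEquiv.ofLinearMap (a.restrict (p := LinearMap.ker T₁) (q := LinearMap.ker T₂) ha)
    (b.restrict (p := LinearMap.ker T₂) (q := LinearMap.ker T₁) hb) ?_ ?_).finrank_eq
  · ext x
    exact hab x x.2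
  · ext x
    exact hba x x.2

/-- `1 - R` and its restriction to `range R` have the same kernel and cokernel, and an endomorphism
of a finite-dimensional space has index zero. -/
theorem index_id_sub_of_finiteDimensional_range (R : E →ₗ[ℝ] E)
    [FiniteDimensional ℝ (LinearMap.range R)] :
    (LinearMap.id - R).index = 0 := by
  set V := LinearMap.range R
  let r : E →ₗ[ℝ] V := R.rangeRestrict
  have hr : ∀ x, (r x : E) = R x := fun x => rfl
  let R' : V →ₗ[ℝ] V := LinearMap.id - r ∘ₗ V.subtype
  have h0 : R'.index = 0 := by
    rw [LinearMap.index_eq_of_finiteDimensional, sub_self]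
  rw [LinearMap.index_eq_finrank_sub] at h0 ⊢
  rw [← h0]
  congr 2
  · refine finrank_ker_eq r V.subtype ?_ ?_ ?_ ?_
    · intro x hx
      have hx' : x = R x := sub_eq_zero.1 hx
      apply Subtype.ext
      change R x - R (R x) = 0
      rw [← hx', ← hx', sub_self]
    · intro x hx
      exact congrArg Subtype.val hx
    · intro x hx
      exact (sub_eq_zero.1 hx).symm
    · intro x hx
      exact (sub_eq_zero.1 hx).symm
  · refine finrank_coker_eq r V.subtype ?_ ?_ ?_ ?_
    · intro x
      refine ⟨r x, ?_⟩
      apply Subtype.ext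
      change R x - R (R x) = R (x - R x)
      rw [map_sub]
    · intro x
      exact ⟨x, rfl⟩
    · intro x
      exact ⟨-x, by change -x - R (-x) = R x - x; rw [map_neg]; abel⟩
    · intro x
      exact ⟨-x, by
        apply Subtype.ext
        change -(x : E) - R (-x) = R x - x
        rw [map_neg]; abel⟩

theorem finiteDimensional_ker_of_comp {T : E →ₗ[ℝ] F} {S : F →ₗ[ℝ] E}
    [FiniteDimensional ℝ (LinearMap.range (LinearMap.id - S ∘ₗ T))] :
    FiniteDimensional ℝ (LinearMap.ker T) :=
  Submodule.finiteDimensional_of_le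
    (show LinearMap.ker T ≤ LinearMap.range (LinearMap.id - S ∘ₗ T) from
      fun x hx => ⟨x, by rw [LinearMap.mem_ker] at hx; simp [hx]⟩)

theorem finiteDimensional_coker_of_comp {T : E →ₗ[ℝ] F} {S : F →ₗ[ℝ] E}
    [FiniteDimensional ℝ (LinearMap.range (LinearMap.id - T ∘ₗ S))] :
    FiniteDimensional ℝ (F ⧸ LinearMap.range T) := by
  refine Module.Finite.of_surjective
    ((LinearMap.range T).mkQ ∘ₗ (LinearMap.range (LinearMap.id - T ∘ₗ S)).subtype) ?_
  intro y
  obtain ⟨y, rfl⟩ := (LinearMap.range T).mkQ_surjective y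
  refine ⟨⟨y - T (S y), ⟨y, rfl⟩⟩, ?_⟩
  refine (Submodule.Quotient.eq _).2 ⟨-S y, ?_⟩
  change T (-S y) = y - T (S y) - y
  rw [map_neg]
  abel

/-- The index is additive under composition, and `S ∘ T` is the identity minus a finite rank
operator. -/
theorem IsScParametrix.index_add {A : ScFiltration E} {B : ScFiltration F} {T : E →ₗ[ℝ] F}
    {S : F →ₗ[ℝ] E} (h : IsScParametrix A B T S) : S.index + T.index = 0 := by
  have := h.comp_left.1
  have := h.comp_right.1
  have := finiteDimensional_ker_of_comp (T := T) (S := S)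
  have := finiteDimensional_ker_of_comp (T := S) (S := T)
  have := finiteDimensional_coker_of_comp (T := T) (S := S)
  have := finiteDimensional_coker_of_comp (T := S) (S := T)
  rw [← LinearMap.index_comp]
  have h1 : S ∘ₗ T = LinearMap.id - (LinearMap.id - S ∘ₗ T) := (sub_sub_cancel _ _).symm
  rw [h1]
  exact index_id_sub_of_finiteDimensional_range _

theorem index_equiv_comp {G : Type*} [AddCommGroup G] [Module ℝ G] (M : F ≃ₗ[ℝ] G)
    (T : E →ₗ[ℝ] F) : (M.toLinearMap ∘ₗ T).index = T.index := by
  rw [LinearMap.index_eq_finrank_sub, LinearMap.index_eq_finrank_sub]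
  congr 2
  · exact finrank_ker_eq LinearMap.id LinearMap.id (fun x hx => by simpa using hx)
      (fun x hx => by simp [hx]) (fun _ _ => rfl) (fun _ _ => rfl)
  · exact finrank_coker_eq M.symm.toLinearMap M.toLinearMap (fun x => ⟨x, by simp⟩)
      (fun x => ⟨x, rfl⟩) (fun x => ⟨0, by simp⟩) (fun x => ⟨0, by simp⟩)

end Index

/-! ### Compact perturbations of the identity -/

section Riesz

variable {X : Type*} [NormedAddCommGroup X] [NormedSpace ℝ X]

/-- If `T = 1 + L` is surjective but not injective, the kernels of its powers increase strictly.
Riesz's lemma then gives a bounded sequence whose images under `L` keep distance at least `1` from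
each other, which compactness forbids. -/
theorem injective_of_surjective_id_add_compact {L : X →L[ℝ] X} (hL : IsCompactOperator L)
    (hs : Function.Surjective (ContinuousLinearMap.id ℝ X + L)) :
    Function.Injective (ContinuousLinearMap.id ℝ X + L) := by
  set T : X →L[ℝ] X := ContinuousLinearMap.id ℝ X + L with hT
  have hTL : ∀ x, L x = T x - x := fun x => by simp [hT]
  by_contra hinj
  have hiter : ∀ n, Function.Surjective (T^[n]) := fun n => hs.iterate n
  obtain ⟨x₀, hx₀, hne⟩ : ∃ x, T x = 0 ∧ x ≠ 0 := by
    by_contra! hcon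
    exact hinj ((injective_iff_map_eq_zero T).2 hcon)
  let V : ℕ → Submodule ℝ X := fun n => LinearMap.ker ((T ^ n : X →L[ℝ] X) : X →ₗ[ℝ] X)
  have hV : ∀ n x, x ∈ V n ↔ T^[n] x = 0 := fun n x => by
    change (T ^ n) x = 0 ↔ _
    rw [FunLike.coe_pow_eq_iterate]
  have hVs : ∀ n x, x ∈ V (n + 1) ↔ T x ∈ V n := fun n x => by
    rw [hV, hV, Function.iterate_succ_apply]
  have hVmono : ∀ n, V n ≤ V (n + 1) := fun n x hx => by
    rw [hV] at hx ⊢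
    rw [Function.iterate_succ_apply', hx, map_zero]
  have hVmono' : Monotone V := monotone_nat_of_le_succ hVmono
  have hcl : ∀ n, IsClosed (V n : Set X) := fun n => (T ^ n).isClosed_ker
  have hseq : ∀ n, ∃ x ∈ V (n + 1), ‖x‖ ≤ 3 ∧ ∀ y ∈ V n, 1 ≤ ‖x - y‖ := by
    intro n
    have h₁ : IsClosed ((V n).comap (V (n + 1)).subtype : Set (V (n + 1))) :=
      (hcl n).preimage_val
    -- A preimage of `x₀` under the `n`-th iterate is killed by one further application of `T`, but
    -- not before.
    have h₂ : ∃ x : V (n + 1), x ∉ (V n).comap (V (n + 1)).subtype := by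
      obtain ⟨x, hx⟩ := hiter n x₀
      refine ⟨⟨x, ?_⟩, ?_⟩
      · rw [hV, Function.iterate_succ_apply', hx, hx₀]
      · intro h
        have h' : x ∈ V n := h
        rw [hV, hx] at h'
        exact hne h'
    obtain ⟨⟨x, hx⟩, hxn, hxy⟩ := riesz_lemma_of_norm_lt (c := (2 : ℝ)) (by norm_num)
      (R := 3) (by norm_num) h₁ h₂
    exact ⟨x, hx, hxn, fun y hy => hxy ⟨y, hVmono n hy⟩ hy⟩
  choose f hfV hfn hfd using hseq
  have hp : Pairwise fun m n => 1 ≤ ‖L (f m) - L (f n)‖ := by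
    have : Std.Symm fun m n => 1 ≤ ‖L (f m) - L (f n)‖ := ⟨fun m n h => by rwa [norm_sub_rev]⟩
    apply Pairwise.of_lt
    intro m n hmn
    -- `L (f m) - L (f n)` is `f n` minus this vector. It lies in `V n` because `T` maps `V (n + 1)`
    -- into `V n` and `m + 1 ≤ n`.
    have h1 : f m - T (f m) + T (f n) ∈ V n := by
      refine Submodule.add_mem _ (Submodule.sub_mem _ ?_ ?_) ?_
      · exact hVmono' hmn (hfV m)
      · exact hVmono' hmn.le ((hVs _ _).1 (hfV m))
      · exact (hVs _ _).1 (hfV n)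
    have h2 := hfd n _ h1
    have h3 : L (f m) - L (f n) = f n - (f m - T (f m) + T (f n)) := by
      rw [hTL, hTL]
      abel
    rwa [h3]
  obtain ⟨K, hK, hK'⟩ := hL.image_closedBall_subset_compact 3
  obtain ⟨y, hyK, ψ, hψ, hψy⟩ := hK.tendsto_subseq
    (fun n => hK' ⟨f n, by simpa using hfn n, rfl⟩ : ∀ n, L (f n) ∈ K)
  have hψy := hψy.cauchySeq
  rw [Metric.cauchySeq_iff'] at hψy
  obtain ⟨N, hN⟩ := hψy 1 one_pos
  have h1 : ‖L (f (ψ (N + 1))) - L (f (ψ N))‖ < 1 := by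
    simpa [dist_eq_norm] using hN (N + 1) (Nat.le_succ N)
  exact h1.not_ge (hp (hψ (Nat.lt_succ_self N)).ne')

/-- On the closed kernel `-L` is the identity, so the identity there is compact. -/
theorem finiteDimensional_ker_id_add_compact {L : X →L[ℝ] X} (hL : IsCompactOperator L) :
    FiniteDimensional ℝ (LinearMap.ker ((ContinuousLinearMap.id ℝ X + L : X →L[ℝ] X) :
      X →ₗ[ℝ] X)) := by
  set K := LinearMap.ker ((ContinuousLinearMap.id ℝ X + L : X →L[ℝ] X) : X →ₗ[ℝ] X)
  have hK : ∀ x ∈ K, (-L) x = x := fun x hx => by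
    have : x + L x = 0 := hx
    change -(L x) = x
    exact (eq_neg_of_add_eq_zero_left this).symm
  have hcl : IsClosed (K : Set X) := ContinuousLinearMap.isClosed_ker _
  have h1 : IsCompactOperator (-L) := hL.neg
  have h2 := h1.restrict (f := ((-L : X →L[ℝ] X) : X →ₗ[ℝ] X)) (V := K)
    (fun x hx => by
      change (-L) x ∈ K
      rw [hK x hx]; exact hx) hcl
  apply FiniteDimensional.of_isCompactOperator_id (𝕜 := ℝ)
  have h3 : (id : K → K) = ((-L : X →L[ℝ] X) : X →ₗ[ℝ] X).restrict (fun x hx => by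
      change (-L) x ∈ K
      rw [hK x hx]; exact hx) := by
    ext x
    exact (hK x x.2).symm
  rw [h3]
  exact h2

variable [CompleteSpace X]

theorem isUnit_of_injective_id_add_compact {L : X →L[ℝ] X} (hL : IsCompactOperator L)
    (hi : Function.Injective (ContinuousLinearMap.id ℝ X + L)) :
    IsUnit (ContinuousLinearMap.id ℝ X + L) := by
  rcases hL.hasEigenvalue_or_mem_resolventSet (μ := (-1 : ℝ)) (by norm_num) with h | h
  · obtain ⟨x, hx⟩ := h.exists_hasEigenvector
    have h1 : L x = (-1 : ℝ) • x := hx.apply_eq_smul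
    refine absurd (hi (a₁ := x) (a₂ := 0) ?_) hx.2
    simp [h1]
  · rw [spectrum.mem_resolventSet_iff] at h
    rw [← IsUnit.neg_iff]
    convert h using 1
    ext x
    rw [sub_apply, Algebra.algebraMap_eq_smul_one]
    change -(x + L x) = (-1 : ℝ) • x - L x
    rw [neg_smul, one_smul, neg_add, sub_eq_add_neg]

/-- The rank one operators. -/
def rankOne (S : Set X) : Set (X →L[ℝ] X) := {R | ∃ φ : X →L[ℝ] ℝ, ∃ w ∈ S, R = φ.smulRight w}

/-- Induction on the dimension of the kernel. If `1 + L` is not injective it is not surjective;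
choose `w` outside its range and `φ` with `φ x₀ = 1` for some kernel vector `x₀`. A vector killed
after adding `φ ⊗ w` must satisfy `φ x = 0`, since otherwise `w` would be in the range. The new
kernel thus lies in the old one and misses `x₀`. -/
theorem exists_span_rankOne_isUnit {L : X →L[ℝ] X} (hL : IsCompactOperator L) :
    ∃ R ∈ Submodule.span ℝ (rankOne (univ : Set X)),
      IsUnit (ContinuousLinearMap.id ℝ X + L + R) := by
  induction hn : Module.finrank ℝ (LinearMap.ker ((ContinuousLinearMap.id ℝ X + L : X →L[ℝ] X) :
      X →ₗ[ℝ] X)) using Nat.strong_induction_on generalizing L with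
  | _ n ih =>
  have hfin := finiteDimensional_ker_id_add_compact hL
  by_cases hi : Function.Injective (ContinuousLinearMap.id ℝ X + L)
  · exact ⟨0, zero_mem _, by simpa using isUnit_of_injective_id_add_compact hL hi⟩
  · have hns := mt (injective_of_surjective_id_add_compact hL) hi
    obtain ⟨x₀, hx₀, hne⟩ : ∃ x, (ContinuousLinearMap.id ℝ X + L) x = 0 ∧ x ≠ 0 := by
      by_contra! hcon
      exact hi ((injective_iff_map_eq_zero (ContinuousLinearMap.id ℝ X + L)).2 hcon)
    obtain ⟨w, hw⟩ : ∃ w, ∀ x, (ContinuousLinearMap.id ℝ X + L) x ≠ w := by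
      simpa [Function.Surjective] using hns
    obtain ⟨φ, hφ⟩ := SeparatingDual.exists_eq_one (R := ℝ) hne
    have hL' : IsCompactOperator (L + φ.smulRight w) := by
      refine hL.add ?_
      have h1 : IsCompactOperator (φ : X → ℝ) :=
        isCompactOperator_of_locallyCompactSpace_dom φ
      exact h1.clm_comp ((ContinuousLinearMap.id ℝ ℝ).smulRight w)
    have hlt : Module.finrank ℝ (LinearMap.ker ((ContinuousLinearMap.id ℝ X +
        (L + φ.smulRight w) : X →L[ℝ] X) : X →ₗ[ℝ] X)) < n := by
      rw [← hn]
      have hmem : ∀ x, (ContinuousLinearMap.id ℝ X + (L + φ.smulRight w)) x = 0 →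
          φ x = 0 ∧ (ContinuousLinearMap.id ℝ X + L) x = 0 := by
        intro x hx
        have hx' : (ContinuousLinearMap.id ℝ X + L) x + φ x • w = 0 := by
          rw [← hx]
          simp [add_assoc]
        have hφx : φ x = 0 := by
          by_contra hφx
          apply hw (-(φ x)⁻¹ • x)
          rw [map_smul, eq_neg_of_add_eq_zero_left hx', smul_neg, neg_smul, neg_neg,
            inv_smul_smul₀ hφx]
        rw [hφx, zero_smul, add_zero] at hx'
        exact ⟨hφx, hx'⟩
      refine Submodule.finrank_lt_finrank_of_lt (lt_of_le_of_ne (fun x hx => (hmem x hx).2) ?_)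
      intro heq
      have h2 : x₀ ∈ LinearMap.ker ((ContinuousLinearMap.id ℝ X + L : X →L[ℝ] X) : X →ₗ[ℝ] X) :=
        hx₀
      rw [← heq] at h2
      rw [(hmem x₀ h2).1] at hφ
      exact zero_ne_one hφ
    obtain ⟨R, hR, hu⟩ := ih _ hlt hL' rfl
    refine ⟨φ.smulRight w + R, Submodule.add_mem _ (Submodule.subset_span
      ⟨φ, w, mem_univ _, rfl⟩) hR, ?_⟩
    rwa [← add_assoc, add_assoc (ContinuousLinearMap.id ℝ X)]

/-- A compact perturbation of the identity becomes invertible after adding an operator of finite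
rank with values in a given dense set. -/
theorem exists_span_rankOne_isUnit_of_dense {L : X →L[ℝ] X} (hL : IsCompactOperator L) {D : Set X}
    (hD : Dense D) :
    ∃ R ∈ Submodule.span ℝ (rankOne D), IsUnit (ContinuousLinearMap.id ℝ X + L + R) := by
  obtain ⟨R, hR, hu⟩ := exists_span_rankOne_isUnit hL
  -- `φ ⊗ w` depends continuously on `w`, so `R` is a limit of admissible operators; since
  -- invertibility is an open condition, one of them serves.
  have hle : Submodule.span ℝ (rankOne (univ : Set X)) ≤
      (Submodule.span ℝ (rankOne D)).topologicalClosure := by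
    rw [Submodule.span_le]
    rintro _ ⟨φ, w, -, rfl⟩
    have hc : Continuous fun w : X => φ.smulRight w :=
      (ContinuousLinearMap.smulRightL ℝ X X φ).continuous
    refine closure_mono ?_ (image_closure_subset_closure_image hc ⟨w, hD w, rfl⟩)
    rintro _ ⟨w, hw, rfl⟩
    exact Submodule.subset_span ⟨φ, w, hw, rfl⟩
  have hR' : R ∈ closure (Submodule.span ℝ (rankOne D) : Set (X →L[ℝ] X)) := hle hR
  have hopen : IsOpen {R : X →L[ℝ] X | IsUnit (ContinuousLinearMap.id ℝ X + L + R)} :=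
    Units.isOpen.preimage (continuous_const.add continuous_id)
  obtain ⟨R', h1, h2⟩ := mem_closure_iff.1 hR' _ hopen hu
  exact ⟨R', h2, h1⟩

end Riesz

/-! ### Operators between sc-Banach spaces -/

namespace ScBanach

variable {E F G : ScBanach.{u}}

theorem incl_succ (m : ℕ) (x : E.lvl (m + 1)) : E.incl (m + 1) x = E.incl m (E.step m x) := rfl

theorem filtration_antitone : Antitone E.filtration.level :=
  antitone_nat_of_succ_le fun m => by
    rintro _ ⟨x, rfl⟩
    exact ⟨E.step m x, rfl⟩

theorem isSmooth_iff {x : E.lvl 0} : E.IsSmooth x ↔ x ∈ E.filtration.smooth := by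
  rw [ScFiltration.mem_smooth]
  exact Iff.rfl

theorem isSmooth_of_dense_aux {m : ℕ} {x : E.lvl m} (h : ∃ y : ∀ k, E.lvl (m + k), y 0 = x ∧
    ∀ k, E.step (m + k) (y (k + 1)) = y k) : E.incl m x ∈ E.filtration.smooth := by
  obtain ⟨y, rfl, hy⟩ := h
  have h1 : ∀ k, E.incl (m + k) (y k) = E.incl m (y 0) := by
    intro k
    induction k with
    | zero => rfl
    | succ k ih =>
      rw [← ih, ← hy k]
      rfl
  exact ScFiltration.mem_smooth.2 fun k =>
    filtration_antitone (Nat.le_add_left k m) ⟨y k, h1 k⟩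

variable (E) in
theorem dense_smooth : Dense {x : E.lvl 0 | x ∈ E.filtration.smooth} :=
  (E.dense 0).mono fun _ hx => isSmooth_of_dense_aux hx

variable (E) in
/-- `E_m` as a subspace of `E_0`. -/
noncomputable def levelEquiv (m : ℕ) : E.lvl m ≃ₗ[ℝ] E.filtration.level m :=
  LinearEquiv.ofInjective (E.incl m : E.lvl m →ₗ[ℝ] E.lvl 0) (E.incl_injective m)

theorem coe_levelEquiv (m : ℕ) (x : E.lvl m) : (E.levelEquiv m x : E.lvl 0) = E.incl m x := rfl

theorem incl_levelEquiv_symm (m : ℕ) (x : E.filtration.level m) :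
    E.incl m ((E.levelEquiv m).symm x) = x := by
  rw [← coe_levelEquiv, LinearEquiv.apply_symm_apply]

theorem continuous_levelEquiv_symm (m : ℕ) :
    Continuous[E.filtration.top m, _] (E.levelEquiv m).symm := continuous_induced_dom

theorem continuous_levelEquiv (m : ℕ) :
    Continuous[_, E.filtration.top m] (E.levelEquiv m) := by
  refine continuous_induced_rng.2 ?_
  convert continuous_id
  ext x
  exact (E.levelEquiv m).symm_apply_apply x

variable (E) in
theorem filtration_isRegular : E.filtration.IsRegular where
  level_zero := by
    rw [eq_top_iff]
    exact fun x _ => ⟨x, rfl⟩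
  addGroup m := topologicalAddGroup_induced (E.levelEquiv m).symm
  smul m := continuousSMul_induced (E.levelEquiv m).symm
  t2 m := @T2Space.of_injective_continuous _ _ (E.filtration.top m) _ _ _
    (E.levelEquiv m).symm.injective (continuous_levelEquiv_symm m)
  dense m := by
    let _ := E.filtration.top m
    have h1 := (E.levelEquiv m).surjective.denseRange.dense_image (continuous_levelEquiv m)
      (E.dense m)
    refine h1.mono ?_
    rintro _ ⟨x, hx, rfl⟩
    exact isSmooth_of_dense_aux hx

section

attribute [local instance] ScFiltration.top

theorem isScOperator_of_continuous {T : E.lvl 0 →ₗ[ℝ] F.lvl 0}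
    (h : ∀ m, ∃ Tm : E.lvl m → F.lvl m, Continuous Tm ∧ ∀ x, F.incl m (Tm x) = T (E.incl m x)) :
    IsScOperator E.filtration F.filtration T := by
  intro m
  obtain ⟨Tm, hc, hT⟩ := h m
  refine ⟨fun x => F.levelEquiv m (Tm ((E.levelEquiv m).symm x)), ?_, fun x => ?_⟩
  · exact (continuous_levelEquiv m).comp (hc.comp (continuous_levelEquiv_symm m))
  · rw [coe_levelEquiv, hT, incl_levelEquiv_symm]

theorem isScOperator_iff {T : E.lvl 0 →ₗ[ℝ] F.lvl 0} :
    IsScOperator E.filtration F.filtration T ↔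
      ∀ m, ∃ Tm : E.lvl m →L[ℝ] F.lvl m, ∀ x, F.incl m (Tm x) = T (E.incl m x) := by
  constructor
  · intro h m
    obtain ⟨φ, hφ, key⟩ : ∃ φ : E.lvl m → F.lvl m, Continuous φ ∧
        ∀ x, F.incl m (φ x) = T (E.incl m x) := by
      obtain ⟨Tm, hc, hT⟩ := h m
      exact ⟨fun x => (F.levelEquiv m).symm (Tm (E.levelEquiv m x)),
        (continuous_levelEquiv_symm m).comp (hc.comp (continuous_levelEquiv m)),
        fun x => by rw [incl_levelEquiv_symm, hT, coe_levelEquiv]⟩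
    refine ⟨⟨⟨⟨φ, fun x y => ?_⟩, fun r x => ?_⟩, hφ⟩, key⟩
    · apply F.incl_injective m
      rw [map_add, key, key, key, map_add, map_add]
    · apply F.incl_injective m
      rw [RingHom.id_apply, map_smul, key, key, map_smul, map_smul]
  · intro h
    refine isScOperator_of_continuous fun m => ?_
    obtain ⟨Tm, hT⟩ := h m
    exact ⟨Tm, Tm.continuous, hT⟩

end

/-- An `sc⁺`-operator: it induces continuous operators `E_m → F_{m+1}`. -/
def IsScPlusOperator (E F : ScBanach.{u}) (T : E.lvl 0 →ₗ[ℝ] F.lvl 0) : Prop :=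
  ∀ m, ∃ Tm : E.lvl m →L[ℝ] F.lvl (m + 1), ∀ x, F.incl (m + 1) (Tm x) = T (E.incl m x)

namespace IsScPlusOperator

theorem isScOperator {T : E.lvl 0 →ₗ[ℝ] F.lvl 0} (h : IsScPlusOperator E F T) :
    IsScOperator E.filtration F.filtration T :=
  ScBanach.isScOperator_iff.2 fun m => by
    obtain ⟨Tm, hT⟩ := h m
    exact ⟨(F.step m).comp Tm, hT⟩

theorem comp_left {T : E.lvl 0 →ₗ[ℝ] F.lvl 0} (h : IsScPlusOperator E F T)
    {S : F.lvl 0 →ₗ[ℝ] G.lvl 0} (hS : IsScOperator F.filtration G.filtration S) :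
    IsScPlusOperator E G (S ∘ₗ T) := fun m => by
  obtain ⟨Tm, hT⟩ := h m
  obtain ⟨Sm, hS⟩ := ScBanach.isScOperator_iff.1 hS (m + 1)
  exact ⟨Sm.comp Tm, fun x => by simp [hS, hT]⟩

theorem add {T S : E.lvl 0 →ₗ[ℝ] F.lvl 0} (hT : IsScPlusOperator E F T)
    (hS : IsScPlusOperator E F S) : IsScPlusOperator E F (T + S) := fun m => by
  obtain ⟨Tm, hT⟩ := hT m
  obtain ⟨Sm, hS⟩ := hS m
  exact ⟨Tm + Sm, fun x => by simp [hT, hS]⟩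

theorem smul {T : E.lvl 0 →ₗ[ℝ] F.lvl 0} (hT : IsScPlusOperator E F T) (r : ℝ) :
    IsScPlusOperator E F (r • T) := fun m => by
  obtain ⟨Tm, hT⟩ := hT m
  exact ⟨r • Tm, fun x => by simp [hT]⟩

theorem sub {T S : E.lvl 0 →ₗ[ℝ] F.lvl 0} (hT : IsScPlusOperator E F T)
    (hS : IsScPlusOperator E F S) : IsScPlusOperator E F (T - S) := by
  have := hT.add (hS.smul (-1))
  rwa [neg_one_smul, ← sub_eq_add_neg] at this

theorem neg {T : E.lvl 0 →ₗ[ℝ] F.lvl 0} (hT : IsScPlusOperator E F T) :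
    IsScPlusOperator E F (-T) := by
  simpa using hT.smul (-1)

theorem zero : IsScPlusOperator E F 0 := fun m => ⟨0, fun x => by simp⟩

theorem of_span_rankOne {R : E.lvl 0 →L[ℝ] E.lvl 0}
    (hR : R ∈ Submodule.span ℝ (rankOne {x : E.lvl 0 | x ∈ E.filtration.smooth})) :
    IsScPlusOperator E E R ∧ IsSmoothFinite E.filtration (R : E.lvl 0 →ₗ[ℝ] E.lvl 0) := by
  induction hR using Submodule.span_induction with
  | mem R hR =>
    obtain ⟨φ, w, hw, rfl⟩ := hR
    refine ⟨fun m => ?_, ?_, fun x => Submodule.smul_mem _ _ hw⟩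
    · obtain ⟨y, hy⟩ := ScFiltration.mem_smooth.1 hw (m + 1)
      have hy' : E.incl (m + 1) y = w := hy
      exact ⟨(φ.comp (E.incl m)).smulRight y, fun x => by simp [hy']⟩
    · refine Submodule.finiteDimensional_of_le (S₂ := Submodule.span ℝ {w}) ?_
      rintro _ ⟨x, rfl⟩
      exact Submodule.smul_mem _ _ (Submodule.mem_span_singleton_self w)
  | zero =>
    refine ⟨zero, ?_, fun x => zero_mem _⟩
    have : ((0 : E.lvl 0 →L[ℝ] E.lvl 0) : E.lvl 0 →ₗ[ℝ] E.lvl 0) = 0 := rfl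
    rw [this, LinearMap.range_zero]
    infer_instance
  | add R S _ _ hR hS => exact ⟨hR.1.add hS.1, hR.2.add hS.2⟩
  | smul r R _ hR =>
    exact ⟨hR.1.smul r, hR.2.smul r⟩

/-- Bootstrapping: `N = 1 - L ∘ N`, and `L` gains one level, so continuity of `N` on level `m`
yields continuity on level `m + 1`. -/
theorem isScOperator_inverse {L : E.lvl 0 →ₗ[ℝ] E.lvl 0} (hL : IsScPlusOperator E E L)
    {N : E.lvl 0 →L[ℝ] E.lvl 0} (hN : ∀ x, N x + L (N x) = x) :
    IsScOperator E.filtration E.filtration (N : E.lvl 0 →ₗ[ℝ] E.lvl 0) := by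
  refine ScBanach.isScOperator_iff.2 fun m => ?_
  induction m with
  | zero => exact ⟨N, fun x => rfl⟩
  | succ m ih =>
    obtain ⟨Nm, hNm⟩ := ih
    obtain ⟨Lm, hLm⟩ := hL m
    refine ⟨ContinuousLinearMap.id ℝ _ - (Lm.comp Nm).comp (E.step m), fun x => ?_⟩
    change E.incl (m + 1) (x - Lm (Nm (E.step m x))) = N (E.incl (m + 1) x)
    rw [map_sub, hLm, hNm, incl_succ]
    exact sub_eq_of_eq_add (hN _).symm

end IsScPlusOperator

/-- Adding an `sc⁺`-operator preserves the existence of a parametrix and the index. -/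
theorem exists_parametrix_add {T K : E.lvl 0 →ₗ[ℝ] F.lvl 0} {S : F.lvl 0 →ₗ[ℝ] E.lvl 0}
    (h : IsScParametrix E.filtration F.filtration T S) (hK : IsScPlusOperator E F K) :
    (∃ S', IsScParametrix E.filtration F.filtration (T + K) S') ∧ (T + K).index = T.index := by
  have hSK : IsScPlusOperator E E (S ∘ₗ K) := hK.comp_left h.right
  obtain ⟨L₁, hL₁⟩ := hSK 0
  have hLc : IsCompactOperator ((E.step 0).comp L₁) := (E.step_compact 0).comp_clm L₁
  obtain ⟨R, hR, hu⟩ := exists_span_rankOne_isUnit_of_dense hLc E.dense_smooth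
  obtain ⟨hRp, hRf⟩ := IsScPlusOperator.of_span_rankOne hR
  obtain ⟨⟨M, N, hMN, hNM⟩, rfl : M = _⟩ := hu
  set M : E.lvl 0 →L[ℝ] E.lvl 0 := ContinuousLinearMap.id ℝ _ + (E.step 0).comp L₁ + R with hM
  have hMx : ∀ x, M x = x + S (K x) + R x := fun x => by
    have : E.step 0 (L₁ x) = S (K x) := hL₁ x
    rw [hM]
    change x + E.step 0 (L₁ x) + R x = _
    rw [this]
  have hMN' : ∀ x, M (N x) = x := fun x => DFunLike.congr_fun hMN x
  have hNM' : ∀ x, N (M x) = x := fun x => DFunLike.congr_fun hNM x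
  have scN : IsScOperator E.filtration E.filtration (N : E.lvl 0 →ₗ[ℝ] E.lvl 0) :=
    (hSK.add hRp).isScOperator_inverse fun x => by
      conv_rhs => rw [← hMN' x, hMx]
      rw [add_assoc]
      rfl
  have hMeq : (M : E.lvl 0 →ₗ[ℝ] E.lvl 0) =
      LinearMap.id + S ∘ₗ K + (R : E.lvl 0 →ₗ[ℝ] E.lvl 0) := LinearMap.ext hMx
  have scM : IsScOperator E.filtration E.filtration (M : E.lvl 0 →ₗ[ℝ] E.lvl 0) := by
    rw [hMeq]
    exact (IsScOperator.id.add E.filtration_isRegular hSK.isScOperator).add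
      E.filtration_isRegular hRp.isScOperator
  set S' : F.lvl 0 →ₗ[ℝ] E.lvl 0 := (N : E.lvl 0 →ₗ[ℝ] E.lvl 0) ∘ₗ S with hS'
  have scS' : IsScOperator F.filtration E.filtration S' := scN.comp h.right
  have scTK : IsScOperator E.filtration F.filtration (T + K) :=
    h.left.add F.filtration_isRegular hK.isScOperator
  set R₁ : E.lvl 0 →ₗ[ℝ] E.lvl 0 := LinearMap.id - S ∘ₗ T with hR₁
  set R₂ : F.lvl 0 →ₗ[ℝ] F.lvl 0 := LinearMap.id - T ∘ₗ S with hR₂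
  set Z : E.lvl 0 →ₗ[ℝ] E.lvl 0 := LinearMap.id - S' ∘ₗ (T + K) with hZ
  -- From `1 = N ∘ M`, where `M - S ∘ (T + K) = R + R₁`.
  have hZ' : Z = (N : E.lvl 0 →ₗ[ℝ] E.lvl 0) ∘ₗ ((R : E.lvl 0 →ₗ[ℝ] E.lvl 0) + R₁) := by
    ext x
    change x - N (S (T x + K x)) = N (R x + (x - S (T x)))
    have h1 : R x + (x - S (T x)) = M x - S (T x + K x) := by
      rw [hMx, map_add]
      abel
    rw [h1, map_sub, hNM']
  have hZf : IsSmoothFinite E.filtration Z := by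
    rw [hZ']
    exact (hRf.add h.comp_left).comp_left fun x => scN.mem_smooth ((hRf.add h.comp_left).2 x)
  set Q : F.lvl 0 →ₗ[ℝ] F.lvl 0 := LinearMap.id - (T + K) ∘ₗ S' with hQ
  -- The right defect is reduced to the left one: `Z ∘ S' = S' ∘ Q` and `M ∘ S' = S` give `T ∘ M ∘ Z
  -- ∘ S' = T ∘ S ∘ Q`, which differs from `Q` by `R₂ ∘ Q`. The reappearance of `Q` is harmless
  -- since `R₂` already has finite rank and smooth values.
  have hQ' : Q = (T ∘ₗ (M : E.lvl 0 →ₗ[ℝ] E.lvl 0)) ∘ₗ (Z ∘ₗ S') + R₂ ∘ₗ Q := by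
    ext y
    have h1 : Z (S' y) = S' (Q y) := by
      rw [hZ, hQ]
      simp
    have h2 : M (S' (Q y)) = S (Q y) := hMN' _
    change Q y = T (M (Z (S' y))) + (Q y - T (S (Q y)))
    rw [h1, h2]
    abel
  have hQf : IsSmoothFinite F.filtration Q := by
    rw [hQ']
    exact ((hZf.comp_right S').comp_left fun x =>
      (h.left.comp scM).mem_smooth ((hZf.comp_right S').2 x)).add (h.comp_right.comp_right Q)
  have hp : IsScParametrix E.filtration F.filtration (T + K) S' := ⟨scTK, scS', hZf, hQf⟩
  refine ⟨⟨S', hp⟩, ?_⟩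
  have hi : S'.index = S.index :=
    index_equiv_comp (LinearEquiv.ofLinearMap (N : E.lvl 0 →ₗ[ℝ] E.lvl 0)
      (M : E.lvl 0 →ₗ[ℝ] E.lvl 0) (LinearMap.ext hNM') (LinearMap.ext hMN')) S
  have h1 := hp.index_add
  have h2 := h.index_add
  omega

end ScBanach

/-! ### Block decompositions -/

section Block

variable {E E' F F' : Type*} [AddCommGroup E] [Module ℝ E] [AddCommGroup E'] [Module ℝ E']
variable [AddCommGroup F] [Module ℝ F] [AddCommGroup F'] [Module ℝ F']

attribute [local instance] ScFiltration.top

/-- A filtered space is regular if it is an sc-retract of a regular one. -/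
theorem ScFiltration.IsRegular.of_retract {A : ScFiltration E} {A' : ScFiltration E'}
    (hA : A.IsRegular) {i : E' →ₗ[ℝ] E} {p : E →ₗ[ℝ] E'} (hi : IsScOperator A' A i)
    (hp : IsScOperator A A' p) (hpi : ∀ x, p (i x) = x) : A'.IsRegular := by
  have hind : ∀ m, ∃ im : A'.level m →ₗ[ℝ] A.level m, Function.Injective im ∧
      A'.top m = TopologicalSpace.induced im (A.top m) := by
    intro m
    obtain ⟨h1, hc1⟩ := isScOperator_iff.1 hi m
    obtain ⟨h2, hc2⟩ := isScOperator_iff.1 hp m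
    have h3 : Function.LeftInverse (p.restrict h2) (i.restrict h1) :=
      fun x => Subtype.ext (hpi x)
    exact ⟨i.restrict h1, h3.injective, (h3.isEmbedding hc2 hc1).eq_induced⟩
  refine ⟨?_, fun m => ?_, fun m => ?_, fun m => ?_, fun m => ?_⟩
  · rw [eq_top_iff]
    intro x _
    rw [← hpi x]
    refine hp.mem_level ?_
    rw [hA.level_zero]
    trivial
  · obtain ⟨im, -, h⟩ := hind m
    have := hA.addGroup m
    rw [h]
    exact topologicalAddGroup_induced im
  · obtain ⟨im, -, h⟩ := hind m
    have := hA.smul m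
    rw [h]
    exact continuousSMul_induced im
  · obtain ⟨im, hinj, h⟩ := hind m
    have := hA.t2 m
    exact T2Space.of_injective_continuous hinj (h ▸ continuous_induced_dom)
  · obtain ⟨h1, hc1⟩ := isScOperator_iff.1 hi m
    obtain ⟨h2, hc2⟩ := isScOperator_iff.1 hp m
    have hs : Function.Surjective (p.restrict h2) :=
      fun x => ⟨i.restrict h1 x, Subtype.ext (hpi x)⟩
    refine (hs.denseRange.dense_image hc2 (hA.dense m)).mono ?_
    rintro _ ⟨x, hx, rfl⟩
    exact hp.mem_smooth hx

/-- Data exhibiting `L : E' → F'` as a diagonal block of `D : E → F` whose complementary block is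
an sc-isomorphism with inverse induced by `Ψ`. -/
structure IsScBlock (A : ScFiltration E) (A' : ScFiltration E') (B : ScFiltration F)
    (B' : ScFiltration F') (D : E →ₗ[ℝ] F) (L : E' →ₗ[ℝ] F') (Ψ : F →ₗ[ℝ] E) (iE : E' →ₗ[ℝ] E)
    (pE : E →ₗ[ℝ] E') (iF : F' →ₗ[ℝ] F) (pF : F →ₗ[ℝ] F') : Prop where
  sc_D : IsScOperator A B D
  sc_Ψ : IsScOperator B A Ψ
  sc_iE : IsScOperator A' A iE
  sc_pE : IsScOperator A A' pE
  sc_iF : IsScOperator B' B iF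
  sc_pF : IsScOperator B B' pF
  pE_iE : ∀ x, pE (iE x) = x
  pF_iF : ∀ y, pF (iF y) = y
  D_iE : ∀ x, D (iE x) = iF (L x)
  pF_D : ∀ x, pF (D x) = L (pE x)
  Ψ_D : ∀ x, pE x = 0 → Ψ (D x) = x
  D_Ψ : ∀ y, pF y = 0 → D (Ψ y) = y

namespace IsScBlock

variable {A : ScFiltration E} {A' : ScFiltration E'} {B : ScFiltration F} {B' : ScFiltration F'}
  {D : E →ₗ[ℝ] F} {L : E' →ₗ[ℝ] F'} {Ψ : F →ₗ[ℝ] E} {iE : E' →ₗ[ℝ] E}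
  {pE : E →ₗ[ℝ] E'} {iF : F' →ₗ[ℝ] F} {pF : F →ₗ[ℝ] F'}

/-- A parametrix of the block is extended by `Ψ` on the complementary part; conversely, one of the
whole operator is compressed to the block. The defects are composed with the inclusions and
projections only, so they keep finite rank and smooth values. -/
theorem exists_parametrix_iff (h : IsScBlock A A' B B' D L Ψ iE pE iF pF) (hA : A.IsRegular)
    (hB : B.IsRegular) :
    (∃ S, IsScParametrix A' B' L S) ↔ ∃ S, IsScParametrix A B D S := by
  have hL : pF ∘ₗ D ∘ₗ iE = L := by
    ext x
    change pF (D (iE x)) = L x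
    rw [h.D_iE, h.pF_iF]
  constructor
  · rintro ⟨S, hS⟩
    refine ⟨iE ∘ₗ S ∘ₗ pF + Ψ ∘ₗ (LinearMap.id - iF ∘ₗ pF), h.sc_D, ?_, ?_, ?_⟩
    · exact (h.sc_iE.comp (hS.right.comp h.sc_pF)).add hA
        (h.sc_Ψ.comp (IsScOperator.id.sub hB (h.sc_iF.comp h.sc_pF)))
    · have e : LinearMap.id - (iE ∘ₗ S ∘ₗ pF + Ψ ∘ₗ (LinearMap.id - iF ∘ₗ pF)) ∘ₗ D =
          iE ∘ₗ ((LinearMap.id - S ∘ₗ L) ∘ₗ pE) := by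
        ext x
        change x - (iE (S (pF (D x))) + Ψ (D x - iF (pF (D x)))) = iE (pE x - S (L (pE x)))
        have h1 : D x - iF (pF (D x)) = D (x - iE (pE x)) := by
          rw [h.pF_D, map_sub, h.D_iE]
        rw [h1, h.Ψ_D _ (by rw [map_sub, h.pE_iE, sub_self]), h.pF_D, map_sub]
        abel
      rw [e]
      exact (hS.comp_left.comp_right pE).comp_left fun x =>
        h.sc_iE.mem_smooth ((hS.comp_left.comp_right pE).2 x)
    · have e : LinearMap.id - D ∘ₗ (iE ∘ₗ S ∘ₗ pF + Ψ ∘ₗ (LinearMap.id - iF ∘ₗ pF)) =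
          iF ∘ₗ ((LinearMap.id - L ∘ₗ S) ∘ₗ pF) := by
        ext y
        change y - D (iE (S (pF y)) + Ψ (y - iF (pF y))) = iF (pF y - L (S (pF y)))
        rw [map_add, h.D_Ψ _ (by rw [map_sub, h.pF_iF, sub_self]), h.D_iE, map_sub]
        abel
      rw [e]
      exact (hS.comp_right.comp_right pF).comp_left fun x =>
        h.sc_iF.mem_smooth ((hS.comp_right.comp_right pF).2 x)
  · rintro ⟨S, hS⟩
    refine ⟨pE ∘ₗ S ∘ₗ iF, ?_, h.sc_pE.comp (hS.right.comp h.sc_iF), ?_, ?_⟩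
    · rw [← hL]
      exact h.sc_pF.comp (h.sc_D.comp h.sc_iE)
    · have e : LinearMap.id - (pE ∘ₗ S ∘ₗ iF) ∘ₗ L =
          pE ∘ₗ ((LinearMap.id - S ∘ₗ D) ∘ₗ iE) := by
        ext x
        change x - pE (S (iF (L x))) = pE (iE x - S (D (iE x)))
        rw [map_sub, h.pE_iE, h.D_iE]
      rw [e]
      exact (hS.comp_left.comp_right iE).comp_left fun x =>
        h.sc_pE.mem_smooth ((hS.comp_left.comp_right iE).2 x)
    · have e : LinearMap.id - L ∘ₗ (pE ∘ₗ S ∘ₗ iF) =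
          pF ∘ₗ ((LinearMap.id - D ∘ₗ S) ∘ₗ iF) := by
        ext y
        change y - L (pE (S (iF y))) = pF (iF y - D (S (iF y)))
        rw [map_sub, h.pF_iF, h.pF_D]
      rw [e]
      exact (hS.comp_right.comp_right iF).comp_left fun x =>
        h.sc_pF.mem_smooth ((hS.comp_right.comp_right iF).2 x)

/-- The complementary block is bijective: it adds nothing to the kernel, and the complement of the
block in `F` lies in `range D`. -/
theorem index_eq (h : IsScBlock A A' B B' D L Ψ iE pE iF pF) : L.index = D.index := by
  have h1 : ∀ y, iF (pF y) - y ∈ LinearMap.range D := fun y => by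
    refine ⟨-Ψ (y - iF (pF y)), ?_⟩
    rw [map_neg, h.D_Ψ _ (by rw [map_sub, h.pF_iF, sub_self])]
    abel
  rw [LinearMap.index_eq_finrank_sub, LinearMap.index_eq_finrank_sub]
  congr 2
  · refine finrank_ker_eq iE pE (fun x hx => by rw [h.D_iE, hx, map_zero])
      (fun x hx => by rw [← h.pF_D, hx, map_zero]) (fun x _ => h.pE_iE x) fun x hx => ?_
    have h2 : D (x - iE (pE x)) = 0 := by
      rw [map_sub, h.D_iE, ← h.pF_D, hx, map_zero, map_zero, sub_zero]
    have h3 := h.Ψ_D (x - iE (pE x)) (by rw [map_sub, h.pE_iE, sub_self])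
    rw [h2, map_zero] at h3
    exact (sub_eq_zero.1 h3.symm).symm
  · exact finrank_coker_eq iF pF (fun x => ⟨iE x, h.D_iE x⟩) (fun x => ⟨pE x, (h.pF_D x).symm⟩)
      (fun y => ⟨0, by simp [h.pF_iF]⟩) h1

end IsScBlock

/-- The sc-Fredholm property and the index of a diagonal block whose complementary block is
invertible agree with those of any `sc⁺`-perturbation of the whole operator. -/
theorem IsScBlock.isScFredholm_iff {G H : ScBanach.{u}} {A' : ScFiltration E'} {B' : ScFiltration F'}
    {D K : G.lvl 0 →ₗ[ℝ] H.lvl 0} {L : E' →ₗ[ℝ] F'} {Ψ : H.lvl 0 →ₗ[ℝ] G.lvl 0}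
    {iE : E' →ₗ[ℝ] G.lvl 0} {pE : G.lvl 0 →ₗ[ℝ] E'} {iF : F' →ₗ[ℝ] H.lvl 0}
    {pF : H.lvl 0 →ₗ[ℝ] F'}
    (h : IsScBlock G.filtration A' H.filtration B' D L Ψ iE pE iF pF)
    (hK : ScBanach.IsScPlusOperator G H K) :
    (IsScFredholm A' B' L ↔ IsScFredholm G.filtration H.filtration (D + K)) ∧
      (IsScFredholm A' B' L → fredholmIndex L = fredholmIndex (D + K)) := by
  have hG := G.filtration_isRegular
  have hH := H.filtration_isRegular
  have hA' := hG.of_retract h.sc_iE h.sc_pE h.pE_iE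
  have hB' := hH.of_retract h.sc_iF h.sc_pF h.pF_iF
  rw [isScFredholm_iff_exists_parametrix hA' hB', isScFredholm_iff_exists_parametrix hG hH,
    h.exists_parametrix_iff hG hH]
  refine ⟨⟨fun ⟨S, hS⟩ => (ScBanach.exists_parametrix_add hS hK).1, fun ⟨S, hS⟩ => ?_⟩,
    fun ⟨S, hS⟩ => ?_⟩
  · have := (ScBanach.exists_parametrix_add hS hK.neg).1
    rwa [add_neg_cancel_right] at this
  · exact h.index_eq.trans (ScBanach.exists_parametrix_add hS hK).2.symm

end Block

/-! ### The chain rule -/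

section ChainRule

variable {E₁ E₀ F₁ F₀ G₀ : Type*} [NormedAddCommGroup E₁] [NormedSpace ℝ E₁]
  [NormedAddCommGroup E₀] [NormedSpace ℝ E₀] [NormedAddCommGroup F₁]
  [NormedAddCommGroup F₀] [NormedSpace ℝ F₀] [NormedAddCommGroup G₀] [NormedSpace ℝ G₀]

/-- Joint continuity of `(y, κ) ↦ D y κ` gives local uniform bounds for the operators `D y`. -/
theorem exists_eventually_norm_le {V : Set F₁} {D : F₁ → F₀ →L[ℝ] G₀} {y₀ : F₁} (hy₀ : y₀ ∈ V)
    (hD : ContinuousOn (fun z : F₁ × F₀ => D z.1 z.2) (V ×ˢ univ)) :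
    ∃ M > 0, ∀ᶠ y in 𝓝[V] y₀, ‖D y‖ ≤ M := by
  have h1 : ∀ᶠ z in 𝓝[V ×ˢ univ] ((y₀, 0) : F₁ × F₀), ‖D z.1 z.2‖ < 1 := by
    have h2 := hD (y₀, 0) ⟨hy₀, trivial⟩
    have h3 : Filter.Tendsto (fun z : F₁ × F₀ => D z.1 z.2) (𝓝[V ×ˢ univ] (y₀, 0)) (𝓝 0) := by
      simpa [ContinuousWithinAt] using h2
    exact (tendsto_zero_iff_norm_tendsto_zero.1 h3).eventually_lt_const one_pos
  rw [nhdsWithin_prod_eq, nhdsWithin_univ] at h1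
  obtain ⟨p, hp, q, hq, hpq⟩ := Filter.eventually_prod_iff.1 h1
  obtain ⟨r, hr, hball⟩ := Metric.eventually_nhds_iff.1 hq
  -- Scale `κ` to norm `r / 2`, where `D y` takes values of norm below `1`.
  refine ⟨2 / r, by positivity, hp.mono fun y hy => ?_⟩
  refine ContinuousLinearMap.opNorm_le_bound _ (by positivity) fun κ => ?_
  rcases eq_or_ne κ 0 with rfl | hκ
  · simp
  have hκ' : 0 < ‖κ‖ := norm_pos_iff.2 hκ
  have h4 : ‖D y ((r / 2 / ‖κ‖) • κ)‖ < 1 := by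
    refine hpq hy (hball ?_)
    rw [dist_zero_right, norm_smul, Real.norm_of_nonneg (by positivity),
      div_mul_cancel₀ _ hκ'.ne']
    linarith
  rw [map_smul, norm_smul, Real.norm_of_nonneg (by positivity)] at h4
  have h5 : ‖D y κ‖ = (2 / r * ‖κ‖) * (r / 2 / ‖κ‖ * ‖D y κ‖) := by
    field_simp
  rw [h5]
  exact mul_le_of_le_one_right (by positivity) h4.le

/-- Strong continuity of the derivatives becomes uniform on compact sets; this stands in for
continuity in operator norm, which sc-smooth maps need not have. -/
theorem eventually_forall_mem_compact_norm_sub_le {V : Set F₁} {D : F₁ → F₀ →L[ℝ] G₀} {y₀ : F₁}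
    (hy₀ : y₀ ∈ V) (hD : ContinuousOn (fun z : F₁ × F₀ => D z.1 z.2) (V ×ˢ univ))
    {K : Set F₀} (hK : IsCompact K) {ε : ℝ} (hε : 0 < ε) :
    ∀ᶠ y in 𝓝[V] y₀, ∀ κ ∈ K, ‖D y κ - D y₀ κ‖ ≤ ε := by
  rw [← map_nhds_subtype_val ⟨y₀, hy₀⟩, Filter.eventually_map]
  refine hK.eventually_forall_of_forall_eventually fun κ _ => ?_
  have hD' : Continuous fun z : V × F₀ => D z.1 z.2 :=
    hD.comp_continuous (f := fun z : V × F₀ => ((z.1 : F₁), z.2)) (by fun_prop)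
      fun z => ⟨z.1.2, trivial⟩
  have hc : Continuous fun z : V × F₀ => ‖D z.1 z.2 - D y₀ z.2‖ :=
    (hD'.sub ((D y₀).continuous.comp continuous_snd)).norm
  have := hc.tendsto (⟨y₀, hy₀⟩, κ)
  simp only [sub_self, norm_zero] at this
  exact this.eventually_le_const hε

variable [NormedSpace ℝ F₁]

/-- The mean value inequality for `g` on a convex set, with derivatives compared to `D y₀`. -/
theorem norm_sub_sub_le_of_convex {S : Set F₁} (hS : Convex ℝ S) {iF : F₁ →L[ℝ] F₀} {g : F₀ → G₀}
    {D : F₁ → F₀ →L[ℝ] G₀}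
    (hg : ∀ y ∈ S, HasFDerivWithinAt (fun z => g (iF z)) ((D y).comp iF) S y)
    {y₀ y : F₁} (hy₀ : y₀ ∈ S) (hy : y ∈ S) {b : ℝ}
    (hb : ∀ z ∈ S, ‖D z (iF (y - y₀)) - D y₀ (iF (y - y₀))‖ ≤ b) :
    ‖g (iF y) - g (iF y₀) - D y₀ (iF (y - y₀))‖ ≤ b := by
  have hseg : ∀ t ∈ Icc (0 : ℝ) 1, y₀ + t • (y - y₀) ∈ S := fun t ht =>
    hS.add_smul_sub_mem hy₀ hy ht
  have hder : ∀ t ∈ Icc (0 : ℝ) 1, HasDerivWithinAt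
      (fun t : ℝ => g (iF (y₀ + t • (y - y₀))) - t • D y₀ (iF (y - y₀)))
      (D (y₀ + t • (y - y₀)) (iF (y - y₀)) - D y₀ (iF (y - y₀))) (Icc 0 1) t := by
    intro t ht
    have h1 : HasDerivWithinAt (fun t : ℝ => y₀ + t • (y - y₀)) (y - y₀) (Icc 0 1) t := by
      simpa using ((hasDerivWithinAt_id t (Icc (0 : ℝ) 1)).smul_const (y - y₀)).const_add y₀
    have h2 := (hg _ (hseg t ht)).comp_hasDerivWithinAt t h1 hseg
    have h3 : HasDerivWithinAt (fun t : ℝ => t • D y₀ (iF (y - y₀))) (D y₀ (iF (y - y₀)))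
        (Icc 0 1) t := by
      simpa using (hasDerivWithinAt_id t (Icc (0 : ℝ) 1)).smul_const (D y₀ (iF (y - y₀)))
    exact h2.sub h3
  have := norm_image_sub_le_of_norm_deriv_le_segment_01' hder
    fun t ht => hb _ (hseg t (Ico_subset_Icc_self ht))
  simp only [one_smul, zero_smul, add_zero, sub_zero, add_sub_cancel] at this
  convert this using 2
  abel

/-- The chain rule of sc-calculus: `f` is only continuous as a map into `F₁`, and differentiable as
a map into `F₀`, while `g` is only differentiable along `F₁`. -/
theorem hasFDerivWithinAt_comp_of_compact {iE : E₁ →L[ℝ] E₀} (hiE : IsCompactOperator iE)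
    {iF : F₁ →L[ℝ] F₀} {U : Set E₁} {C N : Set F₁} (hC : Convex ℝ C) (hN : IsOpen N)
    {f : E₁ → F₁} {g : F₀ → G₀} {A : E₀ →L[ℝ] F₀} {D : F₁ → F₀ →L[ℝ] G₀} {x : E₁}
    (hf : HasFDerivWithinAt (fun y => iF (f y)) (A.comp iE) U x)
    (hfc : ContinuousWithinAt f U x) (hUV : MapsTo f U (C ∩ N)) (hx : x ∈ U)
    (hg : ∀ y ∈ C ∩ N, HasFDerivWithinAt (fun z => g (iF z)) ((D y).comp iF) (C ∩ N) y)
    (hD : ContinuousOn (fun z : F₁ × F₀ => D z.1 z.2) ((C ∩ N) ×ˢ univ)) :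
    HasFDerivWithinAt (fun y => g (iF (f y))) (((D (f x)).comp A).comp iE) U x := by
  have hy₀ : f x ∈ C ∩ N := hUV hx
  obtain ⟨M, hM, hMb⟩ := exists_eventually_norm_le hy₀ hD
  -- Here compactness of `E₁ → E₀` enters: the normalized increments `A (iE h) / ‖h‖` all lie in one
  -- compact set.
  obtain ⟨K, hK, hKb⟩ := (hiE.clm_comp A).image_closedBall_subset_compact
    (f := ((A.comp iE : E₁ →L[ℝ] F₀) : E₁ →ₗ[ℝ] F₀)) 1
  have hDy₀ : ‖D (f x)‖ ≤ M := hMb.self_of_nhdsWithin hy₀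
  have hKs : ∀ h : E₁, ∃ κ ∈ K, A (iE h) = ‖h‖ • κ := by
    intro h
    rcases eq_or_ne h 0 with rfl | hh
    · exact ⟨0, hKb ⟨0, by simp, map_zero _⟩, by simp⟩
    · have hh' : ‖h‖ ≠ 0 := norm_ne_zero_iff.2 hh
      refine ⟨A (iE (‖h‖⁻¹ • h)), hKb ⟨‖h‖⁻¹ • h, ?_, rfl⟩, ?_⟩
      · simp [norm_smul, hh']
      · rw [map_smul, map_smul, smul_inv_smul₀ hh']
  rw [hasFDerivWithinAt_iff_isLittleO, Asymptotics.isLittleO_iff] at hf ⊢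
  intro c hc
  obtain ⟨δ₁, hδ₁, hball₁⟩ := Metric.mem_nhdsWithin_iff.1
    (hMb.and (eventually_forall_mem_compact_norm_sub_le hy₀ hD hK (half_pos hc)))
  obtain ⟨δ₂, hδ₂, hball₂⟩ := Metric.isOpen_iff.1 hN _ hy₀.2
  set S : Set F₁ := C ∩ Metric.ball (f x) (min δ₁ δ₂) with hS
  have hSV : S ⊆ C ∩ N := fun z hz =>
    ⟨hz.1, hball₂ (Metric.ball_subset_ball (min_le_right _ _) hz.2)⟩
  have hSb : ∀ z ∈ S, ‖D z‖ ≤ M ∧ ∀ κ ∈ K, ‖D z κ - D (f x) κ‖ ≤ c / 2 := fun z hz =>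
    hball₁ ⟨Metric.ball_subset_ball (min_le_left _ _) hz.2, hSV hz⟩
  have hxS : f x ∈ S := ⟨hy₀.1, Metric.mem_ball_self (lt_min hδ₁ hδ₂)⟩
  have hSc : Convex ℝ S := hC.inter (convex_ball _ _)
  have hfS : ∀ᶠ x' in 𝓝[U] x, f x' ∈ S := by
    filter_upwards [hfc (Metric.ball_mem_nhds _ (lt_min hδ₁ hδ₂)), self_mem_nhdsWithin] with x' h1 h2
    exact ⟨(hUV h2).1, h1⟩
  -- The error `c` is split as `c / 2` for the compact part plus three terms `c / 6`: two for `D z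
  -- r` and `D (f x) r` in the mean value estimate, and one for replacing `k` by `A (iE h)` at the
  -- end.
  filter_upwards [hfS, hf (show 0 < c / (6 * M) by positivity)] with x' hx' hr
  set h := x' - x with hh
  obtain ⟨κ, hκ, hκA⟩ := hKs h
  set k := iF (f x' - f x) with hk
  set r := k - A (iE h) with hrdef
  have hr' : ‖r‖ ≤ c / (6 * M) * ‖h‖ := by
    rw [hrdef, hk, map_sub]
    exact hr
  have hDr : ∀ z, ‖D z‖ ≤ M → ‖D z r‖ ≤ c / 6 * ‖h‖ := fun z hz => by
    calc ‖D z r‖ ≤ M * (c / (6 * M) * ‖h‖) :=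
          (D z).le_of_opNorm_le_of_le hz hr'
      _ = c / 6 * ‖h‖ := by field_simp
  have hka : k = ‖h‖ • κ + r := by rw [hrdef, hκA]; abel
  have hmv := norm_sub_sub_le_of_convex hSc (fun y hy => (hg y (hSV hy)).mono hSV) hxS hx'
    (b := c / 2 * ‖h‖ + (c / 6 * ‖h‖ + c / 6 * ‖h‖)) (fun z hz => by
      change ‖D z k - D (f x) k‖ ≤ _
      have e : D z k - D (f x) k = ‖h‖ • (D z κ - D (f x) κ) + (D z r - D (f x) r) := by
        rw [hka, map_add, map_add, map_smul, map_smul, smul_sub]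
        abel
      rw [e]
      refine (norm_add_le _ _).trans (add_le_add ?_ ?_)
      · rw [norm_smul, norm_norm, mul_comm]
        exact mul_le_mul_of_nonneg_right ((hSb z hz).2 κ hκ) (norm_nonneg _)
      · exact (norm_sub_le _ _).trans (add_le_add (hDr z (hSb z hz).1) (hDr _ hDy₀)))
  have e2 : g (iF (f x')) - g (iF (f x)) - (((D (f x)).comp A).comp iE) h =
      (g (iF (f x')) - g (iF (f x)) - D (f x) k) + D (f x) r := by
    change _ - D (f x) (A (iE h)) = _
    have : D (f x) r = D (f x) k - D (f x) (A (iE h)) := map_sub _ _ _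
    rw [this, sub_add_sub_cancel]
  rw [e2]
  refine (norm_add_le _ _).trans ((add_le_add hmv (hDr _ hDy₀)).trans_eq ?_)
  ring

end ChainRule

/-! ### sc-derivatives at smooth points -/

namespace ScBanach

theorem prod_incl (E F : ScBanach.{u}) : ∀ (m : ℕ) (z : (E.prod F).lvl m),
    (E.prod F).incl m z = ((E.incl m z.1, F.incl m z.2) : E.lvl 0 × F.lvl 0)
  | 0, _ => rfl
  | m + 1, z => prod_incl E F m ((E.prod F).step m z)

theorem prod_incl_eq {E F : ScBanach.{u}} {m : ℕ} {z : E.lvl m × F.lvl m}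
    {w : E.lvl 0 × F.lvl 0} (h1 : E.incl m z.1 = w.1) (h2 : F.incl m z.2 = w.2) :
    (E.prod F).incl m z = w :=
  (prod_incl E F m z).trans (Prod.ext h1 h2)

theorem incl_shift_incl (E : ScBanach.{u}) : ∀ (m : ℕ) (x : E.lvl (m + 1)),
    E.incl 1 (E.shift.incl m x) = E.incl (m + 1) x
  | 0, _ => rfl
  | m + 1, x => incl_shift_incl E m (E.step (m + 1) x)

theorem isSmooth_prod {E F : ScBanach.{u}} {z : E.lvl 0 × F.lvl 0} :
    (E.prod F).IsSmooth z ↔ E.IsSmooth z.1 ∧ F.IsSmooth z.2 := by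
  constructor
  · intro h
    refine ⟨fun m => ?_, fun m => ?_⟩
    · obtain ⟨y, hy⟩ := h m
      exact ⟨y.1, by rw [← hy, prod_incl]⟩
    · obtain ⟨y, hy⟩ := h m
      exact ⟨y.2, by rw [← hy, prod_incl]⟩
  · rintro ⟨h1, h2⟩ m
    obtain ⟨y1, hy1⟩ := h1 m
    obtain ⟨y2, hy2⟩ := h2 m
    exact ⟨((y1, y2) : E.lvl m × F.lvl m), prod_incl_eq hy1 hy2⟩

theorem isScOperator_fst (E F : ScBanach.{u}) : IsScOperator (E.prod F).filtration E.filtration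
    (LinearMap.fst ℝ (E.lvl 0) (F.lvl 0)) :=
  isScOperator_of_continuous (E := E.prod F) fun m =>
    ⟨fun z => z.1, continuous_fst, fun z => by rw [prod_incl]; rfl⟩

theorem isScOperator_snd (E F : ScBanach.{u}) : IsScOperator (E.prod F).filtration F.filtration
    (LinearMap.snd ℝ (E.lvl 0) (F.lvl 0)) :=
  isScOperator_of_continuous (E := E.prod F) fun m =>
    ⟨fun z => z.2, continuous_snd, fun z => by rw [prod_incl]; rfl⟩

theorem isScOperator_prod {E F G : ScBanach.{u}} {A : E.lvl 0 →ₗ[ℝ] F.lvl 0}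
    {B : E.lvl 0 →ₗ[ℝ] G.lvl 0} (hA : IsScOperator E.filtration F.filtration A)
    (hB : IsScOperator E.filtration G.filtration B) :
    IsScOperator E.filtration (F.prod G).filtration (A.prod B) := by
  refine isScOperator_of_continuous (F := F.prod G) fun m => ?_
  obtain ⟨Am, hAm⟩ := isScOperator_iff.1 hA m
  obtain ⟨Bm, hBm⟩ := isScOperator_iff.1 hB m
  exact ⟨fun x => (Am x, Bm x), Am.continuous.prodMk Bm.continuous,
    fun x => prod_incl_eq (hAm x) (hBm x)⟩

end ScBanach

/-- Relatively open subsets of convex sets which are fat on level `1`. -/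
def IsScDomain (E : ScBanach.{u}) (U : Set (E.lvl 0)) : Prop :=
  ∃ C N : Set (E.lvl 0), Convex ℝ C ∧ (interior (E.incl 1 ⁻¹' C)).Nonempty ∧ IsOpen N ∧ U = C ∩ N

namespace IsScDomain

variable {E F : ScBanach.{u}} {U : Set (E.lvl 0)}

theorem univ : IsScDomain E univ :=
  ⟨Set.univ, Set.univ, convex_univ, by simp, isOpen_univ, by simp⟩

theorem inter_open (hU : IsScDomain E U) {N : Set (E.lvl 0)} (hN : IsOpen N) :
    IsScDomain E (U ∩ N) := by
  obtain ⟨C, N', hC, hi, hN', rfl⟩ := hU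
  exact ⟨C, N' ∩ N, hC, hi, hN'.inter hN, inter_assoc _ _ _⟩

theorem prod_univ (hU : IsScDomain E U) :
    IsScDomain (E.prod F) {z : E.lvl 0 × F.lvl 0 | z.1 ∈ U} := by
  obtain ⟨C, N, hC, ⟨x, hx⟩, hN, rfl⟩ := hU
  refine ⟨{z : E.lvl 0 × F.lvl 0 | z.1 ∈ C}, {z : E.lvl 0 × F.lvl 0 | z.1 ∈ N},
    hC.linear_preimage (LinearMap.fst ℝ (E.lvl 0) (F.lvl 0)), ?_,
    hN.preimage continuous_fst, rfl⟩
  obtain ⟨t, ht, hto, hxt⟩ := mem_interior.1 hx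
  exact ⟨((x, 0) : E.lvl 1 × F.lvl 1), mem_interior.2
    ⟨{z : E.lvl 1 × F.lvl 1 | z.1 ∈ t}, fun z hz => ht hz, hto.preimage continuous_fst, hxt⟩⟩

theorem uniqueDiffWithinAt (hU : IsScDomain E U) {x : E.lvl 1} (hx : E.incl 1 x ∈ U) :
    UniqueDiffWithinAt ℝ (E.incl 1 ⁻¹' U) x := by
  obtain ⟨C, N, hC, hi, hN, rfl⟩ := hU
  have h1 : Convex ℝ (E.incl 1 ⁻¹' C) :=
    hC.linear_preimage (E.incl 1 : E.lvl 1 →ₗ[ℝ] E.lvl 0)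
  exact ((uniqueDiffOn_convex h1 hi) x hx.1).inter
    ((hN.preimage (E.incl 1).continuous).mem_nhds hx.2)

end IsScDomain

section HasScDerivAt

variable {E F G H : ScBanach.{u}} {U : Set (E.lvl 0)} {f g : E.lvl 0 → F.lvl 0} {x : E.lvl 1}
  {D D' : E.lvl 0 →L[ℝ] F.lvl 0}

/-- Fatness of the domain on level `1` determines the derivative on `E_1`, which is dense in `E_0`.
-/
theorem HasScDerivAt.unique (hU : IsScDomain E U) (hx : E.incl 1 x ∈ U)
    (h : HasScDerivAt E F U f x D) (h' : HasScDerivAt E F U f x D') : D = D' := by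
  have h1 := (hU.uniqueDiffWithinAt hx).eq h h'
  refine ContinuousLinearMap.ext_on (s := range (E.incl 1)) ?_ ?_
  · refine E.dense_smooth.mono fun y hy => Submodule.subset_span ?_
    exact ScFiltration.mem_smooth.1 hy 1
  · rintro _ ⟨y, rfl⟩
    exact DFunLike.congr_fun h1 y

/-- sc-derivatives depend only on the germ of the map. -/
theorem HasScDerivAt.of_local (h : HasScDerivAt E F U f x D) {U' N : Set (E.lvl 0)}
    (hN : IsOpen N) (hx : E.incl 1 x ∈ N) (hUN : U' ∩ N ⊆ U) (hg : ∀ y ∈ U' ∩ N, g y = f y)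
    (hgx : g (E.incl 1 x) = f (E.incl 1 x)) : HasScDerivAt E F U' g x D := by
  have h1 : HasFDerivWithinAt (fun y : E.lvl 1 => f (E.incl 1 y)) (D.comp (E.incl 1))
      (E.incl 1 ⁻¹' U' ∩ E.incl 1 ⁻¹' N) x := HasFDerivWithinAt.mono h fun y hy => hUN hy
  have h2 := h1.congr (f₁ := fun y : E.lvl 1 => g (E.incl 1 y)) (fun y hy => hg _ hy) hgx
  exact (hasFDerivWithinAt_inter ((hN.preimage (E.incl 1).continuous).mem_nhds hx)).1 h2

end HasScDerivAt

/-- A weak form of `sc¹`: there are sc-derivatives which depend continuously, in the strong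
operator topology, on the point of level `1`. -/
def ScC1On (E F : ScBanach.{u}) (U : Set (E.lvl 0)) (f : E.lvl 0 → F.lvl 0) : Prop :=
  ∃ D : E.lvl 1 → E.lvl 0 →L[ℝ] F.lvl 0,
    (∀ x, E.incl 1 x ∈ U → HasScDerivAt E F U f x (D x)) ∧
    ContinuousOn (fun z : E.lvl 1 × E.lvl 0 => D z.1 z.2) ((E.incl 1 ⁻¹' U) ×ˢ univ)

/-- The properties at a smooth point `x ∈ U` of an `sc¹`-map `f : U → F` with derivative `D` at `x`:
`f x` is smooth, `f` is continuous on level `1`, and `D` is an sc-operator. -/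
structure ScGermAt (E F : ScBanach.{u}) (U : Set (E.lvl 0)) (f : E.lvl 0 → F.lvl 0) (x : E.lvl 0)
    (D : E.lvl 0 →L[ℝ] F.lvl 0) : Prop where
  mem : x ∈ U
  smooth : E.IsSmooth x
  smooth_map : F.IsSmooth (f x)
  lift : ∃ f₁ : E.lvl 1 → F.lvl 1, ContinuousOn f₁ (E.incl 1 ⁻¹' U) ∧
    ∀ y, E.incl 1 y ∈ U → F.incl 1 (f₁ y) = f (E.incl 1 y)
  deriv : ∃ x₁, E.incl 1 x₁ = x ∧ HasScDerivAt E F U f x₁ D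
  op : IsScOperator E.filtration F.filtration (D : E.lvl 0 →ₗ[ℝ] F.lvl 0)

section Germ

variable {E F G H : ScBanach.{u}} {U : Set (E.lvl 0)} {f g : E.lvl 0 → F.lvl 0} {x : E.lvl 0}
  {D D' : E.lvl 0 →L[ℝ] F.lvl 0}

theorem IsScZero.isSmooth_map (h : IsScZero E F U f) (hx : x ∈ U) (hs : E.IsSmooth x) :
    F.IsSmooth (f x) := fun m => by
  obtain ⟨fm, -, hfm⟩ := h m
  obtain ⟨y, rfl⟩ := hs m
  exact ⟨fm y, hfm y hx⟩

theorem ScSmooth.scC1On (h : ScSmooth E F U f) : ScC1On E F U f := by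
  obtain ⟨-, Tf, hT, hTz⟩ := h 1
  obtain ⟨T₀, hT₀c, hT₀⟩ := hTz 0
  choose! D hD using hT
  refine ⟨D, fun x hx => (hD x hx).1, ?_⟩
  have h1 : ContinuousOn (fun z : E.lvl 1 × E.lvl 0 => (T₀ z).2) ((E.incl 1 ⁻¹' U) ×ˢ univ) :=
    continuous_snd.comp_continuousOn (hT₀c.mono fun z hz => hz.1)
  refine h1.congr fun z hz => ?_
  have h2 : T₀ z = Tf z := hT₀ z hz.1
  change D z.1 z.2 = (T₀ z).2
  rw [h2]
  exact ((hD z.1 hz.1).2 z.2).2.symm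

/-- Level `m` of `TU` is `U_{m+1} ⊕ E_m`. As `x` is smooth, the base point can be frozen at `x` on
every level, and continuity of the tangent map along this slice makes `D` continuous `E_m → F_m`. -/
theorem ScSmooth.exists_germ (h : ScSmooth E F U f) (hx : x ∈ U) (hs : E.IsSmooth x) :
    ∃ D, ScGermAt E F U f x D := by
  obtain ⟨hz, Tf, hT, hTz⟩ := h 1
  obtain ⟨x₁, rfl⟩ := hs 1
  obtain ⟨D, hD, hDT⟩ := hT x₁ hx
  refine ⟨D, hx, hs, hz.isSmooth_map hx hs, hz 1, ⟨x₁, rfl, hD⟩, ?_⟩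
  refine ScBanach.isScOperator_of_continuous fun m => ?_
  obtain ⟨Tm, hTc, hTm⟩ := hTz m
  obtain ⟨y, hy⟩ := hs (m + 1)
  have hy' : E.shift.incl m y = x₁ := by
    apply E.incl_injective 1
    rw [ScBanach.incl_shift_incl, hy]
  have hin : ∀ h : E.lvl m, E.tangent.incl m ((y, h) : E.lvl (m + 1) × E.lvl m) =
      ((x₁, E.incl m h) : E.lvl 1 × E.lvl 0) := fun h => by
    rw [← hy']
    exact ScBanach.prod_incl E.shift E m _
  have hmem : ∀ h : E.lvl m, E.tangent.incl m ((y, h) : E.lvl (m + 1) × E.lvl m) ∈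
      {z : E.lvl 1 × E.lvl 0 | E.incl 1 z.1 ∈ U} := fun h => by
    rw [hin]
    exact hx
  have hc : Continuous fun h : E.lvl m => Tm ((y, h) : E.lvl (m + 1) × E.lvl m) :=
    hTc.comp_continuous (f := fun h : E.lvl m => ((y, h) : E.lvl (m + 1) × E.lvl m))
      (continuous_const.prodMk continuous_id) hmem
  refine ⟨fun h => (Tm ((y, h) : E.lvl (m + 1) × E.lvl m)).2, continuous_snd.comp hc, fun h => ?_⟩
  have h1 := hTm _ (hmem h)
  rw [hin] at h1
  have h2 := ScBanach.prod_incl F.shift F m (Tm ((y, h) : E.lvl (m + 1) × E.lvl m))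
  have h3 := h2.symm.trans h1
  exact (congrArg Prod.snd h3).trans (hDT (E.incl m h)).2

namespace ScGermAt

theorem unique (hU : IsScDomain E U) (h : ScGermAt E F U f x D) (h' : ScGermAt E F U f x D') :
    D = D' := by
  obtain ⟨x₁, rfl, h1⟩ := h.deriv
  obtain ⟨x₂, hx, h2⟩ := h'.deriv
  obtain rfl := E.incl_injective 1 hx
  exact h1.unique hU h.mem h2

theorem scDeriv_eq (hU : IsScDomain E U) (h : ScGermAt E F U f x D) :
    scDeriv E F U f x = D := by
  obtain ⟨x₁, rfl, h1⟩ := h.deriv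
  have hex : ∃ D : E.lvl 0 →L[ℝ] F.lvl 0, ∃ y : E.lvl 1, E.incl 1 y = E.incl 1 x₁ ∧
      HasScDerivAt E F U f y D := ⟨D, x₁, rfl, h1⟩
  unfold scDeriv
  rw [dif_pos hex]
  obtain ⟨y, hy, h2⟩ := hex.choose_spec
  obtain rfl := E.incl_injective 1 hy
  exact h2.unique hU h.mem h1

theorem congr (h : ScGermAt E F U f x D) (hg : ∀ y ∈ U, g y = f y) : ScGermAt E F U g x D := by
  refine ⟨h.mem, h.smooth, ?_, ?_, ?_, h.op⟩
  · rw [hg x h.mem]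
    exact h.smooth_map
  · obtain ⟨f₁, hc, hf₁⟩ := h.lift
    exact ⟨f₁, hc, fun y hy => by rw [hf₁ y hy, hg _ hy]⟩
  · obtain ⟨x₁, rfl, h1⟩ := h.deriv
    exact ⟨x₁, rfl, h1.of_local isOpen_univ (mem_univ _) inter_subset_left
      (fun y hy => hg y hy.1) (hg _ h.mem)⟩

theorem mono (h : ScGermAt E F U f x D) {U' : Set (E.lvl 0)} (hU : U' ⊆ U) (hx : x ∈ U') :
    ScGermAt E F U' f x D := by
  refine ⟨hx, h.smooth, h.smooth_map, ?_, ?_, h.op⟩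
  · obtain ⟨f₁, hc, hf₁⟩ := h.lift
    exact ⟨f₁, hc.mono (preimage_mono hU), fun y hy => hf₁ y (hU hy)⟩
  · obtain ⟨x₁, rfl, h1⟩ := h.deriv
    exact ⟨x₁, rfl, HasFDerivWithinAt.mono h1 (preimage_mono hU)⟩

/-- The derivative of a map on a larger domain is computed on a neighbourhood. -/
theorem scDeriv_eq_of_local (h : ScGermAt E F U f x D) {U' N : Set (E.lvl 0)}
    (hU' : IsScDomain E U') (hx : x ∈ U') (hN : IsOpen N) (hxN : x ∈ N) (hUN : U' ∩ N ⊆ U)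
    (hg : ∀ y ∈ U' ∩ N, g y = f y) : scDeriv E F U' g x = D := by
  obtain ⟨x₁, rfl, h1⟩ := h.deriv
  have h1' : HasScDerivAt E F U' g x₁ D :=
    h1.of_local hN hxN hUN hg (hg _ ⟨hx, hxN⟩)
  have hex : ∃ D : E.lvl 0 →L[ℝ] F.lvl 0, ∃ y : E.lvl 1, E.incl 1 y = E.incl 1 x₁ ∧
      HasScDerivAt E F U' g y D := ⟨D, x₁, rfl, h1'⟩
  unfold scDeriv
  rw [dif_pos hex]
  obtain ⟨y, hy, h2⟩ := hex.choose_spec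
  obtain rfl := E.incl_injective 1 hy
  exact h2.unique hU' hx h1'

theorem add (h : ScGermAt E F U f x D) (h' : ScGermAt E F U g x D') :
    ScGermAt E F U (fun y => f y + g y) x (D + D') := by
  refine ⟨h.mem, h.smooth, fun m => ?_, ?_, ?_, ?_⟩
  · obtain ⟨y, hy⟩ := h.smooth_map m
    obtain ⟨y', hy'⟩ := h'.smooth_map m
    exact ⟨y + y', by rw [map_add, hy, hy']⟩
  · obtain ⟨f₁, hc, hf₁⟩ := h.lift
    obtain ⟨g₁, hgc, hg₁⟩ := h'.lift
    exact ⟨fun y => f₁ y + g₁ y, hc.add hgc, fun y hy => by rw [map_add, hf₁ y hy, hg₁ y hy]⟩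
  · obtain ⟨x₁, rfl, h1⟩ := h.deriv
    obtain ⟨x₂, hx, h2⟩ := h'.deriv
    obtain rfl := E.incl_injective 1 hx
    exact ⟨x₂, rfl, HasFDerivWithinAt.add h1 h2⟩
  · exact h.op.add F.filtration_isRegular h'.op

theorem sub (h : ScGermAt E F U f x D) (h' : ScGermAt E F U g x D') :
    ScGermAt E F U (fun y => f y - g y) x (D - D') := by
  refine ⟨h.mem, h.smooth, fun m => ?_, ?_, ?_, ?_⟩
  · obtain ⟨y, hy⟩ := h.smooth_map m
    obtain ⟨y', hy'⟩ := h'.smooth_map m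
    exact ⟨y - y', by rw [map_sub, hy, hy']⟩
  · obtain ⟨f₁, hc, hf₁⟩ := h.lift
    obtain ⟨g₁, hgc, hg₁⟩ := h'.lift
    exact ⟨fun y => f₁ y - g₁ y, hc.sub hgc, fun y hy => by rw [map_sub, hf₁ y hy, hg₁ y hy]⟩
  · obtain ⟨x₁, rfl, h1⟩ := h.deriv
    obtain ⟨x₂, hx, h2⟩ := h'.deriv
    obtain rfl := E.incl_injective 1 hx
    exact ⟨x₂, rfl, HasFDerivWithinAt.sub h1 h2⟩
  · exact h.op.sub F.filtration_isRegular h'.op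

theorem prodMk {k : E.lvl 0 → G.lvl 0} {D' : E.lvl 0 →L[ℝ] G.lvl 0}
    (h : ScGermAt E F U f x D) (h' : ScGermAt E G U k x D') :
    ScGermAt E (F.prod G) U (fun y => ((f y, k y) : F.lvl 0 × G.lvl 0)) x (D.prod D') := by
  refine ⟨h.mem, h.smooth, ScBanach.isSmooth_prod.2 ⟨h.smooth_map, h'.smooth_map⟩, ?_, ?_, ?_⟩
  · obtain ⟨f₁, hc, hf₁⟩ := h.lift
    obtain ⟨g₁, hgc, hg₁⟩ := h'.lift
    exact ⟨fun y => (f₁ y, g₁ y), hc.prodMk hgc,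
      fun y hy => ScBanach.prod_incl_eq (hf₁ y hy) (hg₁ y hy)⟩
  · obtain ⟨x₁, rfl, h1⟩ := h.deriv
    obtain ⟨x₂, hx, h2⟩ := h'.deriv
    obtain rfl := E.incl_injective 1 hx
    exact ⟨x₂, rfl, HasFDerivWithinAt.prodMk h1 h2⟩
  · exact ScBanach.isScOperator_prod h.op h'.op

/-- sc-operators, as maps. -/
theorem of_isScOperator (hD : IsScOperator E.filtration F.filtration (D : E.lvl 0 →ₗ[ℝ] F.lvl 0))
    (hx : x ∈ U) (hs : E.IsSmooth x) : ScGermAt E F U D x D := by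
  refine ⟨hx, hs, ?_, ?_, ?_, hD⟩
  · rw [ScBanach.isSmooth_iff] at hs ⊢
    exact hD.mem_smooth hs
  · obtain ⟨D₁, hD₁⟩ := ScBanach.isScOperator_iff.1 hD 1
    exact ⟨D₁, D₁.continuous.continuousOn, fun y _ => hD₁ y⟩
  · obtain ⟨x₁, rfl⟩ := hs 1
    exact ⟨x₁, rfl, (D.comp (E.incl 1)).hasFDerivWithinAt⟩

theorem const {y : F.lvl 0} (hy : F.IsSmooth y) (hx : x ∈ U) (hs : E.IsSmooth x) :
    ScGermAt E F U (fun _ => y) x 0 := by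
  refine ⟨hx, hs, hy, ?_, ?_, ?_⟩
  · obtain ⟨y₁, hy₁⟩ := hy 1
    exact ⟨fun _ => y₁, continuousOn_const, fun _ _ => hy₁⟩
  · obtain ⟨x₁, rfl⟩ := hs 1
    refine ⟨x₁, rfl, ?_⟩
    unfold HasScDerivAt
    rw [ContinuousLinearMap.zero_comp]
    exact hasFDerivWithinAt_const _ _ _
  · exact ScBanach.IsScPlusOperator.zero.isScOperator

theorem id (hx : x ∈ U) (hs : E.IsSmooth x) :
    ScGermAt E E U (fun y => y) x (ContinuousLinearMap.id ℝ _) :=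
  of_isScOperator (D := ContinuousLinearMap.id ℝ _) IsScOperator.id hx hs

/-- The chain rule. -/
theorem comp {V : Set (F.lvl 0)} {k : F.lvl 0 → G.lvl 0} {B : F.lvl 0 →L[ℝ] G.lvl 0}
    (hk : ScGermAt F G V k (f x) B) (h : ScGermAt E F U f x D) (hkC : ScC1On F G V k)
    (hV : IsScDomain F V) (hUV : MapsTo f U V) :
    ScGermAt E G U (fun y => k (f y)) x (B.comp D) := by
  refine ⟨h.mem, h.smooth, hk.smooth_map, ?_, ?_, hk.op.comp h.op⟩
  · obtain ⟨f₁, hc, hf₁⟩ := h.lift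
    obtain ⟨k₁, hkc, hk₁⟩ := hk.lift
    have hm : ∀ y, E.incl 1 y ∈ U → F.incl 1 (f₁ y) ∈ V := fun y hy => by
      rw [hf₁ y hy]
      exact hUV hy
    exact ⟨fun y => k₁ (f₁ y), hkc.comp hc hm, fun y hy => by rw [hk₁ _ (hm y hy), hf₁ y hy]⟩
  · obtain ⟨f₁, hc, hf₁⟩ := h.lift
    obtain ⟨x₁, rfl, h1⟩ := h.deriv
    refine ⟨x₁, rfl, ?_⟩
    obtain ⟨B', hB', hBc⟩ := hkC
    have hmem := h.mem
    have hV' := hV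
    obtain ⟨C, N, hC, -, hN, rfl⟩ := hV
    have hm : ∀ y, E.incl 1 y ∈ U → F.incl 1 (f₁ y) ∈ C ∩ N := fun y hy => by
      rw [hf₁ y hy]
      exact hUV hy
    -- The chain rule uses a field of derivatives of `k` near `f x`; uniqueness identifies its value
    -- there with the given `B`.
    have hBB : B' (f₁ x₁) = B := by
      obtain ⟨z, hz, h2⟩ := hk.deriv
      rw [← hf₁ x₁ hmem] at hz
      obtain rfl := F.incl_injective 1 hz
      exact (hB' _ (hm _ hmem)).unique hV' (hm _ hmem) h2
    have h3 : HasFDerivWithinAt (fun y => F.incl 1 (f₁ y)) (D.comp (E.incl 1)) (E.incl 1 ⁻¹' U) x₁ :=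
      HasFDerivWithinAt.congr h1 (fun y hy => hf₁ y hy) (hf₁ x₁ hmem)
    have h4 := hasFDerivWithinAt_comp_of_compact (E.step_compact 0)
      (hC.linear_preimage (F.incl 1 : F.lvl 1 →ₗ[ℝ] F.lvl 0)) (hN.preimage (F.incl 1).continuous)
      h3 (hc x₁ hmem) hm hmem (g := k) (D := B') hB' hBc
    rw [hBB] at h4
    exact HasFDerivWithinAt.congr h4 (fun y hy => by rw [hf₁ y hy]) (by rw [hf₁ x₁ hmem])

end ScGermAt

namespace ScC1On

theorem sub (h : ScC1On E F U f) (h' : ScC1On E F U g) : ScC1On E F U (fun y => f y - g y) := by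
  obtain ⟨D, hD, hDc⟩ := h
  obtain ⟨D', hD', hDc'⟩ := h'
  exact ⟨fun x => D x - D' x, fun x hx => HasFDerivWithinAt.sub (hD x hx) (hD' x hx),
    hDc.sub hDc'⟩

theorem mono (h : ScC1On E F U f) {U' : Set (E.lvl 0)} (hU : U' ⊆ U) : ScC1On E F U' f := by
  obtain ⟨D, hD, hDc⟩ := h
  exact ⟨D, fun x hx => HasFDerivWithinAt.mono (hD x (hU hx)) (preimage_mono hU),
    hDc.mono (prod_mono (preimage_mono hU) Subset.rfl)⟩

theorem of_clm (A : E.lvl 0 →L[ℝ] F.lvl 0) : ScC1On E F U A :=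
  ⟨fun _ => A, fun _ _ => (A.comp (E.incl 1)).hasFDerivWithinAt,
    (A.continuous.comp continuous_snd).continuousOn⟩

theorem prodMk {k : E.lvl 0 → G.lvl 0} (h : ScC1On E F U f) (h' : ScC1On E G U k) :
    ScC1On E (F.prod G) U (fun y => ((f y, k y) : F.lvl 0 × G.lvl 0)) := by
  obtain ⟨D, hD, hDc⟩ := h
  obtain ⟨D', hD', hDc'⟩ := h'
  exact ⟨fun x => (D x).prod (D' x), fun x hx => HasFDerivWithinAt.prodMk (hD x hx) (hD' x hx),
    hDc.prodMk hDc'⟩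

end ScC1On

/-- Apply the germ statement to the map into `F¹`: its derivative is an sc-operator `E → F¹`, which
therefore gains one level. -/
theorem ScPlusSmooth.exists_germ (h : ScPlusSmooth E F U f) (hx : x ∈ U) (hs : E.IsSmooth x) :
    ∃ D, ScGermAt E F U f x D ∧
      ScBanach.IsScPlusOperator E F (D : E.lvl 0 →ₗ[ℝ] F.lvl 0) := by
  obtain ⟨f₁, hf₁, hsm⟩ := h
  obtain ⟨D₁, hD₁⟩ := hsm.exists_germ hx hs
  have hp : ScBanach.IsScPlusOperator E F
      (((F.incl 1).comp D₁ : E.lvl 0 →L[ℝ] F.lvl 0) : E.lvl 0 →ₗ[ℝ] F.lvl 0) := fun m => by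
    obtain ⟨Dm, hDm⟩ := ScBanach.isScOperator_iff.1 hD₁.op m
    exact ⟨Dm, fun y => (F.incl_shift_incl m (Dm y)).symm.trans (congrArg (F.incl 1) (hDm y))⟩
  refine ⟨(F.incl 1).comp D₁, ⟨hx, hs, fun m => ?_, ?_, ?_, hp.isScOperator⟩, hp⟩
  · obtain ⟨y, hy⟩ := hD₁.smooth_map m
    exact ⟨F.step m y, (F.incl_shift_incl m y).symm.trans
      ((congrArg (F.incl 1) hy).trans (hf₁ x hx))⟩
  · obtain ⟨f₂, hc, hf₂⟩ := hD₁.lift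
    exact ⟨fun y => F.step 1 (f₂ y), (F.step 1).continuous.comp_continuousOn hc, fun y hy =>
      (F.incl_shift_incl 1 (f₂ y)).symm.trans
        ((congrArg (F.incl 1) (hf₂ y hy)).trans (hf₁ _ hy))⟩
  · obtain ⟨x₁, rfl, h1⟩ := hD₁.deriv
    refine ⟨x₁, rfl, ?_⟩
    exact HasFDerivWithinAt.congr ((F.incl 1).hasFDerivAt.comp_hasFDerivWithinAt x₁ h1)
      (fun y hy => (hf₁ _ hy).symm) (hf₁ _ hx).symm

end Germ

/-! ### Splicings and charts -/

theorem IsPartialQuadrant.isScDomain {W : ScBanach.{u}} {C : Set (W.lvl 0)}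
    (hC : IsPartialQuadrant W C) : IsScDomain W C := by
  obtain ⟨n, Q, T, hT, rfl⟩ := hC
  refine ⟨_, univ, ?_, ?_, isOpen_univ, (inter_univ _).symm⟩
  · intro x hx y hy a b ha hb _ i
    rw [map_add, map_smul, map_smul]
    exact add_nonneg (mul_nonneg ha (hx i)) (mul_nonneg hb (hy i))
  -- An interior point on level `1`: all quadrant coordinates equal to `1`.
  · refine ⟨(T 1).symm (fun _ => 1, 0), mem_interior.2
      ⟨{x | ∀ i, 0 < (T 1 x).1 i}, fun x hx i => ?_, ?_, fun i => ?_⟩⟩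
    · have h1 : T 0 (W.incl 1 x) = ((T 1 x).1, Q.step 0 (T 1 x).2) := hT 0 x
      rw [h1]
      exact (hx i).le
    · simp only [Set.ofPred_forall]
      refine isOpen_iInter_of_finite fun i => ?_
      exact isOpen_lt continuous_const
        ((continuous_apply i).comp (continuous_fst.comp (T 1).continuous))
    · rw [ContinuousLinearEquiv.apply_symm_apply]
      exact one_pos

theorem ScSmooth.continuousOn {E F : ScBanach.{u}} {U : Set (E.lvl 0)} {f : E.lvl 0 → F.lvl 0}
    (h : ScSmooth E F U f) : ContinuousOn f U := by
  obtain ⟨f₀, hc, hf₀⟩ := h 0 0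
  exact hc.congr fun x hx => (hf₀ x hx).symm

/-! ### Maps linear in the fibres -/

section FibreLinear

variable {H G F F' : ScBanach.{u}} {U : Set (G.lvl 0)} {g : G.lvl 0 × F.lvl 0 → F'.lvl 0}
  {T : F.lvl 0 →ₗ[ℝ] F'.lvl 0} {x : G.lvl 0}

theorem ScSmooth.isScOperator_fibre
    (hg : ScSmooth (G.prod F) F' {z : G.lvl 0 × F.lvl 0 | z.1 ∈ U} g) (hx : x ∈ U)
    (hs : G.IsSmooth x) (hT : ∀ y, g (x, y) = T y) :
    IsScOperator F.filtration F'.filtration T := by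
  refine ScBanach.isScOperator_of_continuous fun m => ?_
  obtain ⟨gm, hc, hgm⟩ := hg 0 m
  obtain ⟨x', rfl⟩ := hs m
  have hin : ∀ a : F.lvl m, (G.prod F).incl m ((x', a) : G.lvl m × F.lvl m) =
      ((G.incl m x', F.incl m a) : G.lvl 0 × F.lvl 0) := fun a => ScBanach.prod_incl_eq rfl rfl
  have hmem : ∀ a : F.lvl m, (G.prod F).incl m ((x', a) : G.lvl m × F.lvl m) ∈
      {z : G.lvl 0 × F.lvl 0 | z.1 ∈ U} := fun a => by
    rw [hin]
    exact hx
  refine ⟨fun a => gm ((x', a) : G.lvl m × F.lvl m),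
    hc.comp_continuous (f := fun a : F.lvl m => ((x', a) : G.lvl m × F.lvl m))
      (continuous_const.prodMk continuous_id) hmem, fun a => ?_⟩
  have h := hgm _ (hmem a)
  rw [hin] at h
  exact h.trans (hT _)

/-- The derivative of `y ↦ g (p y, k y)` at a zero of `k`, for `g` linear in the second variable. -/
theorem ScSmooth.germ_fibre_comp (hU : IsScDomain G U)
    (hg : ScSmooth (G.prod F) F' {z : G.lvl 0 × F.lvl 0 | z.1 ∈ U} g)
    (h0 : ∀ y ∈ U, g (y, 0) = 0) {U' : Set (H.lvl 0)} {p : H.lvl 0 → G.lvl 0}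
    {k : H.lvl 0 → F.lvl 0} {y : H.lvl 0} {Dp : H.lvl 0 →L[ℝ] G.lvl 0} {Dk : H.lvl 0 →L[ℝ] F.lvl 0}
    (hp : ScGermAt H G U' p y Dp) (hk : ScGermAt H F U' k y Dk) (hpU : MapsTo p U' U)
    (hky : k y = 0) (hT : ∀ a, g (p y, a) = T a) :
    ∃ B : H.lvl 0 →L[ℝ] F'.lvl 0, ScGermAt H F' U' (fun a => g (p a, k a)) y B ∧
      ∀ δ, B δ = T (Dk δ) := by
  have hx : p y ∈ U := hpU hp.mem
  have hs := hp.smooth_map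
  have hF0 : F.IsSmooth 0 := fun _ => ⟨0, map_zero _⟩
  have hTsc := hg.isScOperator_fibre hx hs hT
  obtain ⟨T₀, hT₀⟩ := ScBanach.isScOperator_iff.1 hTsc 0
  have hT₀' : (T₀ : F.lvl 0 →ₗ[ℝ] F'.lvl 0) = T := LinearMap.ext hT₀
  obtain ⟨B, hB⟩ := hg.exists_germ (x := ((p y, 0) : G.lvl 0 × F.lvl 0)) hx
    (ScBanach.isSmooth_prod.2 ⟨hs, hF0⟩)
  have hV := hU.prod_univ (F := F)
  -- Along the zero section `g` vanishes identically, so the base directions contribute nothing;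
  -- along the fibre over `p y` it is the linear map `T`.
  have hB1 : ∀ δ : G.lvl 0, B ((δ, 0) : G.lvl 0 × F.lvl 0) = 0 := by
    have h1 : ScGermAt G (G.prod F) U (fun a => ((a, 0) : G.lvl 0 × F.lvl 0)) (p y)
        ((ContinuousLinearMap.id ℝ (G.lvl 0)).prod (0 : G.lvl 0 →L[ℝ] F.lvl 0)) :=
      (ScGermAt.id hx hs).prodMk (ScGermAt.const hF0 hx hs)
    have h2 := ScGermAt.comp (f := fun a => ((a, 0) : G.lvl 0 × F.lvl 0)) hB h1 hg.scC1On hV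
      fun a ha => ha
    have h3 := h2.unique hU ((ScGermAt.const (fun _ => ⟨0, map_zero _⟩) hx hs).congr h0)
    exact fun δ => DFunLike.congr_fun h3 δ
  have hB2 : ∀ η : F.lvl 0, B ((0, η) : G.lvl 0 × F.lvl 0) = T η := by
    have h1 : ScGermAt F (G.prod F) univ (fun a => ((p y, a) : G.lvl 0 × F.lvl 0)) 0
        ((0 : F.lvl 0 →L[ℝ] G.lvl 0).prod (ContinuousLinearMap.id ℝ (F.lvl 0))) :=
      (ScGermAt.const hs (mem_univ _) hF0).prodMk (ScGermAt.id (mem_univ _) hF0)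
    have h2 := ScGermAt.comp (f := fun a => ((p y, a) : G.lvl 0 × F.lvl 0)) hB h1 hg.scC1On hV
      (show MapsTo (fun a : F.lvl 0 => ((p y, a) : G.lvl 0 × F.lvl 0)) univ
        {z : G.lvl 0 × F.lvl 0 | z.1 ∈ U} from fun _ _ => hx)
    have h4 : ScGermAt F F' univ T₀ 0 T₀ :=
      ScGermAt.of_isScOperator (by rw [hT₀']; exact hTsc) (mem_univ _) hF0
    have h3 := h2.unique IsScDomain.univ (h4.congr fun a _ => (hT a).trans (hT₀ a).symm)
    exact fun η => (DFunLike.congr_fun h3 η).trans (hT₀ η)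
  have h1 := hp.prodMk hk
  have hB' : ScGermAt (G.prod F) F' {z : G.lvl 0 × F.lvl 0 | z.1 ∈ U} g
      ((p y, k y) : G.lvl 0 × F.lvl 0) B := by rwa [hky]
  refine ⟨_, ScGermAt.comp (f := fun a => ((p a, k a) : G.lvl 0 × F.lvl 0)) hB' h1 hg.scC1On hV
    hpU, fun δ => ?_⟩
  have e : ((Dp δ, Dk δ) : G.lvl 0 × F.lvl 0) = (Dp δ, 0) + (0, Dk δ) := by simp
  calc B ((Dp δ, Dk δ) : G.lvl 0 × F.lvl 0)
      = B (((Dp δ, 0) : G.lvl 0 × F.lvl 0) + ((0, Dk δ) : G.lvl 0 × F.lvl 0)) :=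
        congrArg B e
    _ = B ((Dp δ, 0) : G.lvl 0 × F.lvl 0) + B ((0, Dk δ) : G.lvl 0 × F.lvl 0) := map_add B _ _
    _ = T (Dk δ) := by rw [hB1, hB2, zero_add]

end FibreLinear

/-! ### Splicing cores and the derivative of the retraction -/

namespace Splicing

variable (S : Splicing.{u})

theorem isScDomain_V : IsScDomain S.amb {z : S.W.lvl 0 × S.E.lvl 0 | z.1 ∈ S.V} := by
  obtain ⟨N, hN, hV⟩ := S.isOpen_V
  have h := (S.isPartialQuadrant.isScDomain.inter_open hN).prod_univ (F := S.E)
  rwa [← hV] at h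

variable {S}

theorem retr_eq_of_mem_core {z : S.amb.lvl 0} (hz : z ∈ S.core) : S.retr z = z :=
  Prod.ext rfl hz.2

theorem retr_mem_core {z : S.amb.lvl 0} (hz : z.1 ∈ S.V) : S.retr z ∈ S.core :=
  ⟨hz, S.π_proj _ hz _⟩

variable (S) in
theorem scC1On_retr : ScC1On S.amb S.amb {z : S.W.lvl 0 × S.E.lvl 0 | z.1 ∈ S.V} S.retr :=
  (ScC1On.of_clm (E := S.amb) (ContinuousLinearMap.fst ℝ (S.W.lvl 0) (S.E.lvl 0))).prodMk
    S.π_smooth.scC1On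

variable (S) in
theorem continuousOn_retr : ContinuousOn S.retr {z : S.W.lvl 0 × S.E.lvl 0 | z.1 ∈ S.V} :=
  continuous_fst.continuousOn.prodMk S.π_smooth.continuousOn

/-- Sets `Ô` for `O` open in the core are open in the cylinder over the partial quadrant. -/
theorem exists_hat_eq {O : Set (S.amb.lvl 0)} (hO : ∃ G, IsOpen G ∧ O = S.core ∩ G) :
    ∃ G, IsOpen G ∧ S.hat O = {z : S.W.lvl 0 × S.E.lvl 0 | z.1 ∈ S.V} ∩ G := by
  obtain ⟨G, hG, rfl⟩ := hO
  obtain ⟨G', hG', h⟩ := continuousOn_iff'.1 S.continuousOn_retr G hG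
  refine ⟨G', hG', ?_⟩
  ext z
  have hz := Set.ext_iff.1 h z
  exact ⟨fun hm => ⟨hm.1, (hz.1 ⟨hm.2.2, hm.1⟩).1⟩,
    fun hm => ⟨hm.1, retr_mem_core hm.1, (hz.2 ⟨hm.2, hm.1⟩).1⟩⟩

theorem isScDomain_hat {O : Set (S.amb.lvl 0)} (hO : ∃ G, IsOpen G ∧ O = S.core ∩ G) :
    IsScDomain S.amb (S.hat O) := by
  obtain ⟨G, hG, h⟩ := exists_hat_eq hO
  rw [h]
  exact S.isScDomain_V.inter_open hG

/-- The derivative of the retraction `(v, e) ↦ (v, π_v e)` at a smooth point of the core. -/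
structure IsRetrDeriv (S : Splicing.{u}) (z : S.amb.lvl 0) (P : S.amb.lvl 0 →L[ℝ] S.amb.lvl 0) :
    Prop where
  germ : ScGermAt S.amb S.amb {z : S.W.lvl 0 × S.E.lvl 0 | z.1 ∈ S.V} S.retr z P
  fst : ∀ δ, (P δ).1 = δ.1
  idem : ∀ δ, P (P δ) = P δ
  vert : ∀ a : S.E.lvl 0, P ((0, a) : S.W.lvl 0 × S.E.lvl 0) =
    ((0, S.π z.1 a) : S.W.lvl 0 × S.E.lvl 0)
  mem_tangentSpace : ∀ δ, δ ∈ S.tangentSpace z ↔ P δ = δ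

/-- Idempotence is the chain rule for `r ∘ r = r` at the fixed point `z`. The formula on vertical
vectors comes from differentiating `a ↦ π_v(e + a) = e + π_v a` at `0`. -/
theorem exists_isRetrDeriv {z : S.amb.lvl 0} (hz : z ∈ S.core) (hs : S.amb.IsSmooth z) :
    ∃ P, S.IsRetrDeriv z P := by
  obtain ⟨d, hd⟩ := S.π_smooth.exists_germ (x := z) hz.1 hs
  have hfst : ScGermAt S.amb S.W {z : S.W.lvl 0 × S.E.lvl 0 | z.1 ∈ S.V} (fun z => z.1) z
      (ContinuousLinearMap.fst ℝ (S.W.lvl 0) (S.E.lvl 0)) :=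
    ScGermAt.of_isScOperator (E := S.amb)
      (D := ContinuousLinearMap.fst ℝ (S.W.lvl 0) (S.E.lvl 0))
      (ScBanach.isScOperator_fst S.W S.E) hz.1 hs
  have hP : ScGermAt S.amb S.amb {z : S.W.lvl 0 × S.E.lvl 0 | z.1 ∈ S.V} S.retr z
      ((ContinuousLinearMap.fst ℝ (S.W.lvl 0) (S.E.lvl 0)).prod d) := hfst.prodMk hd
  set P : S.amb.lvl 0 →L[ℝ] S.amb.lvl 0 :=
    (ContinuousLinearMap.fst ℝ (S.W.lvl 0) (S.E.lvl 0)).prod d with hPdef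
  have hPδ : ∀ δ : S.amb.lvl 0, P δ = ((δ.1, d δ) : S.W.lvl 0 × S.E.lvl 0) := fun δ => rfl
  have hmaps : MapsTo S.retr {z : S.W.lvl 0 × S.E.lvl 0 | z.1 ∈ S.V}
      {z : S.W.lvl 0 × S.E.lvl 0 | z.1 ∈ S.V} := fun x hx => hx
  refine ⟨P, hP, fun δ => rfl, ?_, ?_, ?_⟩
  · have h1 : ScGermAt S.amb S.amb {z : S.W.lvl 0 × S.E.lvl 0 | z.1 ∈ S.V} S.retr (S.retr z) P := by
      rwa [retr_eq_of_mem_core hz]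
    have h2 := h1.comp hP S.scC1On_retr S.isScDomain_V hmaps
    have h3 := h2.congr (g := S.retr) fun y hy => (retr_eq_of_mem_core (retr_mem_core hy)).symm
    have h4 := h3.unique S.isScDomain_V hP
    exact fun δ => DFunLike.congr_fun h4 δ
  · obtain ⟨hs1, hs2⟩ := ScBanach.isSmooth_prod.1 hs
    have hE0 : S.E.IsSmooth 0 := fun _ => ⟨0, map_zero _⟩
    have h1 : ScGermAt S.E S.amb univ (fun a => ((z.1, z.2 + a) : S.W.lvl 0 × S.E.lvl 0)) 0
        ((0 : S.E.lvl 0 →L[ℝ] S.W.lvl 0).prod (0 + ContinuousLinearMap.id ℝ (S.E.lvl 0))) :=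
      (ScGermAt.const hs1 (mem_univ _) hE0).prodMk
        ((ScGermAt.const hs2 (mem_univ _) hE0).add (ScGermAt.id (mem_univ _) hE0))
    have h2 : ScGermAt S.amb S.E {z : S.W.lvl 0 × S.E.lvl 0 | z.1 ∈ S.V}
        (fun z : S.W.lvl 0 × S.E.lvl 0 => S.π z.1 z.2)
        ((z.1, z.2 + 0) : S.W.lvl 0 × S.E.lvl 0) d := by
      rw [add_zero]
      exact hd
    have h3 := ScGermAt.comp (f := fun a => ((z.1, z.2 + a) : S.W.lvl 0 × S.E.lvl 0)) h2 h1
      S.π_smooth.scC1On S.isScDomain_V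
      (show MapsTo (fun a => ((z.1, z.2 + a) : S.W.lvl 0 × S.E.lvl 0)) univ
        {z : S.W.lvl 0 × S.E.lvl 0 | z.1 ∈ S.V} from fun _ _ => hz.1)
    have h4 : ScGermAt S.E S.E univ (fun a => z.2 + S.π z.1 a) 0 (0 + S.π z.1) :=
      (ScGermAt.const hs2 (mem_univ _) hE0).add
        (ScGermAt.of_isScOperator (S.π_smooth.isScOperator_fibre hz.1 hs1 fun _ => rfl) (mem_univ _) hE0)
    have h5 := h3.unique IsScDomain.univ (h4.congr fun a _ => by
      change S.π z.1 (z.2 + a) = z.2 + S.π z.1 a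
      rw [map_add, hz.2])
    intro a
    rw [zero_add, zero_add] at h5
    exact (hPδ _).trans (Prod.ext rfl (DFunLike.congr_fun h5 a))
  · intro δ
    have h1 : scDeriv S.amb S.E {x : S.W.lvl 0 × S.E.lvl 0 | x.1 ∈ S.V}
      (fun x : S.W.lvl 0 × S.E.lvl 0 => S.π x.1 x.2) z = d := hd.scDeriv_eq S.isScDomain_V
    unfold tangentSpace
    rw [h1, hPδ]
    constructor
    · intro h
      exact Prod.ext rfl h
    · intro h
      exact congrArg Prod.snd h

end Splicing

/-! ### Operators into and out of initial filtrations -/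

section Initial

variable {E : Type*} [AddCommGroup E] [Module ℝ E] {E' : Type*} [AddCommGroup E'] [Module ℝ E']
  {ι : Type*} {G : ι → ScBanach.{u}} {ev : ∀ i, E →ₗ[ℝ] (G i).lvl 0}

theorem isScOperator_initial_ev (i : ι) :
    IsScOperator (ScFiltration.initial G ev) (G i).filtration (ev i) := fun _ =>
  ⟨fun x => ⟨ev i x.1, (Submodule.mem_iInf _).1 x.2 i⟩,
    continuous_iInf_dom (i := i) continuous_induced_dom, fun _ => rfl⟩

theorem IsScOperator.to_initial {A : ScFiltration E'} {p : E' →ₗ[ℝ] E}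
    (h : ∀ i, IsScOperator A (G i).filtration (ev i ∘ₗ p)) :
    IsScOperator A (ScFiltration.initial G ev) p := by
  intro m
  refine ⟨fun x => ⟨p x, (Submodule.mem_iInf _).2 fun i => (h i).mem_level x.2⟩, ?_, fun _ => rfl⟩
  refine continuous_iInf_rng.2 fun i => continuous_induced_rng.2 ?_
  obtain ⟨Tm, hc, hT⟩ := h i m
  convert hc using 1
  ext x
  exact (hT x).symm

end Initial

/-! ### Transition maps and tangent spaces -/

/-- The map `f ∘ r` is unchanged by a further precomposition with `r`. -/
theorem Splicing.IsRetrDeriv.comp_eq {S : Splicing.{u}} {F : ScBanach.{u}} {z : S.amb.lvl 0}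
    {P : S.amb.lvl 0 →L[ℝ] S.amb.lvl 0} (hP : S.IsRetrDeriv z P) (hz : z ∈ S.core)
    {O : Set (S.amb.lvl 0)} (hU : IsScDomain S.amb (S.hat O)) {f : S.amb.lvl 0 → F.lvl 0}
    {D : S.amb.lvl 0 →L[ℝ] F.lvl 0}
    (hf : ScGermAt S.amb F (S.hat O) (fun x => f (S.retr x)) z D)
    (hC : ScC1On S.amb F (S.hat O) (fun x => f (S.retr x))) (δ : S.amb.lvl 0) :
    D (P δ) = D δ := by
  have hrr : ∀ x ∈ S.hat O, S.retr (S.retr x) = S.retr x := fun x hx =>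
    Splicing.retr_eq_of_mem_core (Splicing.retr_mem_core hx.1)
  have h0 : S.retr z = z := Splicing.retr_eq_of_mem_core hz
  have h1 : ScGermAt S.amb F (S.hat O) (fun x => f (S.retr x)) (S.retr z) D := by rwa [h0]
  have h2 : ScGermAt S.amb S.amb (S.hat O) S.retr z P :=
    hP.germ.mono (fun x hx => hx.1) hf.mem
  have h3 := h1.comp h2 hC hU fun x hx => ⟨hx.1, by rw [hrr x hx]; exact hx.2⟩
  have h4 := h3.congr (g := fun x => f (S.retr x)) fun x hx => by rw [hrr x hx]
  exact DFunLike.congr_fun (h4.unique hU hf) δ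

namespace MPolyfoldChart

variable {X : Type v} [TopologicalSpace X] (c : MPolyfoldChart.{u} X)

/-- The part of `Ô` lying over the subset `N` of `X`. -/
def dom (N : Set X) : Set (c.S.amb.lvl 0) := c.S.hat (c.φ '' (c.φ.source ∩ N))

variable {c} {N : Set X} {q : X}

theorem mem_dom {z : c.S.amb.lvl 0} : z ∈ c.dom N ↔
    z.1 ∈ c.S.V ∧ c.S.retr z ∈ c.φ.target ∧ c.φ.symm (c.S.retr z) ∈ N := by
  refine and_congr Iff.rfl ?_
  rw [PartialEquiv.image_source_inter_eq']
  exact Iff.rfl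

theorem exists_image_eq (hN : IsOpen N) :
    ∃ G, IsOpen G ∧ c.φ '' (c.φ.source ∩ N) = c.S.core ∩ G := by
  obtain ⟨G, hG, hGt⟩ := c.open_target
  obtain ⟨G', hG', h⟩ := continuousOn_iff'.1 c.continuousOn_symm N hN
  refine ⟨G ∩ G', hG.inter hG', ?_⟩
  rw [PartialEquiv.image_source_inter_eq', inter_comm, h, hGt, inter_comm, inter_assoc]

theorem isScDomain_dom (hN : IsOpen N) : IsScDomain c.S.amb (c.dom N) :=
  Splicing.isScDomain_hat (exists_image_eq hN)

theorem hat_target : c.S.hat c.φ.target = c.dom univ := by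
  unfold dom
  rw [inter_univ, PartialEquiv.image_source_eq_target]

theorem φ_mem_core (hq : q ∈ c.φ.source) : c.φ q ∈ c.S.core := by
  obtain ⟨G, -, hG⟩ := c.open_target
  have := c.φ.map_source hq
  rw [hG] at this
  exact this.1

theorem retr_φ (hq : q ∈ c.φ.source) : c.S.retr (c.φ q) = c.φ q :=
  Splicing.retr_eq_of_mem_core (φ_mem_core hq)

theorem φ_mem_dom (hq : q ∈ c.φ.source) (hN : q ∈ N) : c.φ q ∈ c.dom N := by
  rw [mem_dom, retr_φ hq, c.φ.left_inv hq]
  exact ⟨(φ_mem_core hq).1, c.φ.map_source hq, hN⟩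

theorem exists_dom_local (hN : IsOpen N) (hq : q ∈ c.φ.source) (hqN : q ∈ N) :
    ∃ G, IsOpen G ∧ c.φ q ∈ G ∧ ∀ N', c.dom N' ∩ G ⊆ c.dom (N ∩ N') := by
  obtain ⟨G, hG, h⟩ := Splicing.exists_hat_eq (exists_image_eq (c := c) hN)
  have h' : c.dom N = {z : c.S.W.lvl 0 × c.S.E.lvl 0 | z.1 ∈ c.S.V} ∩ G := h
  have hm := φ_mem_dom hq hqN
  rw [h'] at hm
  refine ⟨G, hG, hm.2, fun N' z hz => ?_⟩
  have h1 : z ∈ c.dom N := by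
    rw [h']
    exact ⟨hz.1.1, hz.2⟩
  have h2 := mem_dom.1 h1
  exact mem_dom.2 ⟨h2.1, h2.2.1, h2.2.2, (mem_dom.1 hz.1).2.2⟩

variable {a d e : MPolyfoldChart.{u} X}

theorem transition_φ (hq : q ∈ c.φ.source) : c.transition d (c.S.retr (c.φ q)) = d.φ q := by
  rw [retr_φ hq]
  unfold transition
  rw [c.φ.left_inv hq]

theorem transition_retr_mem {z : c.S.amb.lvl 0} (hz : z ∈ c.dom (d.φ.source ∩ N)) :
    c.transition d (c.S.retr z) ∈ d.dom N :=
  φ_mem_dom (mem_dom.1 hz).2.2.1 (mem_dom.1 hz).2.2.2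

theorem transition_transition {z : c.S.amb.lvl 0} (hz : z ∈ c.dom d.φ.source) :
    d.transition e (d.S.retr (c.transition d (c.S.retr z))) = c.transition e (c.S.retr z) := by
  have h := (mem_dom.1 hz).2.2
  unfold transition
  rw [retr_φ h, d.φ.left_inv h]

/-- The tangent map of a transition map. -/
noncomputable def tangentTransition (c c' : MPolyfoldChart.{u} X) (q : X) :
    c.S.amb.lvl 0 →L[ℝ] c'.S.amb.lvl 0 :=
  c.S.tangentMap (c.overlap c') c'.S.amb (c.transition c') (c.φ q)

theorem germ_tangentTransition (h : c.S.SmoothOn (c.overlap d) d.S.amb (c.transition d))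
    (hqc : q ∈ c.φ.source) (hqd : q ∈ d.φ.source) (hs : c.S.amb.IsSmooth (c.φ q)) :
    ScGermAt c.S.amb d.S.amb (c.dom d.φ.source) (fun z => c.transition d (c.S.retr z)) (c.φ q)
      (c.tangentTransition d q) := by
  obtain ⟨α, hα⟩ := ScSmooth.exists_germ h (φ_mem_dom hqc hqd) hs
  have : c.tangentTransition d q = α := hα.scDeriv_eq (isScDomain_dom d.open_source)
  rwa [this]

/-- The chain rule applies only over the triple overlap, whereas the transition from `c` to `e` is
defined on a possibly larger set; locality of the sc-derivative bridges the difference. -/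
theorem tangentTransition_eq_comp (h : c.S.SmoothOn (c.overlap d) d.S.amb (c.transition d))
    (h' : d.S.SmoothOn (d.overlap e) e.S.amb (d.transition e)) (hqc : q ∈ c.φ.source)
    (hqd : q ∈ d.φ.source) (hqe : q ∈ e.φ.source) (hs : c.S.amb.IsSmooth (c.φ q)) :
    c.tangentTransition e q = (d.tangentTransition e q).comp (c.tangentTransition d q) := by
  have h1 := germ_tangentTransition h hqc hqd hs
  have hsd := h1.smooth_map
  rw [transition_φ hqc] at hsd
  have h2 := germ_tangentTransition h' hqd hqe hsd
  have h1' : ScGermAt c.S.amb d.S.amb (c.dom (d.φ.source ∩ e.φ.source))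
      (fun z => c.transition d (c.S.retr z)) (c.φ q) (c.tangentTransition d q) :=
    h1.mono (fun z hz => mem_dom.2 ⟨hz.1, (mem_dom.1 hz).2.1, (mem_dom.1 hz).2.2.1⟩)
      (φ_mem_dom hqc ⟨hqd, hqe⟩)
  have h2' : ScGermAt d.S.amb e.S.amb (d.dom e.φ.source)
      (fun z => d.transition e (d.S.retr z)) (c.transition d (c.S.retr (c.φ q)))
      (d.tangentTransition e q) := by rwa [transition_φ hqc]
  have h3 := ScGermAt.comp (f := fun z => c.transition d (c.S.retr z)) h2' h1' h'.scC1On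
    (isScDomain_dom e.open_source) fun z hz => transition_retr_mem hz
  obtain ⟨G, hG, hqG, hl⟩ := exists_dom_local d.open_source hqc hqd
  exact h3.scDeriv_eq_of_local (isScDomain_dom e.open_source) (φ_mem_dom hqc hqe) hG hqG (hl _)
    fun y hy => (transition_transition (mem_dom.2 ⟨hy.1.1, (mem_dom.1 hy.1).2.1,
      (mem_dom.1 (hl _ hy)).2.2.1⟩)).symm

/-- The transition of a chart to itself is the identity on the core, so precomposed with the
retraction it is the retraction. Its tangent is `P`, not the identity of `W ⊕ E`. -/
theorem isRetrDeriv_tangentTransition (hqc : q ∈ c.φ.source) (hs : c.S.amb.IsSmooth (c.φ q)) :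
    c.S.IsRetrDeriv (c.φ q) (c.tangentTransition c q) := by
  obtain ⟨P, hP⟩ := Splicing.exists_isRetrDeriv (φ_mem_core hqc) hs
  have : c.tangentTransition c q = P :=
    hP.germ.scDeriv_eq_of_local (isScDomain_dom c.open_source) (φ_mem_dom hqc hqc) isOpen_univ
      (mem_univ _) (fun z hz => hz.1.1) fun z hz => c.φ.right_inv (mem_dom.1 hz.1).2.1
  rwa [this]

end MPolyfoldChart

namespace MPolyfold

open MPolyfoldChart

variable {X : Type v} [TopologicalSpace X] {M : MPolyfold.{u} X} {q : X}

/-- Charts of the maximal atlas are compatible by definition only with charts of the atlas, so the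
transition is factored through such a chart `a`. -/
theorem isScOperator_tangentTransition (hq : M.IsSmoothPoint q) (c c' : M.ChartAt q) :
    IsScOperator c.1.S.amb.filtration c'.1.S.amb.filtration
      (c.1.tangentTransition c'.1 q : c.1.S.amb.lvl 0 →ₗ[ℝ] c'.1.S.amb.lvl 0) := by
  obtain ⟨a, ha, hqa⟩ := M.cover q
  have hc := c.2.1 a ha
  have hc' := c'.2.1 a ha
  rw [tangentTransition_eq_comp hc.1 hc'.2 c.2.2 hqa c'.2.2 (hq c)]
  exact (germ_tangentTransition hc'.2 hqa c'.2.2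
    (hq ⟨a, fun _ hb => M.compatible a ha _ hb, hqa⟩)).op.comp
    (germ_tangentTransition hc.1 c.2.2 hqa (hq c)).op

theorem tangentTransition_comp (hq : M.IsSmoothPoint q) (c c' c'' : M.ChartAt q)
    (δ : c.1.S.amb.lvl 0) :
    c'.1.tangentTransition c''.1 q (c.1.tangentTransition c'.1 q δ) =
      c.1.tangentTransition c''.1 q δ := by
  obtain ⟨a, ha, hqa⟩ := M.cover q
  have hc := c.2.1 a ha
  have hc' := c'.2.1 a ha
  have hc'' := c''.2.1 a ha
  have hsa : a.S.amb.IsSmooth (a.φ q) := hq ⟨a, fun _ hb => M.compatible a ha _ hb, hqa⟩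
  rw [tangentTransition_eq_comp hc.1 hc''.2 c.2.2 hqa c''.2.2 (hq c),
    tangentTransition_eq_comp hc.1 hc'.2 c.2.2 hqa c'.2.2 (hq c),
    tangentTransition_eq_comp hc'.1 hc''.2 c'.2.2 hqa c''.2.2 (hq c')]
  -- Passing through `c'` inserts the self-transition of `a`, which is a projection rather than the
  -- identity; `h2` absorbs it into the preceding transition.
  have h1 : a.tangentTransition a q = _ :=
    tangentTransition_eq_comp hc'.2 hc'.1 hqa c'.2.2 hqa hsa
  have h2 : c.1.tangentTransition a q = _ :=
    tangentTransition_eq_comp hc.1 (M.compatible a ha a ha).1 c.2.2 hqa hqa (hq c)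
  have h3 := DFunLike.congr_fun h1 (c.1.tangentTransition a q δ)
  have h4 := DFunLike.congr_fun h2 δ
  exact congrArg (a.tangentTransition c''.1 q) (h3.symm.trans h4.symm)

/-- The tangent vector represented in the chart `c` by the projection of `δ` to the tangent
space. -/
noncomputable def tangentMk (hq : M.IsSmoothPoint q) (c : M.ChartAt q) :
    c.1.S.amb.lvl 0 →ₗ[ℝ] M.TangentSpace q :=
  (LinearMap.pi fun c' : M.ChartAt q =>
    (c.1.tangentTransition c'.1 q : c.1.S.amb.lvl 0 →ₗ[ℝ] c'.1.S.amb.lvl 0)).codRestrict _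
    fun δ => ⟨fun c' => ((isRetrDeriv_tangentTransition c'.2.2 (hq c')).mem_tangentSpace _).2
      (tangentTransition_comp hq c c' c' δ), fun c' c'' => tangentTransition_comp hq c c' c'' δ⟩

theorem tangentTransition_tangentCoord (c c' : M.ChartAt q) (h : M.TangentSpace q) :
    c.1.tangentTransition c'.1 q (M.tangentCoord q c h) = M.tangentCoord q c' h :=
  h.2.2 c c'

theorem tangentMk_tangentCoord (hq : M.IsSmoothPoint q) (c : M.ChartAt q)
    (h : M.TangentSpace q) : tangentMk hq c (M.tangentCoord q c h) = h :=
  Subtype.ext (funext fun c' => h.2.2 c c')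

theorem isScOperator_tangentMk (hq : M.IsSmoothPoint q) (c : M.ChartAt q) :
    IsScOperator c.1.S.amb.filtration (M.tangentFiltration q) (tangentMk hq c) :=
  IsScOperator.to_initial fun c' => isScOperator_tangentTransition hq c c'

theorem isScOperator_tangentCoord (c : M.ChartAt q) :
    IsScOperator (M.tangentFiltration q) c.1.S.amb.filtration (M.tangentCoord q c) :=
  isScOperator_initial_ev c

end MPolyfold

/-! ### Fillers and sections in charts -/

theorem ScPlusSmooth.scC1On {E F : ScBanach.{u}} {U : Set (E.lvl 0)} {f : E.lvl 0 → F.lvl 0}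
    (h : ScPlusSmooth E F U f) : ScC1On E F U f := by
  obtain ⟨f₁, hf₁, hsm⟩ := h
  obtain ⟨D, hD, hDc⟩ := hsm.scC1On
  refine ⟨fun x => (F.incl 1).comp (D x), fun x hx => ?_,
    (F.incl 1).continuous.comp_continuousOn hDc⟩
  exact HasFDerivWithinAt.congr ((F.incl 1).hasFDerivAt.comp_hasFDerivWithinAt x (hD x hx))
    (fun y hy => (hf₁ _ hy).symm) (hf₁ _ hx).symm

namespace Filler

variable {S : Splicing.{u}} {O : Set (S.amb.lvl 0)} {R : StrongBundleSplicing S O} (fc : Filler R)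
  {z : S.amb.lvl 0} {P : S.amb.lvl 0 →L[ℝ] S.amb.lvl 0}

/-- `δ - P δ` is vertical and killed by `P`, which acts on vertical vectors as `π_v`. -/
theorem π_sub_eq_zero (hP : S.IsRetrDeriv z P) (δ : S.amb.lvl 0) :
    S.π z.1 (δ.2 - (P δ).2) = 0 := by
  have h1 : δ - P δ = ((0, δ.2 - (P δ).2) : S.W.lvl 0 × S.E.lvl 0) :=
    Prod.ext ((congrArg (fun w => δ.1 - w) (hP.fst δ)).trans (sub_self _)) rfl
  have h2 : P (δ - P δ) = 0 := by rw [map_sub, hP.idem, sub_self]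
  exact congrArg Prod.snd ((hP.vert _).symm.trans ((congrArg P h1).symm.trans h2))

/-- The fibre argument `e - π_v e` vanishes at `z`, so only its own derivative contributes, and
varying the base point of the filler does not. -/
theorem exists_germ_principal (hU : IsScDomain S.amb (S.hat O)) (hzc : z ∈ S.core) (hz : z ∈ O)
    (hs : S.amb.IsSmooth z) (hP : S.IsRetrDeriv z P) :
    ∃ Φ : S.amb.lvl 0 →L[ℝ] R.F.lvl 0, ScGermAt S.amb R.F (S.hat O) fc.principal z Φ ∧
      ∀ δ, Φ δ = fc.toFun z (δ.2 - (P δ).2) := by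
  have hrz := Splicing.retr_eq_of_mem_core hzc
  have hzO : z ∈ S.hat O := ⟨hzc.1, by rwa [hrz]⟩
  have hk1 : ScGermAt S.amb S.amb (S.hat O) (fun x => x - S.retr x) z
      (ContinuousLinearMap.id ℝ _ - P) :=
    (ScGermAt.id hzO hs).sub (hP.germ.mono (fun x hx => hx.1) hzO)
  have hsnd : ScGermAt S.amb S.E univ (ContinuousLinearMap.snd ℝ (S.W.lvl 0) (S.E.lvl 0))
      (z - S.retr z) (ContinuousLinearMap.snd ℝ (S.W.lvl 0) (S.E.lvl 0)) :=
    ScGermAt.of_isScOperator (E := S.amb)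
      (D := ContinuousLinearMap.snd ℝ (S.W.lvl 0) (S.E.lvl 0))
      (ScBanach.isScOperator_snd S.W S.E) (mem_univ _) hk1.smooth_map
  have hk := ScGermAt.comp (f := fun x => x - S.retr x) hsnd hk1
    (ScC1On.of_clm (E := S.amb) (ContinuousLinearMap.snd ℝ (S.W.lvl 0) (S.E.lvl 0)))
    (IsScDomain.univ (E := S.amb)) (mapsTo_univ _ _)
  obtain ⟨Φ, hΦ, hΦT⟩ := ScSmooth.germ_fibre_comp (p := fun x => x)
    (T := fc.toFun z ∘ₗ (LinearMap.id - (S.π z.1 : S.E.lvl 0 →ₗ[ℝ] S.E.lvl 0)))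
    hU fc.smooth_toFun (fun y _ => by simp) (ScGermAt.id hzO hs) hk (fun x hx => hx)
    (congrArg (fun w : S.amb.lvl 0 => w.2) (show z - S.retr z = 0 by rw [hrz, sub_self]))
    fun b => by
      change fc.toFun (S.retr z) (b - S.π z.1 b) = fc.toFun z (b - S.π z.1 b)
      rw [hrz]
  -- The smooth extension of the filler projects by `1 - π_v` once more; this changes neither the
  -- map nor its derivative, since both arguments already lie in `ker π_v`.
  refine ⟨Φ, hΦ.congr fun x hx => ?_, fun δ => (hΦT δ).trans ?_⟩
  · change fc.toFun (S.retr x) (x.2 - S.π x.1 x.2) =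
      fc.toFun (S.retr x) ((x.2 - S.π x.1 x.2) - S.π x.1 (x.2 - S.π x.1 x.2))
    rw [map_sub (S.π x.1), S.π_proj _ hx.1, sub_self, sub_zero]
  · change fc.toFun z ((δ.2 - (P δ).2) - S.π z.1 (δ.2 - (P δ).2)) = _
    rw [π_sub_eq_zero hP, sub_zero]

end Filler

/-! ### Derivatives of sections in strong bundle charts -/

namespace StrongBundleChart

open MPolyfoldChart

variable {X : Type v} [TopologicalSpace X] {Y : X → Type w}
  [∀ x, AddCommGroup (Y x)] [∀ x, Module ℝ (Y x)] [TopologicalSpace (Bundle.TotalSpace Unit Y)]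
  {c d : StrongBundleChart.{u} X Y} {N : Set X} {q : X}

theorem isScDomain_hat_target (c : StrongBundleChart.{u} X Y) :
    IsScDomain c.base.S.amb (c.base.S.hat c.base.φ.target) := by
  rw [hat_target]
  exact isScDomain_dom isOpen_univ

theorem dom_subset_hat_target : c.base.dom N ⊆ c.base.S.hat c.base.φ.target :=
  fun _ hz => ⟨hz.1, (mem_dom.1 hz).2.1⟩

theorem φ_mem_hat_target (hqc : q ∈ c.base.φ.source) :
    c.base.φ q ∈ c.base.S.hat c.base.φ.target :=
  dom_subset_hat_target (φ_mem_dom hqc (mem_univ q))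

theorem localRep_retr_φ (g : ∀ x, Y x) (hqc : q ∈ c.base.φ.source) :
    c.localRep g (c.base.S.retr (c.base.φ q)) = c.fib q (g q) := by
  rw [retr_φ hqc]
  exact congrArg (fun x => c.fib x (g x)) (c.base.φ.left_inv hqc)

theorem isScOperator_fib_fibInv (h : c.SmoothTransition d) (hqc : q ∈ c.base.φ.source)
    (hqd : q ∈ d.base.φ.source) (hs : c.base.S.amb.IsSmooth (c.base.φ q)) :
    IsScOperator c.R.F.filtration d.R.F.filtration (d.fib q ∘ₗ c.fibInv q) :=
  h.2.1.isScOperator_fibre (φ_mem_dom hqc hqd) hs fun y => by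
    change d.fib (c.base.φ.symm (c.base.S.retr (c.base.φ q)))
      (c.fibInv (c.base.φ.symm (c.base.S.retr (c.base.φ q))) y) = d.fib q (c.fibInv q y)
    rw [retr_φ hqc, c.base.φ.left_inv hqc]

variable {g : ∀ x, Y x} {A : c.base.S.amb.lvl 0 →L[ℝ] c.R.F.lvl 0}

/-- `A` is the derivative at a point over `q` of the local representation of the section `g`, which
is defined on `N`. -/
structure IsSectionDeriv (c : StrongBundleChart.{u} X Y) (N : Set X) (g : ∀ x, Y x) (q : X)
    (A : c.base.S.amb.lvl 0 →L[ℝ] c.R.F.lvl 0) : Prop where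
  germ : ScGermAt c.base.S.amb c.R.F (c.base.dom N) (fun z => c.localRep g (c.base.S.retr z))
    (c.base.φ q) A
  scC1On : ScC1On c.base.S.amb c.R.F (c.base.dom N) (fun z => c.localRep g (c.base.S.retr z))

/-- Differentiate the identity `ρ g = g` satisfied by the local representative; at a zero of `g` the
derivative of `ρ` drops out. -/
theorem IsSectionDeriv.ρ_apply (hA : c.IsSectionDeriv N g q A) (hN : IsOpen N)
    (hqc : q ∈ c.base.φ.source) (hg : g q = 0) (δ : c.base.S.amb.lvl 0) :
    c.R.ρ (c.base.φ q) (A δ) = A δ := by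
  obtain ⟨B, hB, hBT⟩ := ScSmooth.germ_fibre_comp (p := fun x => x)
    (T := (c.R.ρ (c.base.φ q) : c.R.F.lvl 0 →ₗ[ℝ] c.R.F.lvl 0)) c.isScDomain_hat_target
    c.R.ρ_smooth.1 (fun y _ => map_zero _) (ScGermAt.id hA.germ.mem hA.germ.smooth) hA.germ
    (fun x hx => dom_subset_hat_target hx) (by rw [localRep_retr_φ g hqc, hg, map_zero]) fun b => by
      change c.R.ρ (c.base.S.retr (c.base.φ q)) b = c.R.ρ (c.base.φ q) b
      rw [retr_φ hqc]
  have h1 := hB.congr (g := fun z => c.localRep g (c.base.S.retr z)) fun z hz => by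
    have hz' := mem_dom.1 hz
    have hx := c.base.φ.map_target hz'.2.1
    have h2 := c.fib_fibInv _ hx (c.localRep g (c.base.S.retr z))
    rw [c.base.φ.right_inv hz'.2.1] at h2
    refine Eq.trans ?_ h2
    unfold localRep
    rw [c.fibInv_fib _ hx]
  have h2 := h1.unique (isScDomain_dom hN) hA.germ
  exact (hBT δ).symm.trans (DFunLike.congr_fun h2 δ)

/-- Change of charts for the derivatives of a section at a zero. -/
theorem IsSectionDeriv.change (hA : c.IsSectionDeriv N g q A)
    {A' : d.base.S.amb.lvl 0 →L[ℝ] d.R.F.lvl 0} (hA' : d.IsSectionDeriv N g q A')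
    (h : c.SmoothTransition d) (hN : IsOpen N) (hqN : q ∈ N) (hqc : q ∈ c.base.φ.source)
    (hqd : q ∈ d.base.φ.source) (hg : g q = 0) (δ : c.base.S.amb.lvl 0) :
    A' (c.base.tangentTransition d.base q δ) = d.fib q (c.fibInv q (A δ)) := by
  have hq := φ_mem_dom (c := c.base) hqc (N := d.base.φ.source ∩ N) ⟨hqd, hqN⟩
  have hU : c.base.dom (d.base.φ.source ∩ N) ⊆ c.base.dom N := fun z hz =>
    mem_dom.2 ⟨hz.1, (mem_dom.1 hz).2.1, (mem_dom.1 hz).2.2.2⟩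
  have hU' : c.base.dom (d.base.φ.source ∩ N) ⊆ c.base.dom d.base.φ.source := fun z hz =>
    mem_dom.2 ⟨hz.1, (mem_dom.1 hz).2.1, (mem_dom.1 hz).2.2.1⟩
  obtain ⟨B, hB, hBT⟩ := ScSmooth.germ_fibre_comp (p := fun x => x)
    (T := d.fib q ∘ₗ c.fibInv q) (isScDomain_dom (c := c.base) d.base.open_source)
    h.2.1 (fun y _ => by rw [map_zero, map_zero]) (ScGermAt.id hq hA.germ.smooth)
    (hA.germ.mono hU hq) (fun x hx => hU' hx) (by rw [localRep_retr_φ g hqc, hg, map_zero])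
    fun b => by
      change d.fib (c.base.φ.symm (c.base.S.retr (c.base.φ q)))
        (c.fibInv (c.base.φ.symm (c.base.S.retr (c.base.φ q))) b) = d.fib q (c.fibInv q b)
      rw [retr_φ hqc, c.base.φ.left_inv hqc]
  have h1 : ScGermAt c.base.S.amb d.base.S.amb (c.base.dom (d.base.φ.source ∩ N))
      (fun z => c.base.transition d.base (c.base.S.retr z)) (c.base.φ q)
      (c.base.tangentTransition d.base q) :=
    (germ_tangentTransition h.1 hqc hqd hA.germ.smooth).mono hU' hq
  have h2 : ScGermAt d.base.S.amb d.R.F (d.base.dom N)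
      (fun z => d.localRep g (d.base.S.retr z))
      (c.base.transition d.base (c.base.S.retr (c.base.φ q))) A' := by
    rw [transition_φ hqc]
    exact hA'.germ
  have h3 := ScGermAt.comp (f := fun z => c.base.transition d.base (c.base.S.retr z)) h2 h1
    hA'.scC1On (isScDomain_dom hN) fun z hz => transition_retr_mem hz
  have h4 := hB.congr (g := fun z =>
      d.localRep g (d.base.S.retr (c.base.transition d.base (c.base.S.retr z)))) fun z hz => by
    have hz' := mem_dom.1 hz
    unfold localRep
    rw [c.fibInv_fib _ (c.base.φ.map_target hz'.2.1)]
    refine congrArg (fun x => d.fib x (g x)) ?_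
    unfold transition
    rw [retr_φ hz'.2.2.1, d.base.φ.left_inv hz'.2.2.1]
  have h5 := h3.unique (isScDomain_dom (d.base.open_source.inter hN)) h4
  exact (DFunLike.congr_fun h5 δ).trans (hBT δ)

end StrongBundleChart

/-! ### The linearization as a diagonal block -/

namespace StrongBundle

open MPolyfoldChart

variable {X : Type v} [TopologicalSpace X] {M : MPolyfold.{u} X} {Y : X → Type w}
  [∀ x, AddCommGroup (Y x)] [∀ x, Module ℝ (Y x)] [TopologicalSpace (Bundle.TotalSpace Unit Y)]
  {B : StrongBundle M Y} {q : X}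

theorem someChart_mem (B : StrongBundle M Y) (q : X) : (B.someChart q).1 ∈ B.atlas :=
  (B.cover q).choose_spec.1

theorem isScOperator_fib (c : B.ChartAt q) :
    IsScOperator (B.fiberFiltration q) c.1.R.F.filtration (c.1.fib q) :=
  isScOperator_initial_ev (G := fun c : B.ChartAt q => c.1.R.F)
    (ev := fun c : B.ChartAt q => c.1.fib q) c

/-- The fibre filtration tests against all charts around `q`; two of them are compared through a
chart of the bundle atlas, with which both are compatible. -/
theorem isScOperator_fibInv (hq : M.IsSmoothPoint q) (c : B.ChartAt q) :
    IsScOperator c.1.R.F.filtration (B.fiberFiltration q) (c.1.fibInv q) := by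
  refine IsScOperator.to_initial (G := fun c : B.ChartAt q => c.1.R.F)
    (ev := fun c : B.ChartAt q => c.1.fib q) fun c' => ?_
  have h1 := StrongBundleChart.isScOperator_fib_fibInv
    (c.2.1.2 _ (B.someChart_mem q)).1 c.2.2 (B.someChart q).2.2 (hq c.toBase)
  have h2 := StrongBundleChart.isScOperator_fib_fibInv
    (c'.2.1.2 _ (B.someChart_mem q)).2 (B.someChart q).2.2 c'.2.2 (hq (B.someChart q).toBase)
  have e : c'.1.fib q ∘ₗ c.1.fibInv q = (c'.1.fib q ∘ₗ (B.someChart q).1.fibInv q) ∘ₗ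
      ((B.someChart q).1.fib q ∘ₗ c.1.fibInv q) := by
    ext y
    exact congrArg (c'.1.fib q)
      ((B.someChart q).1.fibInv_fib q (B.someChart q).2.2 (c.1.fibInv q y)).symm
  change IsScOperator _ _ (c'.1.fib q ∘ₗ c.1.fibInv q)
  rw [e]
  exact h2.comp h1

variable {f s : ∀ x, Y x} {N : Set X}

theorem exists_isSectionDeriv (hf : B.IsScSmoothSection f) (hq : M.IsSmoothPoint q)
    (hqN : q ∈ N) (hs : B.IsScPlusSectionOn N s) (c : B.ChartAt q) :
    ∃ Df Ds : c.1.base.S.amb.lvl 0 →L[ℝ] c.1.R.F.lvl 0,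
      ScGermAt c.1.base.S.amb c.1.R.F (c.1.base.S.hat c.1.base.φ.target)
        (fun z => c.1.localRep f (c.1.base.S.retr z)) (c.1.base.φ q) Df ∧
      ScBanach.IsScPlusOperator c.1.base.S.amb c.1.R.F
        (Ds : c.1.base.S.amb.lvl 0 →ₗ[ℝ] c.1.R.F.lvl 0) ∧
      c.1.IsSectionDeriv N (fun x => f x - s x) q (Df - Ds) := by
  have hmem := φ_mem_dom (c := c.1.base) c.2.2 hqN
  have hf' := hf c.1 c.2.1
  have hs' := hs c.1 c.2.1
  obtain ⟨Df, hDf⟩ := ScSmooth.exists_germ hf'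
    (StrongBundleChart.φ_mem_hat_target c.2.2) (hq c.toBase)
  obtain ⟨Ds, hDs, hDsp⟩ := hs'.exists_germ hmem (hq c.toBase)
  have e : ∀ z, c.1.localRep (fun x => f x - s x) z = c.1.localRep f z - c.1.localRep s z :=
    fun z => map_sub _ _ _
  refine ⟨Df, Ds, hDf, hDsp, ?_, ?_⟩
  · exact ((hDf.mono StrongBundleChart.dom_subset_hat_target hmem).sub hDs).congr
      fun z _ => e _
  · have h := (ScC1On.mono hf'.scC1On StrongBundleChart.dom_subset_hat_target).sub hs'.scC1On
    simp only [e]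
    exact h

/-- Chart independence: both `A` and the tangent coordinates transform by the transition maps, the
former because `f - s` vanishes at `q`. It moves the computation from the chosen chart to the one
carrying the filler. -/
theorem linearization_apply (hf : B.IsScSmoothSection f) (hq : M.IsSmoothPoint q) (hN : IsOpen N)
    (hqN : q ∈ N) (hs : B.IsScPlusSectionOn N s) (hsq : s q = f q) (c : B.ChartAt q)
    {A : c.1.base.S.amb.lvl 0 →L[ℝ] c.1.R.F.lvl 0}
    (hA : c.1.IsSectionDeriv N (fun x => f x - s x) q A) (h : M.TangentSpace q) :
    B.linearization f s q h = c.1.fibInv q (A (M.tangentCoord q c.toBase h)) := by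
  obtain ⟨Df, Ds, -, -, hA'⟩ := exists_isSectionDeriv hf hq hqN hs (B.someChart q)
  obtain ⟨G, hG, hqG, hl⟩ := exists_dom_local hN (B.someChart q).2.2 hqN
  have h1 : (B.someChart q).1.base.S.tangentMap (B.someChart q).1.base.φ.target
      (B.someChart q).1.R.F ((B.someChart q).1.localRep (fun x => f x - s x))
      ((B.someChart q).1.base.φ q) = Df - Ds :=
    hA'.germ.scDeriv_eq_of_local (B.someChart q).1.isScDomain_hat_target
      (StrongBundleChart.φ_mem_hat_target (B.someChart q).2.2) hG hqG
      (fun z hz => by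
        have hz' := hl univ ⟨by rw [← hat_target]; exact hz.1, hz.2⟩
        rwa [inter_univ] at hz') fun _ _ => rfl
  have h2 := hA.change hA' (c.2.1.2 _ (B.someChart_mem q)).1 hN hqN c.2.2 (B.someChart q).2.2
    (by rw [hsq, sub_self]) (M.tangentCoord q c.toBase h)
  have h3 := MPolyfold.tangentTransition_tangentCoord c.toBase (B.someChart q).toBase h
  calc B.linearization f s q h
      = (B.someChart q).1.fibInv q
          ((Df - Ds) (M.tangentCoord q (B.someChart q).toBase h)) :=
        congrArg (fun T : (B.someChart q).1.base.S.amb.lvl 0 →L[ℝ] (B.someChart q).1.R.F.lvl 0 =>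
          (B.someChart q).1.fibInv q (T (M.tangentCoord q (B.someChart q).toBase h))) h1
    _ = (B.someChart q).1.fibInv q ((B.someChart q).1.fib q
          (c.1.fibInv q (A (M.tangentCoord q c.toBase h)))) :=
        congrArg ((B.someChart q).1.fibInv q) ((congrArg (Df - Ds) h3.symm).trans h2)
    _ = _ := (B.someChart q).1.fibInv_fib q (B.someChart q).2.2 _

/-- In a chart with a filler, the linearization of a section and that of its filled version form a
block decomposition. -/
theorem exists_isScBlock (hq : M.IsSmoothPoint q) (hN : IsOpen N)
    (c : B.ChartAt q) {g : ∀ x, Y x} (hg : g q = 0)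
    {A : c.1.base.S.amb.lvl 0 →L[ℝ] c.1.R.F.lvl 0} (hA : c.1.IsSectionDeriv N g q A)
    {L : M.TangentSpace q →ₗ[ℝ] Y q}
    (hL : ∀ h, L h = c.1.fibInv q (A (M.tangentCoord q c.toBase h))) (fc : Filler c.1.R) :
    ∃ Φ : c.1.base.S.amb.lvl 0 →L[ℝ] c.1.R.F.lvl 0,
      ScGermAt c.1.base.S.amb c.1.R.F (c.1.base.S.hat c.1.base.φ.target) fc.principal
        (c.1.base.φ q) Φ ∧
      ∃ (Ψ : c.1.R.F.lvl 0 →ₗ[ℝ] c.1.base.S.amb.lvl 0),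
        IsScBlock c.1.base.S.amb.filtration (M.tangentFiltration q) c.1.R.F.filtration
          (B.fiberFiltration q) ((A + Φ : c.1.base.S.amb.lvl 0 →L[ℝ] c.1.R.F.lvl 0) :
            c.1.base.S.amb.lvl 0 →ₗ[ℝ] c.1.R.F.lvl 0) L Ψ (M.tangentCoord q c.toBase)
          (MPolyfold.tangentMk hq c.toBase) (c.1.fib q) (c.1.fibInv q) := by
  have hqc : q ∈ c.1.base.φ.source := c.2.2
  have hz := hq c.toBase
  have hzO := c.1.base.φ.map_source hqc
  have hP := isRetrDeriv_tangentTransition (c := c.1.base) hqc hz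
  set P := c.1.base.tangentTransition c.1.base q with hPdef
  set z := c.1.base.φ q with hzdef
  obtain ⟨Φ, hΦ, hΦT⟩ := fc.exists_germ_principal c.1.isScDomain_hat_target (φ_mem_core hqc)
    hzO hz hP
  have hAP : ∀ δ, A (P δ) = A δ :=
    hP.comp_eq (φ_mem_core hqc) (isScDomain_dom hN) hA.germ hA.scC1On
  have hπ : ∀ δ : c.1.base.S.amb.lvl 0, c.1.base.S.π z.1 (δ.2 - (P δ).2) = 0 :=
    Filler.π_sub_eq_zero hP
  have hP0 : ∀ δ, P δ = 0 → A δ = 0 := fun δ hδ => by rw [← hAP, hδ, map_zero]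
  have hinv0 : ∀ y, c.1.R.ρ z y = 0 → c.1.fibInv q y = 0 := fun y hy => by
    rw [← c.1.fibInv_fib q hqc (c.1.fibInv q y), c.1.fib_fibInv q hqc, hy, map_zero]
  have hcoord : ∀ h, P (M.tangentCoord q c.toBase h) = M.tangentCoord q c.toBase h := fun h =>
    MPolyfold.tangentTransition_tangentCoord c.toBase c.toBase h
  have hfibL : ∀ h, c.1.fib q (L h) = A (M.tangentCoord q c.toBase h) := fun h => by
    rw [hL, c.1.fib_fibInv q hqc]
    exact hA.ρ_apply hN hqc hg _
  have hT := fc.smooth_invFun.isScOperator_fibre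
    (T := fc.invFun z ∘ₗ (LinearMap.id - (c.1.R.ρ z : c.1.R.F.lvl 0 →ₗ[ℝ] c.1.R.F.lvl 0)))
    hΦ.mem hz fun y => by
      change fc.invFun (c.1.base.S.retr z) (y - c.1.R.ρ (c.1.base.S.retr z) y) =
        fc.invFun z (y - c.1.R.ρ z y)
      rw [hzdef, retr_φ hqc]
  have hΨT : ∀ y, c.1.R.ρ z y = 0 →
      (fc.invFun z ∘ₗ (LinearMap.id - (c.1.R.ρ z : c.1.R.F.lvl 0 →ₗ[ℝ] c.1.R.F.lvl 0))) y =
        fc.invFun z y := fun y hy => by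
    change fc.invFun z (y - c.1.R.ρ z y) = _
    rw [hy, sub_zero]
  set T := fc.invFun z ∘ₗ (LinearMap.id - (c.1.R.ρ z : c.1.R.F.lvl 0 →ₗ[ℝ] c.1.R.F.lvl 0))
  -- The inverse of the filler at `z`, made into an operator on all of `F` by first applying `1 -
  -- ρ_z`, with values placed in the vertical factor `E`.
  refine ⟨Φ, hΦ, LinearMap.prod 0 T, ?_⟩
  exact
    { sc_D := hA.germ.op.add (ScBanach.filtration_isRegular _) hΦ.op
      sc_Ψ := ScBanach.isScOperator_prod ScBanach.IsScPlusOperator.zero.isScOperator hT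
      sc_iE := MPolyfold.isScOperator_tangentCoord c.toBase
      sc_pE := MPolyfold.isScOperator_tangentMk hq c.toBase
      sc_iF := isScOperator_fib c
      sc_pF := isScOperator_fibInv hq c
      pE_iE := MPolyfold.tangentMk_tangentCoord hq c.toBase
      pF_iF := c.1.fibInv_fib q hqc
      -- `Φ` vanishes on tangent vectors, which `P` fixes, and `A` maps them into `im ρ_z`. In
      -- `pF_D`, dually, `Φ` takes values in `ker ρ_z`.
      D_iE := fun h => by
        rw [hfibL]
        refine (congrArg (A _ + ·) ?_).trans (add_zero _)
        refine (hΦT _).trans ((congrArg (fc.toFun _) ?_).trans (map_zero (fc.toFun _)))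
        exact sub_eq_zero.2 (congrArg Prod.snd (hcoord h)).symm
      pF_D := fun δ => by
        rw [hL]
        have h1 : A (M.tangentCoord q c.toBase (MPolyfold.tangentMk hq c.toBase δ)) = A δ := hAP δ
        have h2 : c.1.fibInv q (Φ δ) = 0 := hinv0 _ (by
          rw [hΦT]
          exact fc.map_toFun z hzO _ (hπ δ))
        refine Eq.trans ?_ (congrArg (c.1.fibInv q) h1).symm
        change c.1.fibInv q (A δ + Φ δ) = _
        rw [map_add, h2, add_zero]
      -- The hypothesis says `P δ = 0`. Then `δ` is vertical, `A δ = A (P δ) = 0`, and `A + Φ` acts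
      -- on `δ` as the filler.
      Ψ_D := fun δ hδ => by
        have hPδ : P δ = 0 :=
          (congrArg (M.tangentCoord q c.toBase) hδ).trans (map_zero (M.tangentCoord q c.toBase))
        have h0 := hπ δ
        have h1 := hΦT δ
        rw [hPδ] at h0 h1
        have e : δ.2 - (0 : c.1.base.S.amb.lvl 0).2 = δ.2 := sub_zero _
        rw [e] at h0 h1
        have h2 : (A + Φ) δ = fc.toFun z δ.2 := by
          change A δ + Φ δ = _
          rw [hP0 δ hPδ, h1, zero_add]
        refine Prod.ext ?_ ?_
        · exact (congrArg Prod.fst hPδ).symm.trans (hP.fst δ)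
        · refine (congrArg T h2).trans ?_
          rw [hΨT _ (fc.map_toFun z hzO _ h0), fc.left_inv z hzO _ h0]
      D_Ψ := fun y hy => by
        have hρ : c.1.R.ρ z y = 0 := by
          rw [← c.1.fib_fibInv q hqc, hy, map_zero]
        have h0 := fc.map_invFun z hzO y hρ
        have hPδ : P ((0, T y) : c.1.base.S.W.lvl 0 × c.1.base.S.E.lvl 0) = 0 :=
          (hP.vert _).trans (Prod.ext rfl ((congrArg _ (hΨT y hρ)).trans h0))
        have h1 := hΦT ((0, T y) : c.1.base.S.W.lvl 0 × c.1.base.S.E.lvl 0)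
        have e : (((0, T y) : c.1.base.S.W.lvl 0 × c.1.base.S.E.lvl 0)).2 -
            (P ((0, T y) : c.1.base.S.W.lvl 0 × c.1.base.S.E.lvl 0)).2 = fc.invFun z y :=
          (congrArg (fun w : c.1.base.S.amb.lvl 0 => T y - w.2) hPδ).trans
            ((sub_zero _).trans (hΨT y hρ))
        change A ((0, T y) : c.1.base.S.W.lvl 0 × c.1.base.S.E.lvl 0) +
          Φ ((0, T y) : c.1.base.S.W.lvl 0 × c.1.base.S.E.lvl 0) = y
        exact (congrArg₂ (· + ·) (hP0 _ hPδ) (h1.trans ((congrArg _ e).trans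
          (fc.right_inv z hzO y hρ)))).trans (zero_add y) }

end StrongBundle

/-! ### Comparison of the two linearizations -/

theorem mainTheorem6 {X : Type v} [TopologicalSpace X] [T2Space X] [SecondCountableTopology X]
    (M : MPolyfold.{u} X) {Y : X → Type w}
    [∀ x, AddCommGroup (Y x)] [∀ x, Module ℝ (Y x)]
    [TopologicalSpace (Bundle.TotalSpace Unit Y)] [T2Space (Bundle.TotalSpace Unit Y)]
    [SecondCountableTopology (Bundle.TotalSpace Unit Y)]
    (B : StrongBundle M Y) (hB : B.IsFillable)
    -- an sc-smooth section and a smooth point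
    (f : ∀ x, Y x) (hf : B.IsScSmoothSection f)
    (q : X) (hq : M.IsSmoothPoint q)
    -- a germ of an sc-plus-section at the point, with the same value there
    (s : ∀ x, Y x) (N : Set X) (hN : IsOpen N) (hqN : q ∈ N) (hs : B.IsScPlusSectionOn N s)
    (hsq : s q = f q)
    -- a strong bundle chart around the point with a filler, which defines the filled version
    (c : StrongBundleChart.{u} X Y) (hc : c ∈ B.maximalAtlas) (hqc : q ∈ c.base.φ.source)
    (fc : Filler c.R)
    -- a germ of an sc-plus-section at the corresponding point, with the value of the filled version
    (t : c.base.S.amb.lvl 0 → c.R.F.lvl 0) (N' : Set (c.base.S.amb.lvl 0)) (hN' : IsOpen N')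
    (hqN' : c.base.φ q ∈ N')
    (ht : ScPlusSmooth c.base.S.amb c.R.F (c.base.S.hat c.base.φ.target ∩ N') t)
    (htq : t (c.base.φ q) = c.filled fc f (c.base.φ q)) :
    (IsScFredholm (M.tangentFiltration q) (B.fiberFiltration q) (B.linearization f s q) ↔
      IsScFredholm c.base.S.amb.filtration c.R.F.filtration
        (c.filledLinearization fc f t (c.base.φ q) :
          c.base.S.amb.lvl 0 →ₗ[ℝ] c.R.F.lvl 0)) ∧
    (IsScFredholm (M.tangentFiltration q) (B.fiberFiltration q) (B.linearization f s q) →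
      fredholmIndex (B.linearization f s q) =
        fredholmIndex (c.filledLinearization fc f t (c.base.φ q) :
          c.base.S.amb.lvl 0 →ₗ[ℝ] c.R.F.lvl 0)) := by
  obtain ⟨Df, Ds, hDf, hDs, hA⟩ := StrongBundle.exists_isSectionDeriv hf hq hqN hs ⟨c, hc, hqc⟩
  obtain ⟨Φ, hΦ, Ψ, hblock⟩ := StrongBundle.exists_isScBlock hq hN ⟨c, hc, hqc⟩
    (by rw [hsq, sub_self]) hA
    (StrongBundle.linearization_apply hf hq hN hqN hs hsq ⟨c, hc, hqc⟩ hA) fc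
  have hmem := StrongBundleChart.φ_mem_hat_target hqc
  obtain ⟨Dt, hDt, hDtp⟩ := ht.exists_germ ⟨hmem, hqN'⟩ hDf.smooth
  have h1 := ((hDf.add hΦ).mono inter_subset_left ⟨hmem, hqN'⟩).sub hDt
  -- `t` is controlled only on `N'`, which suffices because the sc-derivative depends on the germ
  -- alone.
  have h2 : c.filledLinearization fc f t (c.base.φ q) = Df + Φ - Dt :=
    h1.scDeriv_eq_of_local c.isScDomain_hat_target hmem hN' hqN' Subset.rfl fun _ _ => rfl
  have h3 := hblock.isScFredholm_iff (hDs.sub hDtp)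
  -- Regroup as the block operator `(Df - Ds) + Φ` plus `Ds - Dt`; the latter is an `sc⁺`-operator
  -- because both `s` and `t` are `sc⁺`.
  have h4 : (c.filledLinearization fc f t (c.base.φ q) :
      c.base.S.amb.lvl 0 →ₗ[ℝ] c.R.F.lvl 0) =
      ((Df - Ds + Φ : c.base.S.amb.lvl 0 →L[ℝ] c.R.F.lvl 0) :
        c.base.S.amb.lvl 0 →ₗ[ℝ] c.R.F.lvl 0) +
      ((Ds : c.base.S.amb.lvl 0 →ₗ[ℝ] c.R.F.lvl 0) - Dt) := by
    rw [h2]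
    ext δ
    change Df δ + Φ δ - Dt δ = Df δ - Ds δ + Φ δ + (Ds δ - Dt δ)
    abel
  rw [h4]
  exact h3
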